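/- Consider an FCFS single-server M/G/1/M update-and-decide system that starts empty at time $0$: updates $k=1,2,\dots$ are generated and arrive at the times $t_k$ of a Poisson process of rate $\lambda>0$; the service times $S_k\ge 0$ are i.i.d. with mean $1/\mu\in(0,\infty)$ and $\mathbb{E}[S_k^2]<\infty$; decisions are made at the epochs $\tau_1<\tau_2<\cdots$ of a Poisson process of rate $\nu>0$; the arrivals, service times and decisions are independent; and $\rho=\lambda/\mu<1$. Let $t_k'$ be the departure (reception) time of update $k$ and $T_k=t_k'-t_k$ its system time, and put $t_0=t_0'=0$. The age upon decision at $\tau_j$ is $\Delta_{\mathrm D}(\tau_j)=\tau_j-t_{N(\tau_j)}$, where $N(\tau)=\max\{k\ge 0: t_k'\le\tau\}$. Let $N_T$ be the number of decisions made up to time $T$, let $G_{\mathrm S}(s)=\mathbb{E}[e^{sS_k}]$, and set $$\omega=\frac{(1-\rho)\,(G_{\mathrm S}(-\lambda)-1)}{\lambda\,G_{\mathrm S}(-\lambda)}.$$ Then the system times $T_k$ converge in distribution to a steady-state system time $T_\infty$, whose moment generating function $G_{\mathrm T}(s)=\mathbb{E}[e^{sT_\infty}]$ is differentiable at $s=-\lambda$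 with $G_{\mathrm T}'(-\lambda)=-\omega$; and, almost surely, the average age upon decisions exists and equals $$\lim_{T\to\infty}\frac{1}{N_T}\sum_{j=1}^{N_T}\Delta_{\mathrm D}(\tau_j)=\frac{\lambda^2\,\mathbb{E}[S_k^2]+2(1-\rho)(1-\lambda\omega)}{2\lambda(1-\rho)}.$$ -/

import Mathlib

open MeasureTheory ProbabilityTheory Filter Topology

namespace UpdateDecide

/-! ## Sample paths of an FCFS single-server update-and-decide system

The system is empty at time `0`. Updates are numbered `1, 2, ...`; `x k`, `s k` and `z k` are the
`(k+1)`-st inter-arrival time, the service time of update `k + 1`, and the `(k+1)`-st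
inter-decision time. The index `0` stands for the time origin: `t₀ = t₀' = τ₀ = 0`. -/

/-- The time `t_k = X_1 + ... + X_k` at which update `k` is generated and arrives. -/
def arrivalTime (x : ℕ → ℝ) (k : ℕ) : ℝ :=
  ∑ i ∈ Finset.range k, x i

/-- The time `t_k'` at which update `k` leaves the FCFS single-server queue, i.e. is received:
its service starts as soon as it has arrived and the previous update has left. -/
noncomputable def departureTime (x s : ℕ → ℝ) : ℕ → ℝ
  | 0 => 0
  | k + 1 => max (departureTime x s k) (arrivalTime x (k + 1)) + s k

/-- The system time (waiting time plus service time) `T_k = t_k' - t_k` of update `k`. -/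
noncomputable def systemTime (x s : ℕ → ℝ) (k : ℕ) : ℝ :=
  departureTime x s k - arrivalTime x k

/-- The epoch `τ_j = Z_1 + ... + Z_j` of the `j`-th decision. -/
def decisionTime (z : ℕ → ℝ) (j : ℕ) : ℝ :=
  ∑ i ∈ Finset.range j, z i

/-- The index `max {k | t_k' ≤ t}` of the most recently received update at time `t`
(`0` before the first departure). -/
noncomputable def latestReceived (x s : ℕ → ℝ) (t : ℝ) : ℕ :=
  sSup {k : ℕ | departureTime x s k ≤ t}

/-- The age at time `t`: the time elapsed since the generation of the most recently received
update. At a decision epoch this is the age upon decision. -/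
noncomputable def age (x s : ℕ → ℝ) (t : ℝ) : ℝ :=
  t - arrivalTime x (latestReceived x s t)

/-- The number `N_T` of decisions made during the period `(-∞, T]`; all decision epochs
`τ_1, τ_2, ...` are nonnegative when the inter-decision times are. -/
noncomputable def decisionCount (z : ℕ → ℝ) (T : ℝ) : ℕ :=
  Set.ncard {j : ℕ | 1 ≤ j ∧ decisionTime z j ≤ T}

/-- The average of the age upon decisions over the `N_T` decisions made up to time `T`. -/
noncomputable def averageAgeUponDecisions (x s z : ℕ → ℝ) (T : ℝ) : ℝ :=
  (∑ j ∈ Finset.Icc 1 (decisionCount z T), age x s (decisionTime z j)) / decisionCount z T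

/-- The random input of an M/G/1/M update-and-decide system: inter-arrival times `X` that are
exponential of rate `lam` (Poisson arrivals), service times `S` with law `F` on `[0, ∞)`, and
inter-decision times `Z` that are exponential of rate `nu` (Poisson decisions), all of them
mutually independent. -/
structure IsMG1MInput {Ω : Type*} [MeasurableSpace Ω] (P : Measure Ω) (lam nu : ℝ)
    (F : Measure ℝ) (X S Z : ℕ → Ω → ℝ) : Prop where
  interarrival_law : ∀ k, HasLaw (X k) (expMeasure lam) P
  service_law : ∀ k, HasLaw (S k) F P
  service_nonneg : F (Set.Iio 0) = 0
  interdecision_law : ∀ k, HasLaw (Z k) (expMeasure nu) P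
  indep : iIndepFun (Sum.elim X (Sum.elim S Z)) P

end UpdateDecide

-- Decisions are independent of the queue, so Poisson sampling sees time averages. The time average
-- of the age is an area per update times the arrival rate. Between the departures of updates `n`
-- and `n + 1` the age is `t - t_n`. Its area is `T_{n+1} X + X²/2` plus half the increment of `T²`,
-- where `X` is the inter-arrival time, and the increments telescope.
--
-- The area needs only three stationary averages, those of `T`, `e^{-λT}` and `T e^{-λT}`, because
-- the mean of `T_{n+1} X` given `T_n` is explicit for exponential `X`. Each average comes from
-- balancing the one-step drift of a test function under Lindley's recursion `T_{n+1} = (T_n - X)⁺ +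
-- S`. The function `t` gives `E e^{-λT} = 1 - ρ`. The function `e^{-λt}` gives `E[T e^{-λT}] = -ω`,
-- the derivative of the generating function at `-λ`. The functions `e^{-rt}`, `r ↓ 0`, together
-- with `t²`, give the Pollaczek-Khinchine mean.
--
-- Steady state comes from Loynes' construction: with the inputs reversed, the system times increase
-- to a limit `L` and keep their one-dimensional laws. The quadratic drift bounds their means, so
-- `L` is integrable (`exists_backwardTime_limit`).
--
-- Almost sure averages use martingale convergence and Kronecker's lemma twice. Along the chain
-- (`IsBackwardLimit.ae_tendsto_average_sub_mean`) the second moment of `T` may be infinite when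
-- only `E[S²]` is finite. System times are therefore truncated at their index, and `E L < ∞`
-- suffices for summable variances. At the decision epochs (`ae_tendsto_sum_sub_integral_div`),
-- `a(τ_{n+1}) - ν ∫ a` over `(τ_n, τ_{n+1}]` is a martingale difference. Its normalized variances
-- are summable because the age rises at most at unit rate and so is controlled by the square root
-- of its integral.

namespace UpdateDecide

/-! ## Martingale convergence on a product space -/

/-- `f` only depends on the first `n` coordinates. -/
def DependsOnPast {E γ : Type*} (n : ℕ) (f : (ℕ → E) → γ) : Prop :=
  ∀ v w : ℕ → E, (∀ i < n, v i = w i) → f v = f w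

theorem DependsOnPast.update {E γ : Type*} {n : ℕ} {f : (ℕ → E) → γ} (h : DependsOnPast n f)
    (v : ℕ → E) (e : E) : f (Function.update v n e) = f v :=
  h _ _ fun _ hi => Function.update_of_ne hi.ne _ _

section ProductSpace

variable {E : Type*} [MeasurableSpace E] (κ : Measure E) [IsProbabilityMeasure κ]

/-- Resampling one coordinate independently does not change a product measure. This replaces
conditioning on the past: a function of the first `n` coordinates does not notice the resampling of
coordinate `n`. -/
theorem measurePreserving_update (n : ℕ) :
    MeasurePreserving (fun p : (ℕ → E) × E => Function.update p.1 n p.2)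
      ((Measure.infinitePi fun _ : ℕ => κ).prod κ) (Measure.infinitePi fun _ : ℕ => κ) := by
  have hm : Measurable (fun p : (ℕ → E) × E => Function.update p.1 n p.2) := by
    refine measurable_pi_iff.2 fun i => ?_
    by_cases h : i = n
    · subst h; simpa using measurable_snd
    · simp only [Function.update_of_ne h]; fun_prop
  refine ⟨hm, Measure.eq_infinitePi _ fun s t ht => ?_⟩
  rw [Measure.map_apply hm (MeasurableSet.pi s.countable_toSet fun i _ => ht i)]
  have : (fun p : (ℕ → E) × E => Function.update p.1 n p.2) ⁻¹' (Set.pi s t) =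
      (Set.pi (s.erase n) t) ×ˢ (if n ∈ s then t n else Set.univ) := by
    ext ⟨v, e⟩
    simp only [Set.mem_preimage, Set.mem_pi, Set.mem_prod, Finset.mem_coe, Finset.mem_erase]
    constructor
    · intro h
      refine ⟨fun i hi => by simpa [Function.update_of_ne hi.1] using h i hi.2, ?_⟩
      split_ifs with hn
      · simpa using h n hn
      · trivial
    · rintro ⟨h1, h2⟩ i hi
      by_cases h : i = n
      · subst h; simpa [hi] using h2
      · simpa [Function.update_of_ne h] using h1 i ⟨h, hi⟩
  rw [this, Measure.prod_prod, Measure.infinitePi_pi _ (fun i _ => ht i)]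
  split_ifs with hn
  · rw [Finset.prod_erase_mul _ _ hn]
  · simp [Finset.erase_eq_of_notMem hn]

variable {κ}

theorem lintegral_eval_past {n : ℕ} {f : (ℕ → E) → E → ENNReal}
    (hf : Measurable (Function.uncurry f)) (hd : DependsOnPast n f) :
    ∫⁻ v, f v (v n) ∂(Measure.infinitePi fun _ : ℕ => κ) =
      ∫⁻ v, ∫⁻ e, f v e ∂κ ∂(Measure.infinitePi fun _ : ℕ => κ) := by
  have hg : Measurable fun v : ℕ → E => f v (v n) :=
    hf.comp (measurable_id.prodMk (measurable_pi_apply n))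
  rw [← (measurePreserving_update κ n).lintegral_comp hg, lintegral_lintegral hf.aemeasurable]
  refine lintegral_congr fun p => ?_
  simp [hd.update]

theorem integrable_eval_past_iff {n : ℕ} {f : (ℕ → E) → E → ℝ}
    (hf : Measurable (Function.uncurry f)) (hd : DependsOnPast n f) :
    Integrable (fun v => f v (v n)) (Measure.infinitePi fun _ : ℕ => κ) ↔
      Integrable (Function.uncurry f) ((Measure.infinitePi fun _ : ℕ => κ).prod κ) := by
  have hg : Measurable fun v : ℕ → E => f v (v n) :=
    hf.comp (measurable_id.prodMk (measurable_pi_apply n))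
  rw [← (measurePreserving_update κ n).integrable_comp hg.aestronglyMeasurable]
  refine integrable_congr (ae_of_all _ fun p => ?_)
  simp [hd.update, Function.uncurry]

theorem integral_eval_past {n : ℕ} {f : (ℕ → E) → E → ℝ}
    (hf : Measurable (Function.uncurry f)) (hd : DependsOnPast n f)
    (hi : Integrable (fun v => f v (v n)) (Measure.infinitePi fun _ : ℕ => κ)) :
    ∫ v, f v (v n) ∂(Measure.infinitePi fun _ : ℕ => κ) =
      ∫ v, ∫ e, f v e ∂κ ∂(Measure.infinitePi fun _ : ℕ => κ) := by
  have hg : Measurable fun v : ℕ → E => f v (v n) :=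
    hf.comp (measurable_id.prodMk (measurable_pi_apply n))
  have hmp := measurePreserving_update κ n
  have h1 : ∫ v, f v (v n) ∂(Measure.infinitePi fun _ : ℕ => κ) =
      ∫ p, f (Function.update p.1 n p.2) (Function.update p.1 n p.2 n)
        ∂((Measure.infinitePi fun _ : ℕ => κ).prod κ) := by
    conv_lhs => rw [← hmp.map_eq]
    rw [integral_map hmp.measurable.aemeasurable hg.aestronglyMeasurable]
  rw [h1, integral_integral ((integrable_eval_past_iff hf hd).1 hi)]
  refine integral_congr_ae (ae_of_all _ fun p => ?_)
  simp [hd.update]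

/-- The filtration of the past of the coordinate process. -/
def pastFiltration (E : Type*) [mE : MeasurableSpace E] :
    Filtration ℕ (inferInstance : MeasurableSpace (ℕ → E)) where
  seq n := MeasurableSpace.comap (fun v (i : Fin n) => v i) inferInstance
  mono' m n hmn := by
    rintro _ ⟨B, hB, rfl⟩
    refine ⟨(fun (w : Fin n → E) (i : Fin m) => w ⟨i, i.2.trans_le hmn⟩) ⁻¹' B, ?_, rfl⟩
    exact (by fun_prop : Measurable fun (w : Fin n → E) (i : Fin m) =>
      w ⟨i, i.2.trans_le hmn⟩) hB
  le' n := Measurable.comap_le (by fun_prop)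

/-- Padding a word of length `n` with a fixed point of `E` factors `f` through the restriction map
that generates the σ-algebra. -/
theorem DependsOnPast.measurable_past {γ : Type*} [MeasurableSpace γ] [Nonempty E] {n : ℕ}
    {f : (ℕ → E) → γ}
    (h : DependsOnPast n f) (hf : Measurable f) : Measurable[pastFiltration E n] f := by
  classical
  let ext : (Fin n → E) → ℕ → E := fun w i =>
    if hi : i < n then w ⟨i, hi⟩ else Classical.arbitrary E
  have hext : Measurable ext := by
    refine measurable_pi_iff.2 fun i => ?_
    by_cases hi : i < n <;> simp only [ext, hi, dite_true, dite_false] <;> fun_prop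
  have : f = (f ∘ ext) ∘ fun v (i : Fin n) => v i := by
    funext v
    refine h _ _ fun i hi => ?_
    simp [ext, hi]
  rw [this]
  exact (hf.comp hext).comp (comap_measurable _)

theorem dependsOnPast_of_measurableSet {n : ℕ} {s : Set (ℕ → E)}
    (hs : MeasurableSet[pastFiltration E n] s) {γ : Type*} [Zero γ] {g : (ℕ → E) → γ}
    (hg : DependsOnPast n g) : DependsOnPast n (s.indicator g) := by
  obtain ⟨B, -, rfl⟩ := hs
  intro v w hvw
  have : (fun i : Fin n => v i) = fun i : Fin n => w i := funext fun i => hvw i i.2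
  classical
  simp only [Set.indicator_apply, Set.mem_preimage, this, hg v w hvw]

variable (κ) in
/-- A series of martingale differences on a product space with summable variances converges. -/
theorem ae_exists_tendsto_sum_of_mean_zero (D : ℕ → (ℕ → E) → E → ℝ)
    (hD : ∀ n, Measurable (Function.uncurry (D n))) (hdep : ∀ n, DependsOnPast n (D n))
    (hzero : ∀ n v, ∫ e, D n v e ∂κ = 0)
    (hsq : ∑' n, ∫⁻ v, ∫⁻ e, ENNReal.ofReal (D n v e ^ 2) ∂κ
      ∂(Measure.infinitePi fun _ : ℕ => κ) ≠ ⊤) :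
    ∀ᵐ v ∂(Measure.infinitePi fun _ : ℕ => κ),
      ∃ c, Tendsto (fun n => ∑ i ∈ Finset.range n, D i v (v i)) atTop (𝓝 c) := by
  set Q := Measure.infinitePi fun _ : ℕ => κ with hQ
  have : Nonempty E := nonempty_of_isProbabilityMeasure κ
  let d : ℕ → (ℕ → E) → ℝ := fun n v => D n v (v n)
  have hdm : ∀ n, Measurable (d n) := fun n =>
    (hD n).comp (measurable_id.prodMk (measurable_pi_apply n))
  let M : ℕ → (ℕ → E) → ℝ := fun n v => ∑ i ∈ Finset.range n, d i v
  have hMm : ∀ n, Measurable (M n) := fun n => Finset.measurable_fun_sum _ fun i _ => hdm i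
  have hdd : ∀ n, DependsOnPast (n + 1) (d n) := fun n v w h => by
    simp only [d]
    rw [hdep n v w fun i hi => h i (by omega), h n (by omega)]
  have hMd : ∀ n, DependsOnPast n (M n) := fun n v w h =>
    Finset.sum_congr rfl fun i hi => hdd i v w fun j hj =>
      h j (by have := Finset.mem_range.1 hi; omega)
  have hd2 : ∀ n, ∫⁻ v, ENNReal.ofReal (d n v ^ 2) ∂Q =
      ∫⁻ v, ∫⁻ e, ENNReal.ofReal (D n v e ^ 2) ∂κ ∂Q := fun n =>
    lintegral_eval_past (f := fun v e => ENNReal.ofReal (D n v e ^ 2))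
      (ENNReal.measurable_ofReal.comp ((hD n).pow_const 2))
      (fun v w h => by simp only [hdep n v w h])
  have hdL : ∀ n, MemLp (d n) 2 Q := fun n => by
    rw [memLp_two_iff_integrable_sq (hdm n).aestronglyMeasurable]
    refine ⟨((hdm n).pow_const 2).aestronglyMeasurable, ?_⟩
    rw [hasFiniteIntegral_iff_ofReal (ae_of_all _ fun v => sq_nonneg _), hd2]
    exact (ENNReal.ne_top_of_tsum_ne_top hsq n).lt_top
  have hML : ∀ n, MemLp (M n) 2 Q := fun n => memLp_finsetSum _ fun i _ => hdL i
  -- Integrating out coordinate `n` kills the increment. Indicators of past events as `g` give the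
  -- martingale property; `g = M n` gives the orthogonality behind the variance formula.
  have horth : ∀ n, ∀ g : (ℕ → E) → ℝ, Measurable g → DependsOnPast n g → MemLp g 2 Q →
      ∫ v, g v * d n v ∂Q = 0 := by
    intro n g hg hgd hgL
    have := integral_eval_past (κ := κ) (n := n) (f := fun v e => g v * D n v e)
      ((hg.comp measurable_fst).mul (hD n))
      (fun v w h => by simp only [hdep n v w h, hgd v w h]) (hgL.integrable_mul (hdL n))
    rw [this]
    simp [integral_const_mul, hzero]
  have hmart : Martingale M (pastFiltration E) Q := by
    refine martingale_of_setIntegral_eq_succ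
      (fun n => ((hMd n).measurable_past (hMm n)).stronglyMeasurable)
      (fun n => (hML n).integrable one_le_two) fun n s hs => ?_
    have hs' := (pastFiltration E).le n s hs
    have h0 := horth n (s.indicator fun _ => 1) (measurable_const.indicator hs')
      (dependsOnPast_of_measurableSet hs fun _ _ _ => rfl)
      ((memLp_const 1).indicator hs')
    have h1 : ∫ v in s, d n v ∂Q = 0 := by
      rw [← integral_indicator hs', ← h0]
      congr 1
      ext v
      by_cases hv : v ∈ s <;> simp [hv]
    have h2 : ∀ v, M (n + 1) v = M n v + d n v := fun v => Finset.sum_range_succ _ _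
    simp only [h2]
    rw [integral_add ((hML n).integrable one_le_two).integrableOn
      ((hdL n).integrable one_le_two).integrableOn, h1, add_zero]
  have hM2 : ∀ n, ∫ v, M n v ^ 2 ∂Q = ∑ i ∈ Finset.range n, ∫ v, d i v ^ 2 ∂Q := by
    intro n
    induction n with
    | zero => simp [M]
    | succ n ih =>
      have h2 : ∀ v, M (n + 1) v ^ 2 = M n v ^ 2 + 2 * (M n v * d n v) + d n v ^ 2 := fun v => by
        have : M (n + 1) v = M n v + d n v := Finset.sum_range_succ _ _
        rw [this]; ring
      simp only [h2]
      rw [integral_add, integral_add, integral_const_mul, horth n _ (hMm n) (hMd n) (hML n), ih,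
        Finset.sum_range_succ]
      · ring
      · exact (hML n).integrable_sq
      · exact ((hML n).integrable_mul (hdL n)).const_mul 2
      · exact (hML n).integrable_sq.add (((hML n).integrable_mul (hdL n)).const_mul 2)
      · exact (hdL n).integrable_sq
  set R := ∑' n, ∫⁻ v, ∫⁻ e, ENNReal.ofReal (D n v e ^ 2) ∂κ ∂Q with hR
  have hlM2 : ∀ n, ∫⁻ v, ENNReal.ofReal (M n v ^ 2) ∂Q ≤ R := fun n => by
    rw [← ofReal_integral_eq_lintegral_ofReal (hML n).integrable_sq
      (ae_of_all _ fun v => sq_nonneg _), hM2,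
      ENNReal.ofReal_sum_of_nonneg fun i _ => integral_nonneg fun v => sq_nonneg _]
    refine le_trans (le_of_eq (Finset.sum_congr rfl fun i _ => ?_)) (ENNReal.sum_le_tsum (Finset.range n))
    rw [ofReal_integral_eq_lintegral_ofReal (hdL i).integrable_sq
      (ae_of_all _ fun v => sq_nonneg _), hd2]
  -- The convergence theorem asks for a bound in `L¹`; it follows from `|x| ≤ x² + 1`.
  have hbdd : ∀ n, eLpNorm (M n) 1 Q ≤ ((R + 1).toNNReal : ENNReal) := fun n => by
    rw [ENNReal.coe_toNNReal (by simp [hsq]), eLpNorm_one_eq_lintegral_enorm]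
    calc ∫⁻ v, ‖M n v‖ₑ ∂Q ≤ ∫⁻ v, (ENNReal.ofReal (M n v ^ 2) + 1) ∂Q := by
          refine lintegral_mono fun v => ?_
          rw [Real.enorm_eq_ofReal_abs, ← ENNReal.ofReal_one, ← ENNReal.ofReal_add (sq_nonneg _)
            zero_le_one]
          refine ENNReal.ofReal_le_ofReal ?_
          rw [← sq_abs]
          nlinarith [sq_nonneg (|M n v| - 1), abs_nonneg (M n v)]
      _ = ∫⁻ v, ENNReal.ofReal (M n v ^ 2) ∂Q + 1 := by
          rw [lintegral_add_right _ measurable_const]; simp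
      _ ≤ R + 1 := by gcongr; exact hlM2 n
  filter_upwards [hmart.submartingale.ae_tendsto_limitProcess hbdd] with v hv
  exact ⟨_, hv⟩

end ProductSpace

/-! ## Kronecker's lemma -/

/-- Summation by parts expresses the sum through the errors `s n` of the convergent series. The
increments of `b` are nonnegative weights with total at most `b n`, so dividing by `b n` averages a
null sequence. -/
theorem tendsto_inv_mul_sum_of_tendsto_sum_div {b d : ℕ → ℝ} (hb0 : ∀ n, 0 < b n)
    (hb : Monotone b) (hbt : Tendsto b atTop atTop) {c : ℝ}
    (hc : Tendsto (fun n => ∑ i ∈ Finset.range n, d i / b i) atTop (𝓝 c)) :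
    Tendsto (fun n => (∑ i ∈ Finset.range n, d i) / b n) atTop (𝓝 0) := by
  set s : ℕ → ℝ := fun n => ∑ i ∈ Finset.range n, d i / b i - c with hs
  have hs0 : Tendsto s atTop (𝓝 0) := by simpa [hs] using hc.sub_const c
  have key : ∀ n, ∑ i ∈ Finset.range n, d i =
      b n * s n - ∑ i ∈ Finset.range n, (b (i + 1) - b i) * s (i + 1) - b 0 * s 0 := by
    intro n
    induction n with
    | zero => simp
    | succ n ih =>
      have : s (n + 1) = s n + d n / b n := by simp [hs, Finset.sum_range_succ]; ring
      rw [Finset.sum_range_succ, Finset.sum_range_succ, ih]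
      have h2 : d n = b n * (s (n + 1) - s n) := by
        rw [this]; field_simp [(hb0 n).ne']; ring
      rw [h2]; ring
  have h1 : (fun n => ∑ i ∈ Finset.range n, (b (i + 1) - b i) * s (i + 1)) =o[atTop] b := by
    have h2 : (fun i => (b (i + 1) - b i) * s (i + 1)) =o[atTop] fun i => b (i + 1) - b i := by
      have : Tendsto (fun i => s (i + 1)) atTop (𝓝 0) := hs0.comp (tendsto_add_atTop_nat 1)
      simpa using (Asymptotics.isBigO_refl (fun i => b (i + 1) - b i) atTop).mul_isLittleO
        ((Asymptotics.isLittleO_one_iff ℝ).2 this)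
    have h3 := h2.sum_range (fun i => sub_nonneg.2 (hb (Nat.le_succ i))) (by
      simp only [Finset.sum_range_sub]
      exact tendsto_atTop_add_const_right _ _ hbt)
    refine h3.trans_isBigO ?_
    simp only [Finset.sum_range_sub]
    refine Asymptotics.IsBigO.of_bound 1 (Eventually.of_forall fun n => ?_)
    rw [Real.norm_of_nonneg (sub_nonneg.2 (hb (Nat.zero_le n))), Real.norm_of_nonneg (hb0 n).le]
    linarith [hb0 0]
  have h2 : Tendsto (fun n => s n - (∑ i ∈ Finset.range n, (b (i + 1) - b i) * s (i + 1)) / b n -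
      b 0 * s 0 / b n) atTop (𝓝 (0 - 0 - 0)) :=
    (hs0.sub h1.tendsto_div_nhds_zero).sub (hbt.const_div_atTop _)
  simp only [sub_zero] at h2
  refine h2.congr fun n => ?_
  rw [key]
  field_simp [(hb0 n).ne']

/-! ## Exponential integrals -/

section Exponential

variable {r : ℝ}

theorem expMeasure_eq_withDensity (r : ℝ) :
    expMeasure r = (volume.restrict (Set.Ioi 0)).withDensity
      fun x => ENNReal.ofReal (r * Real.exp (-(r * x))) := by
  -- The two densities can differ only at the origin.
  have h : (fun x => exponentialPDF r x) =ᵐ[volume]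
      (Set.Ioi (0 : ℝ)).indicator fun x => ENNReal.ofReal (r * Real.exp (-(r * x))) := by
    filter_upwards [Measure.ae_ne volume (0 : ℝ)] with x hx
    rw [exponentialPDF_eq, Set.indicator_apply]
    rcases lt_or_gt_of_ne hx with h | h
    · simp [h.not_ge, h.not_gt]
    · simp [h, h.le]
  rw [← withDensity_indicator measurableSet_Ioi, ← withDensity_congr_ae h]
  rfl

theorem lintegral_expMeasure (r : ℝ) {f : ℝ → ENNReal} (hf : Measurable f) :
    ∫⁻ x, f x ∂expMeasure r =
      ∫⁻ x in Set.Ioi 0, ENNReal.ofReal (r * Real.exp (-(r * x))) * f x := by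
  rw [expMeasure_eq_withDensity, lintegral_withDensity_eq_lintegral_mul _ (by fun_prop) hf]
  rfl

theorem integrable_expMeasure_iff (hr : 0 < r) {f : ℝ → ℝ} :
    Integrable f (expMeasure r) ↔
      IntegrableOn (fun x => r * Real.exp (-(r * x)) * f x) (Set.Ioi 0) := by
  rw [expMeasure_eq_withDensity, integrable_withDensity_iff_integrable_smul₀' (by fun_prop)
    (by simp)]
  simp only [smul_eq_mul]
  refine integrable_congr (ae_of_all _ fun x => ?_)
  simp only [ENNReal.toReal_ofReal (by positivity : 0 ≤ r * Real.exp (-(r * x)))]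

theorem integral_expMeasure (hr : 0 < r) (f : ℝ → ℝ) :
    ∫ x, f x ∂expMeasure r = ∫ x in Set.Ioi 0, r * Real.exp (-(r * x)) * f x := by
  rw [expMeasure_eq_withDensity, integral_withDensity_eq_integral_toReal_smul₀ (by fun_prop)
    (by simp)]
  refine integral_congr_ae (ae_of_all _ fun x => ?_)
  simp only [ENNReal.toReal_ofReal (by positivity : 0 ≤ r * Real.exp (-(r * x))), smul_eq_mul]

theorem ae_expMeasure_pos (r : ℝ) : ∀ᵐ x ∂expMeasure r, 0 < x := by
  rw [expMeasure_eq_withDensity]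
  exact (withDensity_absolutelyContinuous _ _).ae_le (ae_restrict_mem measurableSet_Ioi)

theorem integrable_pow_expMeasure (hr : 0 < r) (n : ℕ) :
    Integrable (fun x => x ^ n) (expMeasure r) := by
  rw [integrable_expMeasure_iff hr]
  have := (integrableOn_rpow_mul_exp_neg_mul_rpow (s := n) (p := 1) (b := r)
    (by have : (0 : ℝ) ≤ n := n.cast_nonneg
        linarith) one_pos hr).const_mul r
  refine this.congr (ae_of_all _ fun x => ?_)
  simp only [Real.rpow_natCast, Real.rpow_one, neg_mul]
  ring

theorem integral_pow_expMeasure (hr : 0 < r) (n : ℕ) :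
    ∫ x, x ^ n ∂expMeasure r = n.factorial / r ^ n := by
  rw [integral_expMeasure hr]
  have := Real.integral_rpow_mul_exp_neg_mul_Ioi (a := n + 1) (r := r) (by positivity) hr
  rw [Real.Gamma_nat_eq_factorial] at this
  simp only [add_sub_cancel_right, Real.rpow_natCast] at this
  have h2 : ∀ x : ℝ, r * Real.exp (-(r * x)) * x ^ n = r * (x ^ n * Real.exp (-(r * x))) :=
    fun x => by ring
  simp only [h2, integral_const_mul, this]
  rw [Real.rpow_add_one (by positivity), Real.rpow_natCast, one_div, inv_pow]
  field_simp

theorem expMeasure_Ici (hr : 0 < r) {a : ℝ} (ha : 0 ≤ a) :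
    expMeasure r (Set.Ici a) = ENNReal.ofReal (Real.exp (-(r * a))) := by
  have := isProbabilityMeasure_expMeasure hr
  have h0 : expMeasure r {a} = 0 := by
    rw [expMeasure_eq_withDensity]
    exact withDensity_absolutelyContinuous _ _ (by simp)
  have h1 : expMeasure r (Set.Ici a) = expMeasure r (Set.Ioi a) := by
    refine measure_congr ?_
    have : ∀ᵐ x ∂expMeasure r, x ≠ a := by rw [ae_iff]; simpa using h0
    filter_upwards [this] with x hx
    exact propext ⟨fun h => lt_of_le_of_ne h hx.symm, fun h => le_of_lt h⟩
  have h2 : (expMeasure r).real (Set.Iic a) = 1 - Real.exp (-(r * a)) := by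
    have := cdf_expMeasure_eq hr a
    rwa [if_pos ha, cdf_eq_real] at this
  rw [h1, ← Set.compl_Iic, ← ENNReal.ofReal_toReal (measure_ne_top (expMeasure r) (Set.Iic a)ᶜ)]
  congr 1
  change (expMeasure r).real _ = _
  rw [probReal_compl_eq_one_sub measurableSet_Iic, h2]
  ring

/-- The waiting time `(t - x)⁺` vanishes beyond `t`, so its functionals reduce to explicit
antiderivatives on a compact interval. -/
theorem integral_expMeasure_of_hasDerivAt (hr : 0 < r) {t : ℝ} (ht : 0 ≤ t) {f F : ℝ → ℝ}
    (hf : ContinuousOn f (Set.Icc 0 t)) (hf0 : ∀ x, t < x → f x = 0)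
    (hF : ∀ x ∈ Set.Icc 0 t, HasDerivAt F (r * Real.exp (-(r * x)) * f x) x) :
    ∫ x, f x ∂expMeasure r = F t - F 0 := by
  have h1 : ∫ x in Set.Ioi 0, r * Real.exp (-(r * x)) * f x =
      ∫ x in Set.Ioc 0 t, r * Real.exp (-(r * x)) * f x := by
    refine (setIntegral_eq_of_subset_of_forall_sdiff_eq_zero measurableSet_Ioi
      Set.Ioc_subset_Ioi_self fun x hx => ?_)
    rw [hf0 x (by by_contra h; exact hx.2 ⟨hx.1, not_lt.1 h⟩), mul_zero]
  rw [integral_expMeasure hr, h1, ← intervalIntegral.integral_of_le ht]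
  refine intervalIntegral.integral_eq_sub_of_hasDerivAt (fun x hx => hF x ?_) ?_
  · rwa [Set.uIcc_of_le ht] at hx
  · refine ContinuousOn.intervalIntegrable ?_
    rw [Set.uIcc_of_le ht]
    fun_prop

/-- An antiderivative of `r e^{-rx} f` of the form `e^{-rx} q` requires `q' - r q = r f`. Most
witnesses `F` below come from solving this equation. -/
theorem hasDerivAt_exp_neg_mul_mul {q : ℝ → ℝ} {q' x : ℝ} (hq : HasDerivAt q q' x) :
    HasDerivAt (fun y => Real.exp (-(r * y)) * q y) (Real.exp (-(r * x)) * (q' - r * q x)) x := by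
  have h1 : HasDerivAt (fun y => Real.exp (-(r * y))) (Real.exp (-(r * x)) * -(r * 1)) x :=
    ((hasDerivAt_id x).const_mul r).neg.exp
  exact (h1.mul hq).congr_deriv (by ring)

theorem integral_posPart_sub_expMeasure (hr : 0 < r) {t : ℝ} (ht : 0 ≤ t) :
    ∫ x, max (t - x) 0 ∂expMeasure r = t - 1 / r + Real.exp (-(r * t)) / r := by
  rw [integral_expMeasure_of_hasDerivAt hr ht (by fun_prop)
    (fun x hx => max_eq_right (by linarith))
    (F := fun x => Real.exp (-(r * x)) * (1 / r - (t - x))) fun x hx => ?_]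
  · simp; ring
  · refine (hasDerivAt_exp_neg_mul_mul (r := r)
      (((hasDerivAt_id x).const_sub t).const_sub (1 / r))).congr_deriv ?_
    rw [max_eq_left (by linarith [hx.2])]
    simp only [id]
    field_simp
    ring

theorem integral_posPart_sub_sq_expMeasure (hr : 0 < r) {t : ℝ} (ht : 0 ≤ t) :
    ∫ x, max (t - x) 0 ^ 2 ∂expMeasure r =
      t ^ 2 - 2 * t / r + 2 / r ^ 2 - 2 * Real.exp (-(r * t)) / r ^ 2 := by
  rw [integral_expMeasure_of_hasDerivAt hr ht (by fun_prop)
    (fun x hx => by rw [max_eq_right (by linarith)]; simp)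
    (F := fun x => Real.exp (-(r * x)) * (-(t - x) ^ 2 + 2 / r * (t - x) - 2 / r ^ 2))
    fun x hx => ?_]
  · simp; ring
  · have h := (hasDerivAt_id x).const_sub t
    refine (hasDerivAt_exp_neg_mul_mul (r := r)
      (((h.pow 2).neg.add (h.const_mul (2 / r))).sub_const (2 / r ^ 2))).congr_deriv ?_
    rw [max_eq_left (by linarith [hx.2])]
    simp
    field_simp
    ring

theorem integral_mul_posPart_sub_expMeasure (hr : 0 < r) {t : ℝ} (ht : 0 ≤ t) :
    ∫ x, x * max (t - x) 0 ∂expMeasure r =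
      t / r - 2 / r ^ 2 + Real.exp (-(r * t)) * (t / r + 2 / r ^ 2) := by
  rw [integral_expMeasure_of_hasDerivAt hr ht (by fun_prop)
    (fun x hx => by rw [max_eq_right (by linarith)]; simp)
    (F := fun x => Real.exp (-(r * x)) * (-(x * (t - x)) + 2 / r * x + (2 / r - t) / r))
    fun x hx => ?_]
  · simp; field_simp; ring
  · have h := (hasDerivAt_id x).const_sub t
    refine (hasDerivAt_exp_neg_mul_mul (r := r)
      (((((hasDerivAt_id x).mul h).neg.add ((hasDerivAt_id x).const_mul (2 / r))).add_const
        ((2 / r - t) / r)))).congr_deriv ?_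
    rw [max_eq_left (by linarith [hx.2])]
    simp
    field_simp
    ring

theorem integrable_exp_neg_posPart_sub (hr : 0 < r) {s : ℝ} (hs : 0 ≤ s) (t : ℝ) :
    Integrable (fun x => Real.exp (-(s * max (t - x) 0))) (expMeasure r) := by
  have := isProbabilityMeasure_expMeasure hr
  refine Integrable.of_bound (by fun_prop) 1 (ae_of_all _ fun x => ?_)
  rw [Real.norm_of_nonneg (Real.exp_pos _).le, Real.exp_le_one_iff]
  have : 0 ≤ s * max (t - x) 0 := by positivity
  linarith

theorem integral_exp_neg_posPart_sub_expMeasure (hr : 0 < r) {s : ℝ} (hs : 0 ≤ s) (hsr : s ≠ r)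
    {t : ℝ} (ht : 0 ≤ t) :
    ∫ x, Real.exp (-(s * max (t - x) 0)) ∂expMeasure r =
      (s * Real.exp (-(r * t)) - r * Real.exp (-(s * t))) / (s - r) := by
  have := isProbabilityMeasure_expMeasure hr
  have hsr' : s - r ≠ 0 := sub_ne_zero.2 hsr
  -- Subtracting `1` makes the integrand vanish for `x > t`.
  have h := integral_expMeasure_of_hasDerivAt hr ht
    (f := fun x => Real.exp (-(s * max (t - x) 0)) - 1) (by fun_prop)
    (fun x hx => by rw [max_eq_right (by linarith)]; simp)
    (F := fun x => Real.exp (-(r * x)) * (r / (s - r) * Real.exp (-(s * (t - x))) + 1))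
    fun x hx => ?_
  · rw [integral_sub (integrable_exp_neg_posPart_sub hr hs t) (integrable_const _)] at h
    simp at h
    rw [sub_eq_iff_eq_add.1 h]
    field_simp
    ring
  · have h1 : HasDerivAt (fun y => Real.exp (-(s * (t - y))))
        (Real.exp (-(s * (t - x))) * -(s * -1)) x :=
      (((hasDerivAt_id x).const_sub t).const_mul s).neg.exp
    refine (hasDerivAt_exp_neg_mul_mul (r := r)
      ((h1.const_mul (r / (s - r))).add_const 1)).congr_deriv ?_
    rw [max_eq_left (by linarith [hx.2])]
    field_simp
    ring

/-- The resonant case `s = r`: the exponentials cancel and the antiderivative gains a linear term.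
The resulting `t e^{-rt}` is the source of `ω`. -/
theorem integral_exp_neg_rate_posPart_sub_expMeasure (hr : 0 < r) {t : ℝ} (ht : 0 ≤ t) :
    ∫ x, Real.exp (-(r * max (t - x) 0)) ∂expMeasure r = Real.exp (-(r * t)) * (1 + r * t) := by
  have := isProbabilityMeasure_expMeasure hr
  have h := integral_expMeasure_of_hasDerivAt hr ht
    (f := fun x => Real.exp (-(r * max (t - x) 0)) - 1) (by fun_prop)
    (fun x hx => by rw [max_eq_right (by linarith)]; simp)
    (F := fun x => r * Real.exp (-(r * t)) * x + Real.exp (-(r * x)) * 1)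
    fun x hx => ?_
  · rw [integral_sub (integrable_exp_neg_posPart_sub hr hr.le t) (integrable_const _)] at h
    simp at h
    rw [h]
    ring
  · refine (((hasDerivAt_id x).const_mul (r * Real.exp (-(r * t)))).add
      (hasDerivAt_exp_neg_mul_mul (r := r) (hasDerivAt_const x (1 : ℝ)))).congr_deriv ?_
    have h2 : Real.exp (-(r * t)) = Real.exp (-(r * x)) * Real.exp (-(r * (t - x))) := by
      rw [← Real.exp_add]; ring_nf
    rw [max_eq_left (by linarith [hx.2]), h2]
    ring

/-- Evaluating a function at an exponential time has the same mean as `r` times its integral up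
to that time. -/
theorem lintegral_add_expMeasure (hr : 0 < r) {g : ℝ → ENNReal} (hg : Measurable g) (t : ℝ) :
    ∫⁻ u, g (t + u) ∂expMeasure r =
      ENNReal.ofReal r * ∫⁻ u, (∫⁻ y in Set.Ioc t (t + u), g y) ∂expMeasure r := by
  have := isProbabilityMeasure_expMeasure hr
  -- As a double integral this can be swapped. The tail of the exponential law at `y - t` then
  -- appears, and `r` times the tail is its density.
  have h1 : ∀ u, ∫⁻ y in Set.Ioc t (t + u), g y =
      ∫⁻ y, (Set.Ioi t).indicator g y * (Set.Ici (y - t)).indicator 1 u := fun u => by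
    rw [← lintegral_indicator measurableSet_Ioc]
    refine lintegral_congr fun y => ?_
    by_cases hy : t < y <;> by_cases hy2 : y ≤ t + u <;>
      simp [hy, hy2, add_comm u t]
  have hm : Measurable (Function.uncurry fun u y : ℝ =>
      (Set.Ioi t).indicator g y * (Set.Ici (y - t)).indicator (1 : ℝ → ENNReal) u) := by
    refine Measurable.mul ((hg.indicator measurableSet_Ioi).comp measurable_snd) ?_
    have hs : MeasurableSet {p : ℝ × ℝ | p.2 - t ≤ p.1} :=
      measurableSet_le (by fun_prop) (by fun_prop)
    exact (measurable_const (a := (1 : ENNReal))).indicator hs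
  rw [lintegral_congr h1, lintegral_lintegral_swap hm.aemeasurable, lintegral_expMeasure r (by fun_prop)]
  have h2 : ∀ y, ∫⁻ u, (Set.Ioi t).indicator g y *
      (Set.Ici (y - t)).indicator (1 : ℝ → ENNReal) u ∂expMeasure r =
      (Set.Ioi t).indicator (fun y => g y * ENNReal.ofReal (Real.exp (-(r * (y - t))))) y := by
    intro y
    rw [lintegral_const_mul _ (measurable_one.indicator measurableSet_Ici),
      lintegral_indicator_one measurableSet_Ici]
    by_cases hy : t < y
    · simp [hy, expMeasure_Ici hr (sub_nonneg.2 hy.le)]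
    · simp [hy]
  have hm2 : Measurable ((Set.Ioi t).indicator
      fun y => g y * ENNReal.ofReal (Real.exp (-(r * (y - t))))) :=
    Measurable.indicator (by fun_prop) measurableSet_Ioi
  rw [lintegral_congr h2, ← lintegral_indicator measurableSet_Ioi,
    ← lintegral_add_left_eq_self ((Set.Ioi t).indicator _) t]
  refine Eq.trans ?_ (lintegral_const_mul _ (hm2.comp (measurable_const_add t)))
  refine lintegral_congr fun u => ?_
  by_cases hu : 0 < u
  · simp only [Set.indicator_apply, Set.mem_Ioi, hu, if_true, lt_add_iff_pos_right,
      add_sub_cancel_left]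
    rw [ENNReal.ofReal_mul hr.le]
    ring
  · simp [hu]

end Exponential

-- The strong law for coordinates of a product measure

theorem ae_tendsto_average_infinitePi {E : Type*} [MeasurableSpace E] (κ : Measure E)
    [IsProbabilityMeasure κ] {f : E → ℝ} (hfm : Measurable f) (hf : Integrable f κ) :
    ∀ᵐ v ∂(Measure.infinitePi fun _ : ℕ => κ),
      Tendsto (fun n : ℕ => (∑ i ∈ Finset.range n, f (v i)) / n) atTop (𝓝 (∫ e, f e ∂κ)) := by
  have hmp : ∀ i : ℕ, MeasurePreserving (Function.eval i)
      (Measure.infinitePi fun _ : ℕ => κ) κ := fun i =>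
    measurePreserving_eval_infinitePi (fun _ : ℕ => κ) i
  have h := strong_law_ae_real (μ := Measure.infinitePi fun _ : ℕ => κ)
    (fun i v => f (v i)) ((hmp 0).integrable_comp_of_integrable hf)
    (fun i j hij => (iIndepFun_infinitePi (P := fun _ : ℕ => κ) (X := fun _ => f)
      fun _ => hfm).indepFun hij)
    (fun i => ⟨(hfm.comp (measurable_pi_apply i)).aemeasurable,
      (hfm.comp (measurable_pi_apply 0)).aemeasurable, by
        have h2 : ∀ j : ℕ, Measure.map (fun v : ℕ → E => f (v j))
            (Measure.infinitePi fun _ : ℕ => κ) = κ.map f := fun j => by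
          conv_rhs => rw [← (hmp j).map_eq]
          exact (Measure.map_map hfm (hmp j).measurable).symm
        rw [h2, h2]⟩)
  have h3 : ∫ v, f (v 0) ∂(Measure.infinitePi fun _ : ℕ => κ) = ∫ e, f e ∂κ := by
    conv_rhs => rw [← (hmp 0).map_eq]
    exact (integral_map (hmp 0).measurable.aemeasurable hfm.aestronglyMeasurable).symm
  rwa [h3] at h

theorem ae_forall_eval_infinitePi {E : Type*} [MeasurableSpace E] (κ : Measure E)
    [IsProbabilityMeasure κ] {p : E → Prop} (hp : ∀ᵐ e ∂κ, p e) :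
    ∀ᵐ v ∂(Measure.infinitePi fun _ : ℕ => κ), ∀ i, p (v i) :=
  ae_all_iff.2 fun i =>
    (measurePreserving_eval_infinitePi (fun _ : ℕ => κ) i).quasiMeasurePreserving.ae hp

/-! ## Sampling at Poisson epochs -/

section Sampling

variable {nu : ℝ}

theorem dependsOnPast_decisionTime (n : ℕ) : DependsOnPast n fun z => decisionTime z n :=
  fun _ _ h => Finset.sum_congr rfl fun i hi => h i (Finset.mem_range.1 hi)

theorem measurable_decisionTime (n : ℕ) : Measurable fun z => decisionTime z n :=
  Finset.measurable_fun_sum _ fun i _ => measurable_pi_apply i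

theorem decisionTime_succ (z : ℕ → ℝ) (n : ℕ) :
    decisionTime z (n + 1) = decisionTime z n + z n := Finset.sum_range_succ _ _

theorem monotone_decisionTime {z : ℕ → ℝ} (hz : ∀ i, 0 < z i) : Monotone (decisionTime z) :=
  monotone_nat_of_le_succ fun n => by rw [decisionTime_succ]; linarith [hz n]

/-- A Poisson process has intensity `nu dt`; the term `g 0` comes from `τ₀ = 0`. Each later epoch
contributes `nu` times the mean integral over the gap before it, and the gaps are disjoint in `(0,
∞)`. -/
theorem tsum_lintegral_decisionTime_le (hnu : 0 < nu) {g : ℝ → ENNReal} (hg : Measurable g) :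
    ∑' n, ∫⁻ z, g (decisionTime z n) ∂(Measure.infinitePi fun _ : ℕ => expMeasure nu) ≤
      g 0 + ENNReal.ofReal nu * ∫⁻ t in Set.Ioi 0, g t := by
  have := isProbabilityMeasure_expMeasure hnu
  set Q := Measure.infinitePi fun _ : ℕ => expMeasure nu
  rw [tsum_eq_zero_add' ENNReal.summable]
  refine add_le_add (by simp [decisionTime]) ?_
  have hGm : Measurable (Function.uncurry fun t s : ℝ => ∫⁻ y in Set.Ioc t s, g y) := by
    have : ∀ p : ℝ × ℝ, ∫⁻ y in Set.Ioc p.1 p.2, g y =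
        ∫⁻ y, {q : (ℝ × ℝ) × ℝ | q.1.1 < q.2 ∧ q.2 ≤ q.1.2}.indicator (fun q => g q.2) (p, y) :=
      fun p => by rw [← lintegral_indicator measurableSet_Ioc]; rfl
    change Measurable fun p : ℝ × ℝ => ∫⁻ y in Set.Ioc p.1 p.2, g y
    simp only [this]
    refine Measurable.lintegral_prod_right ?_
    have hs : MeasurableSet {q : (ℝ × ℝ) × ℝ | q.1.1 < q.2 ∧ q.2 ≤ q.1.2} :=
      (measurableSet_lt (f := fun q : (ℝ × ℝ) × ℝ => q.1.1) (g := fun q => q.2)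
        (by fun_prop) (by fun_prop)).inter
      (measurableSet_le (f := fun q : (ℝ × ℝ) × ℝ => q.2) (g := fun q => q.1.2)
        (by fun_prop) (by fun_prop))
    exact (hg.comp measurable_snd).indicator hs
  have h1 : ∀ n, ∫⁻ z, g (decisionTime z (n + 1)) ∂Q =
      ENNReal.ofReal nu *
        ∫⁻ z, (∫⁻ y in Set.Ioc (decisionTime z n) (decisionTime z (n + 1)), g y) ∂Q := by
    intro n
    have e1 := lintegral_eval_past (κ := expMeasure nu) (n := n)
      (f := fun z e => g (decisionTime z n + e))
      (hg.comp (((measurable_decisionTime n).comp measurable_fst).add measurable_snd))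
      (fun v w h => by simp only [dependsOnPast_decisionTime n v w h])
    have e2 := lintegral_eval_past (κ := expMeasure nu) (n := n)
      (f := fun z e => ∫⁻ y in Set.Ioc (decisionTime z n) (decisionTime z n + e), g y)
      (hGm.comp (((measurable_decisionTime n).comp measurable_fst).prodMk
        (((measurable_decisionTime n).comp measurable_fst).add measurable_snd)))
      (fun v w h => by simp only [dependsOnPast_decisionTime n v w h])
    simp only [decisionTime_succ]
    rw [e1, e2, ← lintegral_const_mul]
    · exact lintegral_congr fun z => lintegral_add_expMeasure hnu hg _
    · refine Measurable.lintegral_prod_right (f := fun (z : ℕ → ℝ) (e : ℝ) =>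
        ∫⁻ y in Set.Ioc (decisionTime z n) (decisionTime z n + e), g y) ?_
      exact hGm.comp (((measurable_decisionTime n).comp measurable_fst).prodMk
        (((measurable_decisionTime n).comp measurable_fst).add measurable_snd))
  simp only [h1, ENNReal.tsum_mul_left]
  gcongr
  rw [← lintegral_tsum (f := fun n z =>
    ∫⁻ y in Set.Ioc (decisionTime z n) (decisionTime z (n + 1)), g y) fun n => (hGm.comp ((measurable_decisionTime n).prodMk
    (measurable_decisionTime (n + 1)))).aemeasurable]
  calc _ ≤ ∫⁻ _, (∫⁻ t in Set.Ioi 0, g t) ∂Q := by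
        refine lintegral_mono_ae ?_
        filter_upwards [ae_forall_eval_infinitePi (expMeasure nu) (ae_expMeasure_pos nu)]
          with z hz
        have hmono := monotone_decisionTime hz
        rw [← lintegral_iUnion (fun n => measurableSet_Ioc)
          (by simpa using hmono.pairwise_disjoint_on_Ioc_succ)]
        refine lintegral_mono_set (Set.iUnion_subset fun n t ht => ?_)
        have : decisionTime z 0 = 0 := by simp [decisionTime]
        exact lt_of_le_of_lt (this ▸ hmono (Nat.zero_le n)) ht.1
    _ = _ := by simp

/-- Partial integration without derivatives of `f`: write `(1 + t)^(-3/2)` as the integral of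
`(3/2)(1 + y)^(-5/2)` over `y > t` and swap. The linear bound on the primitive of `f` leaves the
integrable power `-3/2`. -/
theorem lintegral_mul_rpow_ne_top {f : ℝ → ℝ} (hf : Measurable f) (hf0 : ∀ t, 0 ≤ f t)
    (hfi : ∀ t, IntervalIntegrable f volume 0 t) {K : ℝ}
    (hK : ∀ t, 0 ≤ t → ∫ y in 0..t, f y ≤ K * (1 + t)) :
    ∫⁻ t in Set.Ioi 0, ENNReal.ofReal (f t * (1 + t) ^ (-(3 / 2) : ℝ)) ≠ ⊤ := by
  have hder : ∀ p : ℝ, ∀ y : ℝ, 0 ≤ y → HasDerivAt (fun y : ℝ => -((1 + y) ^ (-p)))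
      (p * (1 + y) ^ (-p - 1)) y := fun p y hy => by
    have := ((hasDerivAt_id y).const_add 1).rpow_const (p := -p) (Or.inl (by simp; linarith))
    refine this.neg.congr_deriv ?_
    simp only [id]; ring
  have hlim : ∀ p : ℝ, 0 < p → Tendsto (fun y : ℝ => -((1 + y) ^ (-p))) atTop (𝓝 (-0)) :=
    fun p hp => ((tendsto_rpow_neg_atTop hp).comp (tendsto_atTop_add_const_left _ 1 tendsto_id)).neg
  have hint : ∀ p : ℝ, 0 < p → ∀ t, 0 ≤ t →
      IntegrableOn (fun y : ℝ => p * (1 + y) ^ (-p - 1)) (Set.Ioi t) := fun p hp t ht =>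
    integrableOn_Ioi_deriv_of_nonneg' (fun y hy => hder p y (ht.trans hy))
      (fun y hy => mul_nonneg hp.le (Real.rpow_nonneg (by linarith [hy.out]) _)) (hlim p hp)
  have hval : ∀ t, 0 ≤ t → ∫ y in Set.Ioi t, (3 / 2 : ℝ) * (1 + y) ^ (-(3 / 2) - 1 : ℝ) =
      (1 + t) ^ (-(3 / 2) : ℝ) := fun t ht => by
    rw [integral_Ioi_of_hasDerivAt_of_nonneg' (fun y hy => hder (3 / 2) y (ht.trans hy))
      (fun y hy => mul_nonneg (by norm_num) (Real.rpow_nonneg (by linarith [hy.out]) _))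
      (hlim (3 / 2) (by norm_num))]
    ring
  set w : ℝ → ENNReal := fun y => ENNReal.ofReal ((3 / 2 : ℝ) * (1 + y) ^ (-(3 / 2) - 1 : ℝ))
    with hw
  have hwm : Measurable w := by fun_prop
  have h1 : ∀ t ∈ Set.Ioi (0 : ℝ), ENNReal.ofReal (f t * (1 + t) ^ (-(3 / 2) : ℝ)) =
      ∫⁻ y in Set.Ioi 0, (Set.Ioi t).indicator w y * ENNReal.ofReal (f t) := fun t ht => by
    rw [← hval t (le_of_lt ht), ENNReal.ofReal_mul (hf0 t), mul_comm,
      ofReal_integral_eq_lintegral_ofReal (hint (3 / 2) (by norm_num) t (le_of_lt ht))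
        ((ae_restrict_mem measurableSet_Ioi).mono fun y hy => mul_nonneg (by norm_num)
          (Real.rpow_nonneg (by linarith [hy.out, ht.out]) _)),
      lintegral_mul_const _ (hwm.indicator measurableSet_Ioi),
      setLIntegral_indicator measurableSet_Ioi, Set.inter_eq_left.2 (Set.Ioi_subset_Ioi ht.out.le)]
  rw [setLIntegral_congr_fun measurableSet_Ioi h1, lintegral_lintegral_swap]
  -- The constant `3/2` is split as `3 * (1/2)`, so that the bound is a multiple of the derivative
  -- of `-(1 + y)^(-1/2)`.
  · have h2 : ∀ y ∈ Set.Ioi (0 : ℝ), ∫⁻ t in Set.Ioi 0,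
        (Set.Ioi t).indicator w y * ENNReal.ofReal (f t) ≤
        ENNReal.ofReal (3 * K * ((1 / 2) * (1 + y) ^ (-(1 / 2) - 1 : ℝ))) := fun y hy => by
      have e1 : ∀ t, (Set.Ioi t).indicator w y * ENNReal.ofReal (f t) =
          (Set.Iio y).indicator (fun t => w y * ENNReal.ofReal (f t)) t := fun t => by
        by_cases h : t < y <;> simp [h]
      rw [lintegral_congr e1, setLIntegral_indicator measurableSet_Iio,
        lintegral_const_mul _ (by fun_prop)]
      have e2 : ∫⁻ t in Set.Iio y ∩ Set.Ioi 0, ENNReal.ofReal (f t) ≤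
          ENNReal.ofReal (K * (1 + y)) := by
        refine (lintegral_mono_set (t := Set.Ioc 0 y) fun t ht => ⟨ht.2, ht.1.out.le⟩).trans ?_
        rw [← ofReal_integral_eq_lintegral_ofReal
          ((intervalIntegrable_iff_integrableOn_Ioc_of_le hy.out.le).1 (hfi y))
          (ae_of_all _ hf0), ← intervalIntegral.integral_of_le hy.out.le]
        exact ENNReal.ofReal_le_ofReal (hK y hy.out.le)
      refine (mul_le_mul_right e2 _).trans (le_of_eq ?_)
      have hy1 : 0 < 1 + y := by linarith [hy.out]
      rw [hw, ← ENNReal.ofReal_mul (by positivity)]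
      congr 1
      have : (1 + y) ^ (-(1 / 2) - 1 : ℝ) = (1 + y) ^ (-(3 / 2) - 1 : ℝ) * (1 + y) := by
        rw [← Real.rpow_add_one hy1.ne']; norm_num
      rw [this]; ring
    refine ne_top_of_le_ne_top ?_ (setLIntegral_mono' measurableSet_Ioi h2)
    exact (((hint (1 / 2) (by norm_num) 0 le_rfl).const_mul (3 * K)).lintegral_lt_top).ne
  · refine Measurable.aemeasurable ?_
    have : Measurable ({p : ℝ × ℝ | p.1 < p.2}.indicator fun p => w p.2) :=
      (hwm.comp measurable_snd).indicator (measurableSet_lt measurable_fst measurable_snd)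
    exact this.mul (by fun_prop)

end Sampling

theorem integrable_one_add_pow_expMeasure {r : ℝ} (hr : 0 < r) (n : ℕ) :
    Integrable (fun x => (1 + x) ^ n) (expMeasure r) := by
  have h : ∀ x : ℝ, (1 + x) ^ n =
      ∑ m ∈ Finset.range (n + 1), x ^ m * (n.choose m : ℝ) := fun x => by
    rw [add_comm, add_pow]; simp
  simp only [h]
  exact integrable_finsetSum _ fun m _ => (integrable_pow_expMeasure hr m).mul_const _

section Sampling

variable {nu : ℝ} {a : ℝ → ℝ}

theorem intervalIntegrable_of_le_posPart (ha : Measurable a) (h0 : ∀ t, 0 ≤ a t)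
    (hle : ∀ t, a t ≤ max t 0) (s t : ℝ) : IntervalIntegrable a volume s t := by
  have : IntervalIntegrable (fun t : ℝ => max t 0) volume s t :=
    Continuous.intervalIntegrable (by fun_prop) s t
  refine this.mono_fun ha.aestronglyMeasurable (ae_of_all _ fun y => ?_)
  beta_reduce
  rw [Real.norm_of_nonneg (h0 y), Real.norm_of_nonneg (le_max_right y 0)]
  exact hle y

/-- A function that increases at most at unit rate is controlled by its integral. -/
theorem sq_le_two_mul_integral (ha : Measurable a) (h0 : ∀ t, 0 ≤ a t)
    (hle : ∀ t, a t ≤ max t 0) (hinc : ∀ t u, 0 ≤ u → a (t + u) ≤ a t + u) {t : ℝ}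
    (ht : 0 ≤ t) : a t ^ 2 ≤ 2 * ∫ y in 0..t, a y := by
  have hat : a t ≤ t := (hle t).trans_eq (max_eq_left ht)
  -- Going back from `t`, the unit-rate bound keeps `a` above a line of slope one. Below this line
  -- lies a triangle of area `a t ^ 2 / 2`, inside `[0, t]` because `a t ≤ t`.
  have h1 : ∫ y in (t - a t)..t, (a t - (t - y)) ≤ ∫ y in (t - a t)..t, a y := by
    refine intervalIntegral.integral_mono_on (by linarith [h0 t])
      (Continuous.intervalIntegrable (by fun_prop) _ _)
      (intervalIntegrable_of_le_posPart ha h0 hle _ _) fun y hy => ?_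
    have := hinc y (t - y) (by linarith [hy.2])
    rw [add_sub_cancel] at this
    linarith
  have h2 : ∫ y in (t - a t)..t, (a t - (t - y)) = a t ^ 2 / 2 := by
    have : ∀ y, a t - (t - y) = y - (t - a t) := fun y => by ring
    simp only [this]
    rw [intervalIntegral.integral_comp_sub_right (fun y => y), sub_self, integral_id]
    ring
  have h3 : ∫ y in 0..t, a y = (∫ y in 0..(t - a t), a y) + ∫ y in (t - a t)..t, a y :=
    (intervalIntegral.integral_add_adjacent_intervals
      (intervalIntegrable_of_le_posPart ha h0 hle _ _)
      (intervalIntegrable_of_le_posPart ha h0 hle _ _)).symm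
  have h4 : 0 ≤ ∫ y in 0..(t - a t), a y :=
    intervalIntegral.integral_nonneg (by linarith) fun y _ => h0 y
  linarith

/-- The compensator identity that centres the sampling martingale. The bound `a t ≤ max t 0` makes
both terms integrable, so the identity for extended nonnegative integrals passes to real ones. -/
theorem integral_add_expMeasure (hnu : 0 < nu) (ha : Measurable a) (h0 : ∀ t, 0 ≤ a t)
    (hle : ∀ t, a t ≤ max t 0) (t : ℝ) :
    ∫ u, (a (t + u) - nu * ∫ y in t..(t + u), a y) ∂expMeasure nu = 0 := by
  have := isProbabilityMeasure_expMeasure hnu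
  have hii := intervalIntegrable_of_le_posPart ha h0 hle
  have hcont : Continuous fun u => ∫ y in t..(t + u), a y :=
    (intervalIntegral.continuous_primitive hii t).comp (by fun_prop)
  have hI0 : ∀ u, 0 < u → 0 ≤ ∫ y in t..(t + u), a y := fun u hu =>
    intervalIntegral.integral_nonneg (by linarith) fun y _ => h0 y
  have hle' : ∀ s, a s ≤ |s| := fun s => (hle s).trans (max_le (le_abs_self s) (abs_nonneg s))
  have i0 : Integrable (fun u => |t| + u) (expMeasure nu) :=
    (integrable_const _).add (by simpa using integrable_pow_expMeasure hnu 1)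
  have i1 : Integrable (fun u => a (t + u)) (expMeasure nu) := by
    refine i0.mono' (ha.comp (measurable_const_add t)).aestronglyMeasurable ?_
    filter_upwards [ae_expMeasure_pos nu] with u hu
    rw [Real.norm_of_nonneg (h0 _)]
    exact (hle' _).trans ((abs_add_le _ _).trans_eq (by rw [abs_of_pos hu]))
  have i2 : Integrable (fun u => ∫ y in t..(t + u), a y) (expMeasure nu) := by
    have : Integrable (fun u => |t| * u + u ^ 2) (expMeasure nu) :=
      ((by simpa using integrable_pow_expMeasure hnu 1 :
        Integrable (fun u : ℝ => u) (expMeasure nu)).const_mul |t|).add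
        (integrable_pow_expMeasure hnu 2)
    refine this.mono' hcont.aestronglyMeasurable ?_
    filter_upwards [ae_expMeasure_pos nu] with u hu
    refine (intervalIntegral.norm_integral_le_of_norm_le_const (C := |t| + u) fun y hy => ?_).trans
      (le_of_eq ?_)
    · rw [Set.uIoc_of_le (by linarith)] at hy
      rw [Real.norm_of_nonneg (h0 _)]
      refine (hle' y).trans (abs_le.2 ⟨?_, ?_⟩)
      · linarith [neg_abs_le t, hy.1]
      · linarith [le_abs_self t, hy.2]
    · rw [add_sub_cancel_left, abs_of_pos hu]; ring
  rw [integral_sub i1 (i2.const_mul nu), integral_const_mul, sub_eq_zero,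
    integral_eq_lintegral_of_nonneg_ae (ae_of_all _ fun u => h0 _) i1.aestronglyMeasurable,
    integral_eq_lintegral_of_nonneg_ae ((ae_expMeasure_pos nu).mono hI0) i2.aestronglyMeasurable,
    lintegral_add_expMeasure hnu (g := fun y => ENNReal.ofReal (a y)) (by fun_prop),
    ENNReal.toReal_mul, ENNReal.toReal_ofReal hnu.le]
  congr 2
  refine lintegral_congr_ae ((ae_expMeasure_pos nu).mono fun u hu => ?_)
  have hu' : t ≤ t + u := by linarith
  change _ = ENNReal.ofReal _
  rw [intervalIntegral.integral_of_le hu', ofReal_integral_eq_lintegral_ofReal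
    ((intervalIntegrable_iff_integrableOn_Ioc_of_le hu').1 (hii _ _)) (ae_of_all _ h0)]

theorem ae_tendsto_decisionTime_div (hnu : 0 < nu) :
    ∀ᵐ z ∂(Measure.infinitePi fun _ : ℕ => expMeasure nu),
      Tendsto (fun n : ℕ => decisionTime z n / n) atTop (𝓝 (1 / nu)) := by
  have := isProbabilityMeasure_expMeasure hnu
  have h := ae_tendsto_average_infinitePi (expMeasure nu) measurable_id
    (by simpa [Function.id_def] using integrable_pow_expMeasure hnu 1)
  have h2 : ∫ x, id x ∂expMeasure nu = 1 / nu := by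
    simpa using integral_pow_expMeasure hnu 1
  rwa [h2] at h

theorem tendsto_atTop_of_tendsto_div {u : ℕ → ℝ} {c : ℝ} (hc : 0 < c)
    (h : Tendsto (fun n : ℕ => u n / n) atTop (𝓝 c)) : Tendsto u atTop atTop := by
  refine (h.pos_mul_atTop hc tendsto_natCast_atTop_atTop).congr' ?_
  filter_upwards [eventually_ne_atTop 0] with n hn
  field_simp

/-- The sum of a function over the epochs of a Poisson process of rate `nu` is asymptotically
`nu` times its integral. -/
theorem ae_tendsto_sum_sub_integral_div (hnu : 0 < nu) (ha : Measurable a) (h0 : ∀ t, 0 ≤ a t)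
    (hle : ∀ t, a t ≤ max t 0) (hinc : ∀ t u, 0 ≤ u → a (t + u) ≤ a t + u) {K : ℝ}
    (hK : ∀ t, 0 ≤ t → ∫ y in 0..t, a y ≤ K * (1 + t)) :
    ∀ᵐ z ∂(Measure.infinitePi fun _ : ℕ => expMeasure nu),
      Tendsto (fun n : ℕ => ((∑ i ∈ Finset.range n, a (decisionTime z (i + 1))) -
        nu * ∫ y in 0..decisionTime z n, a y) / (1 + decisionTime z n)) atTop (𝓝 0) := by
  have := isProbabilityMeasure_expMeasure hnu
  have hii := intervalIntegrable_of_le_posPart ha h0 hle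
  set A : ℝ → ℝ := fun t => ∫ y in 0..t, a y with hA
  have hAc : Continuous A := intervalIntegral.continuous_primitive hii 0
  have hAs : ∀ s t, A t - A s = ∫ y in s..t, a y := fun s t =>
    intervalIntegral.integral_interval_sub_left (hii _ _) (hii _ _)
  -- The increment is divided by the weight for Kronecker's lemma. The `max` keeps the weight
  -- positive on every sequence `z`, not only almost surely.
  set D : ℕ → (ℕ → ℝ) → ℝ → ℝ := fun n z e =>
    (a (decisionTime z n + e) - nu * ∫ y in decisionTime z n..(decisionTime z n + e), a y) /
      (1 + max (decisionTime z n) 0) with hD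
  have hτ : ∀ n, Measurable fun p : (ℕ → ℝ) × ℝ => decisionTime p.1 n := fun n =>
    (measurable_decisionTime n).comp measurable_fst
  have hDm : ∀ n, Measurable (Function.uncurry (D n)) := fun n => by
    simp only [hD, ← hAs]
    refine Measurable.div (Measurable.sub (ha.comp ((hτ n).add measurable_snd)) ?_) ?_
    · exact ((hAc.measurable.comp ((hτ n).add measurable_snd)).sub
        (hAc.measurable.comp (hτ n))).const_mul nu
    · exact ((hτ n).max measurable_const).const_add 1
  have hK0 : 0 ≤ K := by simpa using hK 0 le_rfl
  set g : ℝ → ENNReal := fun t => ENNReal.ofReal (((1 + a t) / (1 + max t 0)) ^ 2) with hg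
  have hgm : Measurable g := by fun_prop
  have hgint : ∫⁻ t in Set.Ioi 0, g t ≠ ⊤ := by
    -- Since `a t ^ 2 ≤ 2 * K * (1 + t)`, one of the two factors `1 + a t` is at most `(1 + √(2K))
    -- √(1 + t)`. The other is kept, leaving `1 + a t` against `(1 + t)^(-3/2)`.
    have h1 := lintegral_mul_rpow_ne_top (f := fun t => (1 + √(2 * K)) * (1 + a t))
      (K := (1 + √(2 * K)) * (1 + K)) (by fun_prop)
      (fun t => mul_nonneg (by positivity) (by linarith [h0 t]))
      (fun t => (intervalIntegrable_const.add (hii 0 t)).const_mul _) (fun t ht => by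
        rw [intervalIntegral.integral_const_mul, intervalIntegral.integral_add
          intervalIntegrable_const (hii 0 t), mul_assoc]
        refine mul_le_mul_of_nonneg_left ?_ (by positivity)
        have := hK t ht
        simp
        nlinarith)
    refine ne_top_of_le_ne_top h1 (setLIntegral_mono' measurableSet_Ioi fun t ht => ?_)
    refine ENNReal.ofReal_le_ofReal ?_
    have ht0 : (0 : ℝ) ≤ t := ht.out.le
    have hp : 0 < 1 + t := by linarith
    rw [max_eq_left ht0, div_pow]
    have e1 : a t ≤ √(2 * K) * √(1 + t) := by
      rw [← Real.sqrt_mul (by positivity)]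
      refine Real.le_sqrt_of_sq_le ((sq_le_two_mul_integral ha h0 hle hinc ht0).trans ?_)
      linarith [hK t ht0]
    have e2 : 1 ≤ √(1 + t) := Real.one_le_sqrt.2 (by linarith)
    have e3 : (1 + t) ^ (-(3 / 2) : ℝ) = √(1 + t) / (1 + t) ^ 2 := by
      rw [Real.sqrt_eq_rpow, ← Real.rpow_natCast, ← Real.rpow_sub hp]; norm_num
    rw [e3, ← mul_div_assoc]
    gcongr
    nlinarith [h0 t, Real.sqrt_nonneg (2 * K)]
  -- The numerator of `D` is at most `(1 + nu)(1 + e)²(1 + a(τ_n))`; `C` is the mean of the squared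
  -- factor in `e`.
  set C := ∫⁻ e, ENNReal.ofReal ((1 + nu) ^ 2 * (1 + e) ^ 4) ∂expMeasure nu with hC
  have hCtop : C ≠ ⊤ :=
    (((integrable_one_add_pow_expMeasure hnu 4).const_mul _).lintegral_lt_top).ne
  have hDsq : ∀ n z, ∫⁻ e, ENNReal.ofReal (D n z e ^ 2) ∂expMeasure nu ≤
      C * g (decisionTime z n) := fun n z => by
    rw [hC, ← lintegral_mul_const _ (by fun_prop)]
    refine lintegral_mono_ae ((ae_expMeasure_pos nu).mono fun e he => ?_)
    rw [hg, ← ENNReal.ofReal_mul (by positivity)]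
    refine ENNReal.ofReal_le_ofReal ?_
    set t := decisionTime z n
    have h1 : a (t + e) ≤ a t + e := hinc t e he.le
    have h2 : 0 ≤ ∫ y in t..(t + e), a y :=
      intervalIntegral.integral_nonneg (by linarith) fun y _ => h0 y
    have h3 : ∫ y in t..(t + e), a y ≤ (a t + e) * e := by
      have := intervalIntegral.integral_mono_on (a := t) (b := t + e) (by linarith) (hii _ _)
        (intervalIntegrable_const (c := a t + e)) fun y hy => by
          have := hinc t (y - t) (by linarith [hy.1])
          rw [add_sub_cancel] at this
          linarith [hy.2]
      rw [intervalIntegral.integral_const, add_sub_cancel_left, smul_eq_mul] at this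
      linarith
    have h4 : |a (t + e) - nu * ∫ y in t..(t + e), a y| ≤ (1 + nu) * (1 + e) ^ 2 * (1 + a t) := by
      have h5 : a t + e ≤ (1 + e) * (1 + a t) := by nlinarith [h0 t]
      have h6 : (1 + nu * e) ≤ (1 + nu) * (1 + e) := by nlinarith
      have h7 : (a t + e) * (1 + nu * e) ≤ ((1 + e) * (1 + a t)) * ((1 + nu) * (1 + e)) :=
        mul_le_mul h5 h6 (by positivity) (by have := h0 t; positivity)
      rw [abs_le]
      constructor <;> nlinarith [h0 (t + e), h0 t, mul_le_mul_of_nonneg_left h3 hnu.le,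
        mul_nonneg hnu.le h2]
    have h5 := pow_le_pow_left₀ (abs_nonneg _) h4 2
    rw [sq_abs] at h5
    rw [div_pow, div_pow, ← mul_div_assoc]
    gcongr
    refine h5.trans_eq (by ring)
  have hconv := ae_exists_tendsto_sum_of_mean_zero (expMeasure nu) D hDm
    (fun n v w h => by simp only [hD, dependsOnPast_decisionTime n v w h])
    (fun n z => by
      simp only [hD]
      rw [integral_div, integral_add_expMeasure hnu ha h0 hle, zero_div])
    (by
      refine ne_top_of_le_ne_top ?_ (ENNReal.tsum_le_tsum fun n => lintegral_mono (hDsq n))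
      have : ∀ n, ∫⁻ z, C * g (decisionTime z n) ∂(Measure.infinitePi fun _ => expMeasure nu) =
          C * ∫⁻ z, g (decisionTime z n) ∂(Measure.infinitePi fun _ => expMeasure nu) :=
        fun n => lintegral_const_mul C (hgm.comp (measurable_decisionTime n))
      simp only [this]
      rw [ENNReal.tsum_mul_left]
      refine ENNReal.mul_ne_top hCtop (ne_top_of_le_ne_top ?_
        (tsum_lintegral_decisionTime_le hnu hgm))
      exact ENNReal.add_ne_top.2 ⟨by simp [hg], ENNReal.mul_ne_top (by simp) hgint⟩)
  filter_upwards [hconv, ae_forall_eval_infinitePi (expMeasure nu) (ae_expMeasure_pos nu),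
    ae_tendsto_decisionTime_div hnu] with z ⟨c, hc⟩ hz hlim
  have hmono := monotone_decisionTime hz
  have hz0 : decisionTime z 0 = 0 := by simp [decisionTime]
  have hτ0 : ∀ n, 0 ≤ decisionTime z n := fun n => hz0 ▸ hmono (Nat.zero_le n)
  have hK := tendsto_inv_mul_sum_of_tendsto_sum_div (b := fun n => 1 + decisionTime z n)
    (d := fun n => a (decisionTime z (n + 1)) - nu * (A (decisionTime z (n + 1)) -
      A (decisionTime z n))) (fun n => by linarith [hτ0 n])
    (fun m n h => add_le_add_right (hmono h) 1)
    (tendsto_atTop_add_const_left _ _ (tendsto_atTop_of_tendsto_div (by positivity) hlim))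
    (hc.congr fun n => Finset.sum_congr rfl fun i _ => by
      simp only [hD, hAs, decisionTime_succ, max_eq_left (hτ0 i)])
  refine hK.congr fun n => ?_
  rw [Finset.sum_sub_distrib, ← Finset.mul_sum, Finset.sum_range_sub (fun n => A (decisionTime z n)),
    hz0]
  simp [hA]

/-- Poisson arrivals see time averages: the sampled sum is `nu` times the integral up to `τ_n`, with
an error `o(τ_n)`, and `τ_n` is asymptotic to `n / nu`. -/
theorem ae_tendsto_average_decisionTime (hnu : 0 < nu) (ha : Measurable a) (h0 : ∀ t, 0 ≤ a t)
    (hle : ∀ t, a t ≤ max t 0) (hinc : ∀ t u, 0 ≤ u → a (t + u) ≤ a t + u) {c : ℝ}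
    (hc : Tendsto (fun t => (∫ y in 0..t, a y) / t) atTop (𝓝 c)) :
    ∀ᵐ z ∂(Measure.infinitePi fun _ : ℕ => expMeasure nu),
      Tendsto (fun n : ℕ => (∑ i ∈ Finset.range n, a (decisionTime z (i + 1))) / n)
        atTop (𝓝 c) := by
  have hii := intervalIntegrable_of_le_posPart ha h0 hle
  have hmono : ∀ s t, 0 ≤ s → s ≤ t → ∫ y in 0..s, a y ≤ ∫ y in 0..t, a y := fun s t hs hst =>
    intervalIntegral.integral_mono_interval le_rfl hs hst (ae_of_all _ h0) (hii _ _)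
  -- Beyond some `B` the averages are below `c + 1`; before it, the integral up to `max B 0` is a
  -- bound.
  obtain ⟨K, hK⟩ : ∃ K, ∀ t, 0 ≤ t → ∫ y in 0..t, a y ≤ K * (1 + t) := by
    obtain ⟨B, hB⟩ := ((hc.eventually (gt_mem_nhds (lt_add_one c))).and
      (eventually_gt_atTop 0)).exists_forall_of_atTop
    refine ⟨max (c + 1) (∫ y in 0..max B 0, a y), fun t ht => ?_⟩
    rcases le_total B t with h | h
    · rcases eq_or_lt_of_le ht with rfl | ht'
      · have := (hB 0 h).2
        exact absurd this (lt_irrefl _)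
      have h1 := (hB t h).1
      rw [div_lt_iff₀ ht'] at h1
      have h2 : c + 1 ≤ max (c + 1) (∫ y in 0..max B 0, a y) := le_max_left _ _
      have h3 : 0 ≤ max (c + 1) (∫ y in 0..max B 0, a y) := le_max_of_le_right
        (intervalIntegral.integral_nonneg (le_max_right _ _) fun y _ => h0 y)
      nlinarith
    · have h1 := hmono t (max B 0) ht (h.trans (le_max_left _ _))
      have h2 : ∫ y in 0..max B 0, a y ≤ max (c + 1) (∫ y in 0..max B 0, a y) := le_max_right _ _
      have h3 : 0 ≤ max (c + 1) (∫ y in 0..max B 0, a y) := le_max_of_le_right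
        (intervalIntegral.integral_nonneg (le_max_right _ _) fun y _ => h0 y)
      nlinarith
  have := isProbabilityMeasure_expMeasure hnu
  filter_upwards [ae_tendsto_sum_sub_integral_div hnu ha h0 hle hinc hK,
    ae_tendsto_decisionTime_div hnu] with z h1 h2
  have hτ := tendsto_atTop_of_tendsto_div (by positivity) h2
  have h3 : Tendsto (fun n : ℕ => (1 + decisionTime z n) / n) atTop (𝓝 (0 + 1 / nu)) := by
    simp only [add_div]
    exact (tendsto_const_div_atTop_nhds_zero_nat 1).add h2
  have h4 := (h1.mul h3).add (((hc.comp hτ).mul h2).const_mul nu)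
  have h5 : 0 * (0 + 1 / nu) + nu * (c * (1 / nu)) = c := by field_simp; ring
  rw [h5] at h4
  refine h4.congr' ?_
  filter_upwards [eventually_gt_atTop 0, hτ.eventually_gt_atTop 0] with n hn hpos
  have : (0 : ℝ) < n := by exact_mod_cast hn
  simp only [Function.comp]
  field_simp
  ring

end Sampling

/-! ## The system time recursion -/

/-- One step of the system time recursion; `p` consists of an inter-arrival time and the following
service time. -/
noncomputable def systemStep (t : ℝ) (p : ℝ × ℝ) : ℝ := max (t - p.1) 0 + p.2

/-- The system time as a function of the sequence of pairs of inputs. -/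
noncomputable def pathTime (v : ℕ → ℝ × ℝ) (n : ℕ) : ℝ :=
  systemTime (fun i => (v i).1) (fun i => (v i).2) n

/-- Lindley's recursion, obtained by subtracting the new arrival time inside the maximum. -/
theorem systemTime_succ (x s : ℕ → ℝ) (n : ℕ) :
    systemTime x s (n + 1) = max (systemTime x s n - x n) 0 + s n := by
  have h : arrivalTime x (n + 1) = arrivalTime x n + x n := Finset.sum_range_succ _ _
  simp only [systemTime, departureTime]
  rw [h, show departureTime x s n - arrivalTime x n - x n =
    departureTime x s n - (arrivalTime x n + x n) by ring, ← sub_self (arrivalTime x n + x n),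
    max_sub_sub_right]
  ring

theorem pathTime_zero (v : ℕ → ℝ × ℝ) : pathTime v 0 = 0 := by
  simp [pathTime, systemTime, departureTime, arrivalTime]

theorem pathTime_succ (v : ℕ → ℝ × ℝ) (n : ℕ) :
    pathTime v (n + 1) = systemStep (pathTime v n) (v n) := systemTime_succ _ _ _

theorem measurable_systemStep : Measurable (Function.uncurry systemStep) := by
  have : Continuous (Function.uncurry systemStep) := by
    simp only [Function.uncurry_def, systemStep]; fun_prop
  exact this.measurable

theorem measurable_pathTime (n : ℕ) : Measurable fun v => pathTime v n := by
  induction n with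
  | zero => simp only [pathTime_zero]; exact measurable_const
  | succ n ih =>
    simp only [pathTime_succ]
    exact measurable_systemStep.comp (ih.prodMk (measurable_pi_apply n))

theorem dependsOnPast_pathTime (n : ℕ) : DependsOnPast n fun v => pathTime v n := by
  induction n with
  | zero => intro v w _; simp only [pathTime_zero]
  | succ n ih =>
    intro v w h
    simp only [pathTime_succ]
    rw [h n (by omega), show pathTime v n = pathTime w n from ih v w fun i hi => h i (by omega)]

theorem systemStep_mono (p : ℝ × ℝ) : Monotone fun t => systemStep t p := fun s t h => by
  simp only [systemStep]; gcongr

theorem systemStep_nonneg {t : ℝ} {p : ℝ × ℝ} (hp : 0 ≤ p.2) : 0 ≤ systemStep t p :=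
  add_nonneg (le_max_right _ _) hp

theorem systemStep_le {t : ℝ} {p : ℝ × ℝ} (ht : 0 ≤ t) (hp : 0 ≤ p.1) :
    systemStep t p ≤ t + p.2 := by
  have : max (t - p.1) 0 ≤ t := max_le (by linarith) ht
  simp only [systemStep]; linarith

theorem pathTime_nonneg {v : ℕ → ℝ × ℝ} (hv : ∀ i, 0 ≤ (v i).2) (n : ℕ) : 0 ≤ pathTime v n := by
  cases n with
  | zero => rw [pathTime_zero]
  | succ n => rw [pathTime_succ]; exact systemStep_nonneg (hv n)

/-! ### Loynes' construction -/

/-- The system time of update `n` when the inputs of the first `n` updates are used in reverse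
order. -/
noncomputable def backwardTime (v : ℕ → ℝ × ℝ) (n : ℕ) : ℝ := pathTime (fun i => v (n - 1 - i)) n

theorem backwardTime_zero (v : ℕ → ℝ × ℝ) : backwardTime v 0 = 0 := pathTime_zero _

/-- The pair `v 0` is always used last, so a larger `n` only adds inputs at the remote end. Hence
monotonicity of the step propagates from the start `0` and `backwardTime v` increases. -/
theorem backwardTime_succ (v : ℕ → ℝ × ℝ) (n : ℕ) :
    backwardTime v (n + 1) = systemStep (backwardTime (fun i => v (i + 1)) n) (v 0) := by
  simp only [backwardTime, pathTime_succ]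
  rw [show n + 1 - 1 - n = 0 by omega]
  congr 1
  refine dependsOnPast_pathTime n _ _ fun i hi => ?_
  exact congrArg v (by omega)

theorem measurable_backwardTime (n : ℕ) : Measurable fun v => backwardTime v n :=
  (measurable_pathTime n).comp (measurable_pi_iff.2 fun _ => measurable_pi_apply _)

theorem backwardTime_nonneg {v : ℕ → ℝ × ℝ} (hv : ∀ i, 0 ≤ (v i).2) (n : ℕ) :
    0 ≤ backwardTime v n := pathTime_nonneg (fun _ => hv _) n

theorem monotone_backwardTime {v : ℕ → ℝ × ℝ} (hv : ∀ i, 0 ≤ (v i).2) :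
    Monotone (backwardTime v) := by
  have key : ∀ n, ∀ v : ℕ → ℝ × ℝ, (∀ i, 0 ≤ (v i).2) →
      backwardTime v n ≤ backwardTime v (n + 1) := by
    intro n
    induction n with
    | zero => intro v hv; rw [backwardTime_zero]; exact backwardTime_nonneg hv 1
    | succ n ih =>
      intro v hv
      rw [backwardTime_succ, backwardTime_succ v (n + 1)]
      exact systemStep_mono _ (ih _ fun i => hv (i + 1))
  exact monotone_nat_of_le_succ fun n => key n v hv

/-- Reversing the first `n` coordinates preserves an i.i.d. law. Only the laws for each fixed `n`
agree, not those of the processes. -/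
theorem map_pathTime_eq_map_backwardTime (κ : Measure (ℝ × ℝ)) [IsProbabilityMeasure κ] (n : ℕ) :
    (Measure.infinitePi fun _ : ℕ => κ).map (fun v => pathTime v n) =
      (Measure.infinitePi fun _ : ℕ => κ).map (fun v => backwardTime v n) := by
  let σ : ℕ → ℕ := fun i => if i < n then n - 1 - i else i
  have hσ : Function.Injective σ := by
    intro i j h
    simp only [σ] at h
    split_ifs at h <;> omega
  have h1 := Measure.map_infinitePi_infinitePi_of_inj (P := fun _ : ℕ => κ) hσ
  have h2 : (fun v => backwardTime v n) = (fun v => pathTime v n) ∘ fun v i => v (σ i) := by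
    funext v
    refine dependsOnPast_pathTime n _ _ fun i hi => ?_
    simp [σ, hi]
  rw [h2, ← Measure.map_map (measurable_pathTime n)
    (measurable_pi_iff.2 fun _ => measurable_pi_apply _), h1]

/-! ### One-step means -/

section Moments

theorem ae_input_nonneg {lam : ℝ} {F : Measure ℝ} [SFinite F] (hF : ∀ᵐ s ∂F, 0 ≤ s) :
    ∀ᵐ p ∂(expMeasure lam).prod F, 0 < p.1 ∧ 0 ≤ p.2 :=
  (Measure.quasiMeasurePreserving_fst.ae (ae_expMeasure_pos lam)).and
    (Measure.quasiMeasurePreserving_snd.ae hF)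

variable {lam : ℝ} {F : Measure ℝ} [IsProbabilityMeasure F] [IsProbabilityMeasure (expMeasure lam)]

theorem integrable_of_integrable_sq {F : Measure ℝ} [IsProbabilityMeasure F]
    (hsq : Integrable (fun x : ℝ => x ^ 2) F) : Integrable (fun x : ℝ => x) F :=
  ((memLp_two_iff_integrable_sq aestronglyMeasurable_id).2 hsq).integrable one_le_two

/-- The weight that dominates the functionals of the inputs below. -/
def inputWeight (p : ℝ × ℝ) : ℝ := (1 + p.1 ^ 2) * (1 + |p.2|)

theorem inputWeight_pos (p : ℝ × ℝ) : 0 < inputWeight p := by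
  unfold inputWeight; positivity

theorem continuous_inputWeight : Continuous inputWeight := by
  unfold inputWeight; fun_prop

/-- The weight is quadratic in the exponential variable, which has all moments, and only linear in
the service time, which has just two. -/
theorem memLp_inputWeight (hlam : 0 < lam) (hsq : Integrable (fun x : ℝ => x ^ 2) F) :
    MemLp inputWeight 2 ((expMeasure lam).prod F) := by
  rw [memLp_two_iff_integrable_sq continuous_inputWeight.aestronglyMeasurable]
  have h1 : Integrable (fun x : ℝ => (1 + x ^ 2) ^ 2) (expMeasure lam) := by
    have : ∀ x : ℝ, (1 + x ^ 2) ^ 2 = 1 + 2 * x ^ 2 + x ^ 4 := fun x => by ring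
    simp only [this]
    exact ((integrable_const _).add ((integrable_pow_expMeasure hlam 2).const_mul 2)).add
      (integrable_pow_expMeasure hlam 4)
  have h2 : Integrable (fun s : ℝ => (1 + |s|) ^ 2) F := by
    have : ∀ s : ℝ, (1 + |s|) ^ 2 = 1 + 2 * |s| + s ^ 2 := fun s => by rw [← sq_abs s]; ring
    simp only [this]
    exact ((integrable_const _).add ((integrable_of_integrable_sq hsq).abs.const_mul 2)).add hsq
  refine (h1.mul_prod h2).congr (ae_of_all _ fun p => ?_)
  simp only [inputWeight]; ring

/-- `φ` grows at most linearly in the system time, with respect to the weight `inputWeight`. -/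
def LinearGrowth (φ : ℝ → ℝ × ℝ → ℝ) : Prop :=
  Measurable (Function.uncurry φ) ∧
    ∃ C, 0 ≤ C ∧ ∀ t p, 0 ≤ t → 0 < p.1 → 0 ≤ p.2 → |φ t p| ≤ C * (1 + t) * inputWeight p

theorem LinearGrowth.integrable (hlam : 0 < lam) (hF : ∀ᵐ s ∂F, 0 ≤ s)
    (hsq : Integrable (fun x : ℝ => x ^ 2) F) {φ : ℝ → ℝ × ℝ → ℝ} (h : LinearGrowth φ) {t : ℝ}
    (ht : 0 ≤ t) : Integrable (φ t) ((expMeasure lam).prod F) := by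
  obtain ⟨hm, C, -, hC⟩ := h
  refine (((memLp_inputWeight hlam hsq).integrable one_le_two).const_mul (C * (1 + t))).mono'
    (hm.comp measurable_prodMk_left).aestronglyMeasurable ?_
  filter_upwards [ae_input_nonneg hF] with p hp
  exact hC t p ht hp.1 hp.2

theorem integrable_posPart_sub_pow {t : ℝ} (ht : 0 ≤ t) (n : ℕ) :
    Integrable (fun x => max (t - x) 0 ^ n) (expMeasure lam) := by
  refine (integrable_const (t ^ n)).mono' (by fun_prop) ?_
  filter_upwards [ae_expMeasure_pos lam] with x hx
  have : max (t - x) 0 ≤ t := max_le (by linarith) ht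
  rw [Real.norm_of_nonneg (by positivity)]
  gcongr

/-- The drift of the identity: service minus inter-arrival time, plus the mean idle time `e^{-λt}/λ`
of the server. -/
theorem integral_systemStep (hlam : 0 < lam) (hsq : Integrable (fun x : ℝ => x ^ 2) F)
    {t : ℝ} (ht : 0 ≤ t) :
    ∫ p, systemStep t p ∂(expMeasure lam).prod F =
      t - 1 / lam + Real.exp (-(lam * t)) / lam + ∫ s, s ∂F := by
  have hS := integrable_of_integrable_sq hsq
  have h1 : Integrable (fun x => max (t - x) 0) (expMeasure lam) := by
    simpa using integrable_posPart_sub_pow ht 1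
  simp only [systemStep]
  rw [integral_add (h1.comp_fst F) (hS.comp_snd (expMeasure lam)), integral_fun_fst (fun x => max (t - x) 0),
    integral_fun_snd (fun s : ℝ => s),
    integral_posPart_sub_expMeasure hlam ht]
  simp

theorem integral_systemStep_sq (hlam : 0 < lam) (hsq : Integrable (fun x : ℝ => x ^ 2) F)
    {t : ℝ} (ht : 0 ≤ t) :
    ∫ p, systemStep t p ^ 2 ∂(expMeasure lam).prod F =
      t ^ 2 - 2 * t / lam + 2 / lam ^ 2 - 2 * Real.exp (-(lam * t)) / lam ^ 2 +
      2 * (t - 1 / lam + Real.exp (-(lam * t)) / lam) * (∫ s, s ∂F) + ∫ s, s ^ 2 ∂F := by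
  have hS := integrable_of_integrable_sq hsq
  have h1 : Integrable (fun x => max (t - x) 0) (expMeasure lam) := by
    simpa using integrable_posPart_sub_pow ht 1
  have h2 := integrable_posPart_sub_pow (lam := lam) ht 2
  have e : ∀ p : ℝ × ℝ, systemStep t p ^ 2 =
      max (t - p.1) 0 ^ 2 + 2 * (max (t - p.1) 0 * p.2) + p.2 ^ 2 := fun p => by
    simp only [systemStep]; ring
  have i2 := (h1.mul_prod hS).const_mul 2
  simp only [e]
  have i12 : Integrable (fun p : ℝ × ℝ => max (t - p.1) 0 ^ 2 + 2 * (max (t - p.1) 0 * p.2))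
      ((expMeasure lam).prod F) := (h2.comp_fst F).add i2
  rw [integral_add i12 (hsq.comp_snd (expMeasure lam)), integral_add (h2.comp_fst F) i2,
    integral_const_mul, integral_fun_fst (fun x => max (t - x) 0 ^ 2),
    integral_fun_snd (fun s : ℝ => s ^ 2), integral_prod_mul (fun x => max (t - x) 0) (fun s => s),
    integral_posPart_sub_sq_expMeasure hlam ht, integral_posPart_sub_expMeasure hlam ht]
  simp
  ring

theorem integral_exp_neg_systemStep (hlam : 0 < lam) {r : ℝ} (hr : 0 ≤ r) (hrl : r ≠ lam) {t : ℝ}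
    (ht : 0 ≤ t) :
    ∫ p, Real.exp (-(r * systemStep t p)) ∂(expMeasure lam).prod F =
      (r * Real.exp (-(lam * t)) - lam * Real.exp (-(r * t))) / (r - lam) *
        ∫ s, Real.exp (-(r * s)) ∂F := by
  have e : ∀ p : ℝ × ℝ, Real.exp (-(r * systemStep t p)) =
      Real.exp (-(r * max (t - p.1) 0)) * Real.exp (-(r * p.2)) := fun p => by
    rw [← Real.exp_add]; simp only [systemStep]; ring_nf
  simp only [e]
  rw [integral_prod_mul (fun x => Real.exp (-(r * max (t - x) 0))) (fun s => Real.exp (-(r * s))),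
    integral_exp_neg_posPart_sub_expMeasure hlam hr hrl ht]

theorem integral_exp_neg_rate_systemStep (hlam : 0 < lam) {t : ℝ} (ht : 0 ≤ t) :
    ∫ p, Real.exp (-(lam * systemStep t p)) ∂(expMeasure lam).prod F =
      Real.exp (-(lam * t)) * (1 + lam * t) * ∫ s, Real.exp (-(lam * s)) ∂F := by
  have e : ∀ p : ℝ × ℝ, Real.exp (-(lam * systemStep t p)) =
      Real.exp (-(lam * max (t - p.1) 0)) * Real.exp (-(lam * p.2)) := fun p => by
    rw [← Real.exp_add]; simp only [systemStep]; ring_nf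
  simp only [e]
  rw [integral_prod_mul (fun x => Real.exp (-(lam * max (t - x) 0)))
      (fun s => Real.exp (-(lam * s))),
    integral_exp_neg_rate_posPart_sub_expMeasure hlam ht]

theorem integral_systemStep_mul (hlam : 0 < lam) (hsq : Integrable (fun x : ℝ => x ^ 2) F)
    {t : ℝ} (ht : 0 ≤ t) :
    ∫ p, (systemStep t p * p.1 + p.1 ^ 2 / 2) ∂(expMeasure lam).prod F =
      t / lam - 2 / lam ^ 2 + Real.exp (-(lam * t)) * (t / lam + 2 / lam ^ 2) +
        (∫ s, s ∂F) / lam + 1 / lam ^ 2 := by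
  have hS := integrable_of_integrable_sq hsq
  have hX : Integrable (fun x : ℝ => x) (expMeasure lam) := by
    simpa using integrable_pow_expMeasure hlam 1
  have hX2 := integrable_pow_expMeasure hlam 2
  have h1 : Integrable (fun x => x * max (t - x) 0) (expMeasure lam) := by
    refine (hX.const_mul t).mono' (by fun_prop) ?_
    filter_upwards [ae_expMeasure_pos lam] with x hx
    have : max (t - x) 0 ≤ t := max_le (by linarith) ht
    rw [Real.norm_of_nonneg (by positivity)]
    nlinarith
  have e : ∀ p : ℝ × ℝ, systemStep t p * p.1 + p.1 ^ 2 / 2 =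
      p.1 * max (t - p.1) 0 + p.1 * p.2 + p.1 ^ 2 / 2 := fun p => by
    simp only [systemStep]; ring
  have i2 := hX.mul_prod hS
  have i3 := (hX2.div_const 2).comp_fst F
  simp only [e]
  have i12 : Integrable (fun p : ℝ × ℝ => p.1 * max (t - p.1) 0 + p.1 * p.2)
      ((expMeasure lam).prod F) := (h1.comp_fst F).add i2
  rw [integral_add i12 i3, integral_add (h1.comp_fst F) i2,
    integral_fun_fst (fun x => x * max (t - x) 0), integral_fun_fst (fun x => x ^ 2 / 2),
    integral_prod_mul (fun x : ℝ => x) (fun s => s), integral_mul_posPart_sub_expMeasure hlam ht,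
    integral_div, integral_pow_expMeasure hlam 2]
  have := integral_pow_expMeasure hlam 1
  simp at this
  rw [this]
  simp
  ring

end Moments

/-- The law of the sequence of pairs of inter-arrival and service times. -/
noncomputable def inputLaw (lam : ℝ) (F : Measure ℝ) : Measure (ℕ → ℝ × ℝ) :=
  Measure.infinitePi fun _ : ℕ => (expMeasure lam).prod F

section Chain

variable {lam : ℝ} {F : Measure ℝ} [IsProbabilityMeasure F] [IsProbabilityMeasure (expMeasure lam)]

instance : IsProbabilityMeasure (inputLaw lam F) := by
  unfold inputLaw; infer_instance

theorem ae_inputs_nonneg (hF : ∀ᵐ s ∂F, 0 ≤ s) :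
    ∀ᵐ v ∂inputLaw lam F, ∀ i, 0 < (v i).1 ∧ 0 ≤ (v i).2 :=
  ae_forall_eval_infinitePi _ (ae_input_nonneg hF)

theorem identDistrib_pathTime_backwardTime (n : ℕ) :
    IdentDistrib (fun v => pathTime v n) (fun v => backwardTime v n)
      (inputLaw lam F) (inputLaw lam F) :=
  ⟨(measurable_pathTime n).aemeasurable, (measurable_backwardTime n).aemeasurable,
    map_pathTime_eq_map_backwardTime _ n⟩

theorem memLp_pathTime (hF : ∀ᵐ s ∂F, 0 ≤ s) (hsq : Integrable (fun x : ℝ => x ^ 2) F) (n : ℕ) :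
    MemLp (fun v => pathTime v n) 2 (inputLaw lam F) := by
  induction n with
  | zero => simp only [pathTime_zero]; exact memLp_const 0
  | succ n ih =>
    have h1 : MemLp (fun p : ℝ × ℝ => p.2) 2 ((expMeasure lam).prod F) := by
      have := (memLp_two_iff_integrable_sq aestronglyMeasurable_id).2 hsq
      exact this.comp_measurePreserving measurePreserving_snd
    have h2 : MemLp (fun v : ℕ → ℝ × ℝ => (v n).2) 2 (inputLaw lam F) :=
      h1.comp_measurePreserving
        (measurePreserving_eval_infinitePi (fun _ : ℕ => (expMeasure lam).prod F) n)
    refine (ih.add h2).mono (measurable_pathTime (n + 1)).aestronglyMeasurable ?_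
    filter_upwards [ae_inputs_nonneg hF] with v hv
    have h3 := pathTime_nonneg (fun i => (hv i).2) n
    have h4 := pathTime_nonneg (fun i => (hv i).2) (n + 1)
    have h5 := systemStep_le h3 (hv n).1.le
    rw [← pathTime_succ] at h5
    simp only [Pi.add_apply]
    rwa [Real.norm_of_nonneg h4, Real.norm_of_nonneg (add_nonneg h3 (hv n).2)]

theorem integral_comp_pathTime_succ {g : ℝ → ℝ} (hg : Measurable g) (n : ℕ)
    (hi : Integrable (fun v => g (pathTime v (n + 1))) (inputLaw lam F)) :
    ∫ v, g (pathTime v (n + 1)) ∂inputLaw lam F =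
      ∫ v, ∫ p, g (systemStep (pathTime v n) p) ∂(expMeasure lam).prod F ∂inputLaw lam F := by
  simp only [pathTime_succ] at hi ⊢
  refine integral_eval_past (n := n) (f := fun v p => g (systemStep (pathTime v n) p)) ?_ ?_ hi
  · exact hg.comp (measurable_systemStep.comp
      (((measurable_pathTime n).comp measurable_fst).prodMk measurable_snd))
  · intro v w h
    simp only [show pathTime v n = pathTime w n from dependsOnPast_pathTime n v w h]

theorem integrable_exp_neg_pathTime (hlam : 0 < lam) (hF : ∀ᵐ s ∂F, 0 ≤ s) (n : ℕ) :
    Integrable (fun v => Real.exp (-(lam * pathTime v n))) (inputLaw lam F) := by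
  refine Integrable.of_bound
    (((measurable_pathTime n).const_mul lam).neg.exp.aestronglyMeasurable) 1 ?_
  filter_upwards [ae_inputs_nonneg hF] with v hv
  rw [Real.norm_of_nonneg (Real.exp_pos _).le, Real.exp_le_one_iff]
  have := mul_nonneg hlam.le (pathTime_nonneg (fun i => (hv i).2) n)
  linarith

theorem integral_pathTime_succ (hlam : 0 < lam) (hF : ∀ᵐ s ∂F, 0 ≤ s)
    (hsq : Integrable (fun x : ℝ => x ^ 2) F) (n : ℕ) :
    ∫ v, pathTime v (n + 1) ∂inputLaw lam F =
      (∫ v, pathTime v n ∂inputLaw lam F) - 1 / lam +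
        (∫ v, Real.exp (-(lam * pathTime v n)) ∂inputLaw lam F) / lam + ∫ s, s ∂F := by
  have hT := fun n => (memLp_pathTime (lam := lam) hF hsq n).integrable one_le_two
  rw [integral_comp_pathTime_succ (g := fun t => t) measurable_id n (hT (n + 1))]
  have : ∀ᵐ v ∂inputLaw lam F, ∫ p, systemStep (pathTime v n) p ∂(expMeasure lam).prod F =
      (pathTime v n + (Real.exp (-(lam * pathTime v n)) / lam)) +
        (-(1 / lam) + ∫ s, s ∂F) := by
    filter_upwards [ae_inputs_nonneg hF] with v hv
    rw [integral_systemStep hlam hsq (pathTime_nonneg (fun i => (hv i).2) n)]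
    ring
  have hE := (integrable_exp_neg_pathTime hlam hF n).div_const lam
  have hTE : Integrable (fun v => pathTime v n + Real.exp (-(lam * pathTime v n)) / lam)
    (inputLaw lam F) := (hT n).add hE
  rw [integral_congr_ae this, integral_add hTE (integrable_const _), integral_add (hT n) hE,
    integral_div]
  simp
  ring

/-- In the exact quadratic drift, the terms `-2e/λ²` and `-2(1 - e)E[S]/λ`, with `e = e^{-λt}`, are
nonpositive and are dropped. -/
theorem integral_pathTime_sq_succ_le (hlam : 0 < lam) (hF : ∀ᵐ s ∂F, 0 ≤ s)
    (hsq : Integrable (fun x : ℝ => x ^ 2) F) (n : ℕ) :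
    ∫ v, pathTime v (n + 1) ^ 2 ∂inputLaw lam F ≤
      (∫ v, pathTime v n ^ 2 ∂inputLaw lam F) -
        2 * (1 / lam - ∫ s, s ∂F) * (∫ v, pathTime v n ∂inputLaw lam F) +
        (2 / lam ^ 2 + ∫ s, s ^ 2 ∂F) := by
  have hT2 := fun n => (memLp_pathTime (lam := lam) hF hsq n).integrable_sq
  have hT := fun n => (memLp_pathTime (lam := lam) hF hsq n).integrable one_le_two
  rw [integral_comp_pathTime_succ (g := fun t => t ^ 2) (by fun_prop) n (hT2 (n + 1)),
    ← integral_const_mul, ← integral_sub (hT2 n) ((hT n).const_mul _)]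
  have hS0 : 0 ≤ ∫ s, s ∂F := integral_nonneg_of_ae hF
  have hb : Integrable (fun v => pathTime v n ^ 2 - 2 * (1 / lam - ∫ s, s ∂F) * pathTime v n)
    (inputLaw lam F) := (hT2 n).sub ((hT n).const_mul _)
  have hc : (2 / lam ^ 2 + ∫ s, s ^ 2 ∂F) =
      ∫ _, (2 / lam ^ 2 + ∫ s, s ^ 2 ∂F) ∂inputLaw lam F := by simp
  rw [hc, ← integral_add hb (integrable_const _)]
  refine integral_mono_of_nonneg (ae_of_all _ fun v => integral_nonneg fun p => sq_nonneg _)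
    (hb.add (integrable_const _)) ?_
  filter_upwards [ae_inputs_nonneg hF] with v hv
  have ht := pathTime_nonneg (fun i => (hv i).2) n
  have he : Real.exp (-(lam * pathTime v n)) ≤ 1 :=
    Real.exp_le_one_iff.2 (by have := mul_nonneg hlam.le ht; linarith)
  have he0 := Real.exp_pos (-(lam * pathTime v n))
  rw [integral_systemStep_sq hlam hsq ht]
  set e := Real.exp (-(lam * pathTime v n))
  have h1 : 0 ≤ (1 - e) / lam := div_nonneg (by linarith) hlam.le
  have h2 : 0 ≤ 2 * e / lam ^ 2 := by positivity
  have h3 := mul_nonneg h1 hS0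
  have h4 : (1 - e) / lam * ∫ s, s ∂F = (1 / lam - e / lam) * ∫ s, s ∂F := by ring
  have h5 : 2 * pathTime v n / lam = 2 * (1 / lam) * pathTime v n := by ring
  nlinarith

theorem integral_exp_neg_pathTime_succ (hlam : 0 < lam) (hF : ∀ᵐ s ∂F, 0 ≤ s) (n : ℕ) :
    ∫ v, Real.exp (-(lam * pathTime v (n + 1))) ∂inputLaw lam F =
      (∫ v, Real.exp (-(lam * pathTime v n)) * (1 + lam * pathTime v n) ∂inputLaw lam F) *
        ∫ s, Real.exp (-(lam * s)) ∂F := by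
  rw [integral_comp_pathTime_succ (g := fun t => Real.exp (-(lam * t))) (by fun_prop) n
    (integrable_exp_neg_pathTime hlam hF (n + 1)), ← integral_mul_const]
  refine integral_congr_ae ?_
  filter_upwards [ae_inputs_nonneg hF] with v hv
  rw [integral_exp_neg_rate_systemStep hlam (pathTime_nonneg (fun i => (hv i).2) n)]

/-! ### The steady state -/

/-- Means increase with `n`. If one of them exceeded the bound, all later ones would, and the
quadratic drift would lower the second moment by a fixed `δ` at each step, eventually below zero. -/
theorem integral_backwardTime_le (hlam : 0 < lam) (hF : ∀ᵐ s ∂F, 0 ≤ s)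
    (hsq : Integrable (fun x : ℝ => x ^ 2) F) (hload : lam * ∫ s, s ∂F < 1) (n : ℕ) :
    ∫ v, backwardTime v n ∂inputLaw lam F ≤
      (2 / lam ^ 2 + ∫ s, s ^ 2 ∂F) / (2 * (1 / lam - ∫ s, s ∂F)) := by
  set Q := inputLaw lam F
  set C := 2 / lam ^ 2 + ∫ s, s ^ 2 ∂F
  have hκ : 0 < 2 * (1 / lam - ∫ s, s ∂F) := by
    have : ∫ s, s ∂F < 1 / lam := by rw [lt_div_iff₀ hlam]; linarith
    linarith
  set k := 2 * (1 / lam - ∫ s, s ∂F)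
  have hT := fun n => (memLp_pathTime (lam := lam) hF hsq n).integrable one_le_two
  have hB : ∀ n, Integrable (fun v => backwardTime v n) Q := fun n =>
    (identDistrib_pathTime_backwardTime n).integrable_iff.1 (hT n)
  have hEq : ∀ n, ∫ v, pathTime v n ∂Q = ∫ v, backwardTime v n ∂Q := fun n =>
    (identDistrib_pathTime_backwardTime n).integral_eq
  by_contra! hcon
  rw [div_lt_iff₀ hκ] at hcon
  set δ := (∫ v, backwardTime v n ∂Q) * k - C
  have hδ : 0 < δ := sub_pos.2 hcon
  have hdec : ∀ j, ∫ v, pathTime v (n + j) ^ 2 ∂Q ≤ (∫ v, pathTime v n ^ 2 ∂Q) - j * δ := by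
    intro j
    induction j with
    | zero => simp
    | succ j ih =>
      have h1 := integral_pathTime_sq_succ_le hlam hF hsq (n + j)
      have h2 : ∫ v, backwardTime v n ∂Q ≤ ∫ v, pathTime v (n + j) ∂Q := by
        rw [hEq]
        refine integral_mono_ae (hB n) (hB (n + j)) ?_
        filter_upwards [ae_inputs_nonneg hF] with v hv
        exact monotone_backwardTime (fun i => (hv i).2) (Nat.le_add_right _ _)
      have h3 := mul_le_mul_of_nonneg_left h2 hκ.le
      have h4 : δ = (∫ v, backwardTime v n ∂Q) * k - C := rfl
      rw [← add_assoc]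
      push_cast
      have h5 : ∫ v, pathTime v (n + j + 1) ^ 2 ∂Q ≤ (∫ v, pathTime v (n + j) ^ 2 ∂Q) -
        k * (∫ v, pathTime v (n + j) ∂Q) + C := h1
      nlinarith
  obtain ⟨j, hj⟩ := exists_nat_gt ((∫ v, pathTime v n ^ 2 ∂Q) / δ)
  rw [div_lt_iff₀ hδ] at hj
  have h1 := hdec j
  have h2 : 0 ≤ ∫ v, pathTime v (n + j) ^ 2 ∂Q := integral_nonneg fun v => sq_nonneg _
  linarith

theorem exists_backwardTime_limit (hlam : 0 < lam) (hF : ∀ᵐ s ∂F, 0 ≤ s)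
    (hsq : Integrable (fun x : ℝ => x ^ 2) F) (hload : lam * ∫ s, s ∂F < 1) :
    ∃ L : (ℕ → ℝ × ℝ) → ℝ, Measurable L ∧ Integrable L (inputLaw lam F) ∧
      ∀ᵐ v ∂inputLaw lam F, (∀ n, 0 ≤ backwardTime v n ∧ backwardTime v n ≤ L v) ∧
        Tendsto (backwardTime v) atTop (𝓝 (L v)) := by
  set Q := inputLaw lam F
  set B := (2 / lam ^ 2 + ∫ s, s ^ 2 ∂F) / (2 * (1 / lam - ∫ s, s ∂F))
  -- Taken in `ENNReal` the supremum always exists; monotone convergence with the uniform mean bound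
  -- makes it integrable, hence almost surely finite.
  let G : (ℕ → ℝ × ℝ) → ENNReal := fun v => ⨆ n, ENNReal.ofReal (backwardTime v n)
  have hGm : Measurable G := .iSup fun n => (measurable_backwardTime n).ennreal_ofReal
  have hB : ∀ n, Integrable (fun v => backwardTime v n) Q := fun n =>
    (identDistrib_pathTime_backwardTime n).integrable_iff.1
      ((memLp_pathTime (lam := lam) hF hsq n).integrable one_le_two)
  have hGle : ∫⁻ v, G v ∂Q ≤ ENNReal.ofReal B := by
    rw [lintegral_iSup' (fun n => (measurable_backwardTime n).ennreal_ofReal.aemeasurable)]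
    · refine iSup_le fun n => ?_
      rw [← ofReal_integral_eq_lintegral_ofReal (hB n)]
      · exact ENNReal.ofReal_le_ofReal (integral_backwardTime_le hlam hF hsq hload n)
      · filter_upwards [ae_inputs_nonneg hF] with v hv
        exact backwardTime_nonneg (fun i => (hv i).2) n
    · filter_upwards [ae_inputs_nonneg hF] with v hv m n hmn
      exact ENNReal.ofReal_le_ofReal (monotone_backwardTime (fun i => (hv i).2) hmn)
  have hGtop : ∫⁻ v, G v ∂Q ≠ ⊤ := ne_top_of_le_ne_top ENNReal.ofReal_ne_top hGle
  refine ⟨fun v => (G v).toReal, hGm.ennreal_toReal,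
    integrable_toReal_of_lintegral_ne_top hGm.aemeasurable hGtop, ?_⟩
  filter_upwards [ae_inputs_nonneg hF, ae_lt_top hGm hGtop] with v hv hfin
  have h0 := backwardTime_nonneg (fun i => (hv i).2)
  have hmono := monotone_backwardTime (fun i => (hv i).2)
  refine ⟨fun n => ⟨h0 n, ?_⟩, ?_⟩
  · have := ENNReal.toReal_mono hfin.ne (le_iSup (fun n => ENNReal.ofReal (backwardTime v n)) n)
    rwa [ENNReal.toReal_ofReal (h0 n)] at this
  · have h1 : Tendsto (fun n => ENNReal.ofReal (backwardTime v n)) atTop (𝓝 (G v)) :=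
      tendsto_atTop_iSup fun m n hmn => ENNReal.ofReal_le_ofReal (hmono hmn)
    exact ((ENNReal.tendsto_toReal hfin.ne).comp h1).congr fun n => ENNReal.toReal_ofReal (h0 n)

end Chain

theorem tendsto_add_one_div_nat :
    Tendsto (fun n : ℕ => ((n : ℝ) + 1) / n) atTop (𝓝 1) := by
  have : Tendsto (fun k : ℕ => 1 + 1 / (k : ℝ)) atTop (𝓝 (1 + 0)) :=
    tendsto_const_nhds.add (tendsto_const_div_atTop_nhds_zero_nat 1)
  rw [add_zero] at this
  refine this.congr' ?_
  filter_upwards [eventually_gt_atTop 0] with k hk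
  have : (0 : ℝ) < k := by exact_mod_cast hk
  field_simp

section Steady

/-- `L` is the almost sure limit in Loynes' construction. -/
structure IsBackwardLimit (lam : ℝ) (F : Measure ℝ) (L : (ℕ → ℝ × ℝ) → ℝ) : Prop where
  measurable : Measurable L
  integrable : Integrable L (inputLaw lam F)
  bounds : ∀ᵐ v ∂inputLaw lam F, ∀ n, 0 ≤ backwardTime v n ∧ backwardTime v n ≤ L v
  tendsto : ∀ᵐ v ∂inputLaw lam F, Tendsto (backwardTime v) atTop (𝓝 (L v))

theorem IsBackwardLimit.nonneg {lam : ℝ} {F : Measure ℝ} {L : (ℕ → ℝ × ℝ) → ℝ}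
    (hL : IsBackwardLimit lam F L) :
    ∀ᵐ v ∂inputLaw lam F, 0 ≤ L v := by
  filter_upwards [hL.bounds] with v hv
  exact (hv 0).1.trans (hv 0).2

theorem integral_exp_neg_service_pos {lam : ℝ} {F : Measure ℝ} [IsProbabilityMeasure F]
    (hlam : 0 < lam) (hF : ∀ᵐ s ∂F, 0 ≤ s) :
    0 < ∫ s, Real.exp (-(lam * s)) ∂F := by
  refine integral_exp_pos ?_
  refine Integrable.of_bound (by fun_prop) 1 ?_
  filter_upwards [hF] with s hs
  rw [Real.norm_of_nonneg (Real.exp_pos _).le, Real.exp_le_one_iff]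
  have := mul_nonneg hlam.le hs
  linarith

variable {lam : ℝ} {F : Measure ℝ} [IsProbabilityMeasure F] [IsProbabilityMeasure (expMeasure lam)]

variable {L : (ℕ → ℝ × ℝ) → ℝ}

/-- Each mean may be computed with the backward time, which converges almost surely and is dominated
by the integrable `L`. -/
theorem IsBackwardLimit.tendsto_integral (hL : IsBackwardLimit lam F L) {g : ℝ → ℝ}
    (hg : Continuous g) {B : ℝ} (hB0 : 0 ≤ B) (hB : ∀ t, 0 ≤ t → |g t| ≤ B * (1 + t)) :
    Tendsto (fun n => ∫ v, g (pathTime v n) ∂inputLaw lam F) atTop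
      (𝓝 (∫ v, g (L v) ∂inputLaw lam F)) := by
  have h1 : ∀ n, ∫ v, g (pathTime v n) ∂inputLaw lam F =
      ∫ v, g (backwardTime v n) ∂inputLaw lam F := fun n =>
    ((identDistrib_pathTime_backwardTime n).comp hg.measurable).integral_eq
  simp only [h1]
  refine tendsto_integral_of_dominated_convergence (fun v => B * (1 + L v))
    (fun n => (hg.measurable.comp (measurable_backwardTime n)).aestronglyMeasurable)
    (((integrable_const 1).add hL.integrable).const_mul B) (fun n => ?_) ?_
  · filter_upwards [hL.bounds] with v hv
    refine (hB _ (hv n).1).trans ?_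
    gcongr
    exact (hv n).2
  · filter_upwards [hL.tendsto] with v hv
    exact (hg.tendsto _).comp hv

theorem exp_neg_mul_one_add_le {y : ℝ} : Real.exp (-y) * (1 + y) ≤ 1 := by
  have := Real.add_one_le_exp y
  calc Real.exp (-y) * (1 + y) ≤ Real.exp (-y) * Real.exp y := by gcongr; linarith
    _ = 1 := by rw [← Real.exp_add]; simp

/-- The means of `T_n` and `T_{n+1}` have the same finite limit, so the mean drift of the identity
tends to zero; the exponential term is what this determines. -/
theorem IsBackwardLimit.integral_exp_neg (hL : IsBackwardLimit lam F L) (hlam : 0 < lam)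
    (hF : ∀ᵐ s ∂F, 0 ≤ s) (hsq : Integrable (fun x : ℝ => x ^ 2) F) :
    ∫ v, Real.exp (-(lam * L v)) ∂inputLaw lam F = 1 - lam * ∫ s, s ∂F := by
  have h1 := hL.tendsto_integral continuous_id zero_le_one fun t ht => by
    simp only [id, abs_of_nonneg ht]; linarith
  have h2 := hL.tendsto_integral (g := fun t => Real.exp (-(lam * t))) (by fun_prop) zero_le_one
    fun t ht => by
      have : Real.exp (-(lam * t)) ≤ 1 :=
        Real.exp_le_one_iff.2 (by have := mul_nonneg hlam.le ht; linarith)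
      rw [abs_of_pos (Real.exp_pos _)]; linarith
  have h3 := ((h1.comp (tendsto_add_atTop_nat 1)).sub h1).const_mul lam
  have h4 : Tendsto (fun n => ∫ v, Real.exp (-(lam * pathTime v n)) ∂inputLaw lam F) atTop
      (𝓝 (0 + 1 - lam * ∫ s, s ∂F)) := by
    simp only [sub_self, mul_zero] at h3
    refine ((h3.add_const 1).sub_const _).congr fun n => ?_
    simp only [Function.comp, id]
    rw [integral_pathTime_succ hlam hF hsq n]
    field_simp
    ring
  simpa using tendsto_nhds_unique h2 h4

/-- Balancing `e^{-λt}` gives `E e^{-λL} = G_S(-λ) E[e^{-λL}(1 + λL)]`, which is linear in the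
unknown mean. -/
theorem IsBackwardLimit.integral_mul_exp_neg (hL : IsBackwardLimit lam F L) (hlam : 0 < lam)
    (hF : ∀ᵐ s ∂F, 0 ≤ s) (hsq : Integrable (fun x : ℝ => x ^ 2) F) :
    ∫ v, L v * Real.exp (-(lam * L v)) ∂inputLaw lam F =
      (1 - lam * ∫ s, s ∂F) * (1 - ∫ s, Real.exp (-(lam * s)) ∂F) /
        (lam * ∫ s, Real.exp (-(lam * s)) ∂F) := by
  have hp := hL.integral_exp_neg hlam hF hsq
  have hG := integral_exp_neg_service_pos hlam hF
  set G := ∫ s, Real.exp (-(lam * s)) ∂F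
  have h2 := hL.tendsto_integral (g := fun t => Real.exp (-(lam * t))) (by fun_prop) zero_le_one
    fun t ht => by
      have : Real.exp (-(lam * t)) ≤ 1 :=
        Real.exp_le_one_iff.2 (by have := mul_nonneg hlam.le ht; linarith)
      rw [abs_of_pos (Real.exp_pos _)]; linarith
  have h3 := hL.tendsto_integral (g := fun t => Real.exp (-(lam * t)) * (1 + lam * t))
    (by fun_prop) zero_le_one fun t ht => by
      have : 0 ≤ lam * t := mul_nonneg hlam.le ht
      rw [abs_of_nonneg (by positivity)]
      linarith [exp_neg_mul_one_add_le (y := lam * t)]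
  have h4 := tendsto_nhds_unique (h2.comp (tendsto_add_atTop_nat 1))
    ((h3.mul_const G).congr fun n => (integral_exp_neg_pathTime_succ hlam hF n).symm)
  have i1 : Integrable (fun v => Real.exp (-(lam * L v))) (inputLaw lam F) := by
    refine Integrable.of_bound
      ((hL.measurable.const_mul lam).neg.exp.aestronglyMeasurable) 1 ?_
    filter_upwards [hL.nonneg] with v hv
    rw [Real.norm_of_nonneg (Real.exp_pos _).le, Real.exp_le_one_iff]
    have := mul_nonneg hlam.le hv
    linarith
  have i2 : Integrable (fun v => L v * Real.exp (-(lam * L v))) (inputLaw lam F) := by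
    refine hL.integrable.mono
      (hL.measurable.mul (hL.measurable.const_mul lam).neg.exp).aestronglyMeasurable ?_
    filter_upwards [hL.nonneg] with v hv
    rw [norm_mul, Real.norm_of_nonneg (Real.exp_pos _).le]
    refine mul_le_of_le_one_right (norm_nonneg _) (Real.exp_le_one_iff.2 ?_)
    have := mul_nonneg hlam.le hv
    linarith
  have h5 : ∀ v, Real.exp (-(lam * L v)) * (1 + lam * L v) =
      Real.exp (-(lam * L v)) + lam * (L v * Real.exp (-(lam * L v))) := fun v => by ring
  simp only [h5] at h4
  rw [integral_add i1 (i2.const_mul lam), integral_const_mul, hp] at h4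
  rw [eq_div_iff (by positivity)]
  linarith

theorem IsBackwardLimit.hasDerivAt_mgf (hL : IsBackwardLimit lam F L) (hlam : 0 < lam) :
    HasDerivAt (mgf L (inputLaw lam F))
      (∫ v, L v * Real.exp (-(lam * L v)) ∂inputLaw lam F) (-lam) := by
  have hmem : -lam ∈ interior (integrableExpSet L (inputLaw lam F)) := by
    refine mem_interior.2 ⟨Set.Iio 0, fun r hr => ?_, isOpen_Iio, by simpa using hlam⟩
    refine Integrable.of_bound (hL.measurable.const_mul r).exp.aestronglyMeasurable 1 ?_
    filter_upwards [hL.nonneg] with v hv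
    rw [Real.norm_of_nonneg (Real.exp_pos _).le, Real.exp_le_one_iff]
    exact mul_nonpos_of_nonpos_of_nonneg (le_of_lt hr) hv
  have := ProbabilityTheory.hasDerivAt_mgf hmem
  simpa [neg_mul] using this

theorem IsBackwardLimit.tendstoInDistribution (hL : IsBackwardLimit lam F L) :
    TendstoInDistribution (fun n v => pathTime v n) atTop L (fun _ => inputLaw lam F)
      (inputLaw lam F) := by
  have h := tendstoInDistribution_of_ae_tendsto (l := atTop)
    (X := fun (n : ℕ) (v : ℕ → ℝ × ℝ) => backwardTime v n)
    (fun n => (measurable_backwardTime n).aemeasurable) hL.measurable.aemeasurable hL.tendsto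
  refine ⟨fun n => (measurable_pathTime n).aemeasurable, hL.measurable.aemeasurable, ?_⟩
  refine h.tendsto.congr fun n => ?_
  exact Subtype.ext (identDistrib_pathTime_backwardTime n).map_eq.symm

/-! ## Averages along the chain of system times -/

/-- The terms are compared with a telescoping series. Both for `y ≤ k` and for `k ≤ y`, the product
`(1 + y + k)(2 + y + k)` is at most four times the square of the larger of `1 + y` and `1 + k`. -/
theorem tsum_min_sq_le {y : ℝ} (hy : 0 ≤ y) :
    ∑' k : ℕ, ENNReal.ofReal (((1 + min y k) / (k + 1)) ^ 2) ≤ ENNReal.ofReal (4 * (1 + y)) := by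
  refine ENNReal.tsum_le_of_sum_range_le fun n => ?_
  rw [← ENNReal.ofReal_sum_of_nonneg fun k _ => sq_nonneg _]
  refine ENNReal.ofReal_le_ofReal ?_
  have key : ∀ k : ℕ, ((1 + min y k) / (k + 1)) ^ 2 ≤
      4 * (1 + y) ^ 2 * (1 / (1 + y + k) - 1 / (1 + y + (k + 1 : ℕ))) := fun k => by
    have hk : (0 : ℝ) ≤ k := k.cast_nonneg
    have h1 : 1 / (1 + y + k) - 1 / (1 + y + (k + 1 : ℕ)) =
        1 / ((1 + y + k) * (1 + y + (k + 1))) := by push_cast; field_simp; ring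
    rw [h1, div_pow, mul_one_div, div_le_div_iff₀ (by positivity) (by positivity)]
    rcases le_total y k with h | h
    · rw [min_eq_left h]
      have h2 : (1 + y + k) * (1 + y + (k + 1)) ≤ 4 * (k + 1) ^ 2 := by nlinarith
      nlinarith [sq_nonneg (1 + y)]
    · rw [min_eq_right h]
      have h2 : (1 + y + k) * (1 + y + (k + 1)) ≤ 4 * (1 + y) ^ 2 := by nlinarith
      nlinarith [sq_nonneg ((k : ℝ) + 1)]
  calc _ ≤ ∑ k ∈ Finset.range n,
        4 * (1 + y) ^ 2 * (1 / (1 + y + k) - 1 / (1 + y + (k + 1 : ℕ))) :=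
        Finset.sum_le_sum fun k _ => key k
    _ = 4 * (1 + y) ^ 2 * (1 / (1 + y) - 1 / (1 + y + n)) := by
        rw [← Finset.mul_sum, Finset.sum_range_sub' (fun k : ℕ => 1 / (1 + y + (k : ℝ)))]
        simp
    _ ≤ 4 * (1 + y) ^ 2 * (1 / (1 + y)) := by
        have : 0 ≤ 1 / (1 + y + n) := by positivity
        gcongr
        linarith
    _ = 4 * (1 + y) := by field_simp

/-- The system time of update `k`, truncated at `k`. -/
noncomputable def truncTime (v : ℕ → ℝ × ℝ) (k : ℕ) : ℝ := min (max (pathTime v k) 0) k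

theorem truncTime_nonneg (v : ℕ → ℝ × ℝ) (k : ℕ) : 0 ≤ truncTime v k :=
  le_min (le_max_right _ _) k.cast_nonneg

theorem measurable_truncTime (k : ℕ) : Measurable fun v => truncTime v k :=
  ((measurable_pathTime k).max measurable_const).min measurable_const

/-- In law `T_k` lies below `L`, so the sum is at most `4 E(1 + L)`. Truncation at `k` thus turns a
first moment into summable normalized second moments. -/
theorem IsBackwardLimit.tsum_lintegral_truncTime_ne_top (hL : IsBackwardLimit lam F L) :
    ∑' k : ℕ, ∫⁻ v, ENNReal.ofReal (((1 + truncTime v k) / (k + 1)) ^ 2) ∂inputLaw lam F ≠ ⊤ := by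
  have h1 : ∀ k : ℕ,
      ∫⁻ v, ENNReal.ofReal (((1 + truncTime v k) / (k + 1)) ^ 2) ∂inputLaw lam F ≤
        ∫⁻ v, ENNReal.ofReal (((1 + min (L v) k) / (k + 1)) ^ 2) ∂inputLaw lam F := fun k => by
    have hu : Measurable fun t : ℝ =>
      ENNReal.ofReal (((1 + min (max t 0) (k : ℝ)) / ((k : ℝ) + 1)) ^ 2) := by fun_prop
    have h2 := ((identDistrib_pathTime_backwardTime (lam := lam) (F := F) k).comp hu).lintegral_eq
    change ∫⁻ v, ENNReal.ofReal (((1 + min (max (pathTime v k) 0) (k : ℝ)) / (k + 1)) ^ 2)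
      ∂inputLaw lam F ≤ _
    refine (h2.le).trans ?_
    refine lintegral_mono_ae ?_
    filter_upwards [hL.bounds] with v hv
    have h3 := hv k
    simp only [Function.comp, max_eq_left h3.1]
    have : 0 ≤ min (backwardTime v k) k := le_min h3.1 k.cast_nonneg
    refine ENNReal.ofReal_le_ofReal ?_
    gcongr
    exact h3.2
  refine ne_top_of_le_ne_top ?_ (ENNReal.tsum_le_tsum h1)
  rw [← lintegral_tsum fun k => by have := hL.measurable; fun_prop]
  have h2 : ∫⁻ v, ENNReal.ofReal (4 * (1 + L v)) ∂inputLaw lam F ≠ ⊤ :=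
    (((integrable_const 1).add hL.integrable).const_mul 4).lintegral_lt_top.ne
  refine ne_top_of_le_ne_top h2 (lintegral_mono_ae ?_)
  filter_upwards [hL.nonneg] with v hv
  exact tsum_min_sq_le hv

/-- The series of squares converges almost surely, so its terms vanish. Once `(1 + truncTime v k) /
(k + 1) < 1` the truncation is inactive. -/
theorem IsBackwardLimit.ae_tendsto_pathTime_div (hL : IsBackwardLimit lam F L)
    (hF : ∀ᵐ s ∂F, 0 ≤ s) :
    ∀ᵐ v ∂inputLaw lam F, Tendsto (fun n : ℕ => pathTime v n / n) atTop (𝓝 0) ∧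
      ∀ᶠ n in atTop, truncTime v n = pathTime v n := by
  have h := hL.tsum_lintegral_truncTime_ne_top
  rw [← lintegral_tsum fun k => by have := measurable_truncTime k; fun_prop] at h
  filter_upwards [ae_inputs_nonneg hF, ae_lt_top (Measurable.tsum fun k => by
    have := measurable_truncTime k; fun_prop) h] with v hv hfin
  have h1 := ENNReal.tendsto_atTop_zero_of_tsum_ne_top hfin.ne
  have h2 := (ENNReal.tendsto_toReal ENNReal.zero_ne_top).comp h1
  have h3 : Tendsto (fun k : ℕ => (1 + truncTime v k) / ((k : ℝ) + 1)) atTop (𝓝 0) := by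
    have h4 := (Real.continuous_sqrt.tendsto 0).comp h2
    simp only [Real.sqrt_zero] at h4
    refine h4.congr fun k => ?_
    have := truncTime_nonneg v k
    simp only [Function.comp]
    rw [ENNReal.toReal_ofReal (sq_nonneg _), Real.sqrt_sq (by positivity)]
  have h5 : ∀ᶠ n in atTop, truncTime v n = pathTime v n := by
    filter_upwards [h3.eventually (gt_mem_nhds one_pos)] with n hn
    rw [div_lt_one (by positivity)] at hn
    have hT := pathTime_nonneg (fun i => (hv i).2) n
    have h6 : truncTime v n < n := by linarith
    simp only [truncTime, max_eq_left hT] at h6 ⊢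
    exact min_eq_left ((min_lt_iff.1 h6).resolve_right (lt_irrefl _)).le
  refine ⟨?_, h5⟩
  have h6 : Tendsto (fun k : ℕ => (1 + truncTime v k) / ((k : ℝ) + 1) * (((k : ℝ) + 1) / k))
      atTop (𝓝 (0 * 1)) := h3.mul tendsto_add_one_div_nat
  rw [zero_mul] at h6
  have h7 := h6.sub (tendsto_const_div_atTop_nhds_zero_nat (1 : ℝ))
  rw [sub_zero] at h7
  refine h7.congr' ?_
  filter_upwards [h5, eventually_gt_atTop 0] with k hk hk0
  have : (0 : ℝ) < k := by exact_mod_cast hk0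
  rw [← hk]
  field_simp
  ring

/-- The law of large numbers for functionals of the system time and the next inputs. -/
theorem IsBackwardLimit.ae_tendsto_average_sub_mean (hL : IsBackwardLimit lam F L)
    (hlam : 0 < lam) (hF : ∀ᵐ s ∂F, 0 ≤ s) (hsq : Integrable (fun x : ℝ => x ^ 2) F)
    {φ : ℝ → ℝ × ℝ → ℝ} (hφ : LinearGrowth φ) :
    ∀ᵐ v ∂inputLaw lam F, Tendsto (fun n : ℕ => (∑ k ∈ Finset.range n, (φ (pathTime v k) (v k) -
      ∫ p, φ (pathTime v k) p ∂(expMeasure lam).prod F)) / n) atTop (𝓝 0) := by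
  set κ := (expMeasure lam).prod F
  obtain ⟨hm, C, hC0, hC⟩ := id hφ
  have hW := memLp_inputWeight hlam hsq
  set EW := ∫ p, inputWeight p ∂κ
  set h : ℝ → ℝ := fun t => ∫ p, φ t p ∂κ
  have hhm : Measurable h := (hm.stronglyMeasurable.integral_prod_right).measurable
  have hh : ∀ t, 0 ≤ t → |h t| ≤ C * (1 + t) * EW := fun t ht => by
    rw [← integral_const_mul]
    refine (abs_integral_le_integral_abs).trans (integral_mono_of_nonneg
      (ae_of_all _ fun p => abs_nonneg _) ((hW.integrable one_le_two).const_mul _) ?_)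
    filter_upwards [ae_input_nonneg hF] with p hp
    exact hC t p ht hp.1 hp.2
  set D : ℕ → (ℕ → ℝ × ℝ) → ℝ × ℝ → ℝ := fun k v p =>
    (φ (truncTime v k) p - h (truncTime v k)) / (k + 1)
  have hWW : ∫⁻ p, ENNReal.ofReal (C ^ 2 * (inputWeight p + EW) ^ 2) ∂κ ≠ ⊤ :=
    ((hW.add (memLp_const EW)).integrable_sq.const_mul (C ^ 2)).lintegral_lt_top.ne
  have hconv := ae_exists_tendsto_sum_of_mean_zero κ D
    (fun k => by
      have h1 : Measurable fun q : (ℕ → ℝ × ℝ) × (ℝ × ℝ) => truncTime q.1 k :=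
        (measurable_truncTime k).comp measurable_fst
      exact ((hm.comp (h1.prodMk measurable_snd)).sub (hhm.comp h1)).div_const _)
    (fun k v w hvw => by
      have : truncTime v k = truncTime w k := by
        simp only [truncTime,
          show pathTime v k = pathTime w k from dependsOnPast_pathTime k v w hvw]
      simp only [D, this])
    (fun k v => by
      simp only [D]
      rw [integral_div, integral_sub (hφ.integrable hlam hF hsq (truncTime_nonneg v k))
        (integrable_const _)]
      simp [h, κ])
    (by
      have h1 : ∀ k v, ∫⁻ p, ENNReal.ofReal (D k v p ^ 2) ∂κ ≤
          (∫⁻ p, ENNReal.ofReal (C ^ 2 * (inputWeight p + EW) ^ 2) ∂κ) *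
            ENNReal.ofReal (((1 + truncTime v k) / (k + 1)) ^ 2) := fun k v => by
        have hcW := continuous_inputWeight
        rw [← lintegral_mul_const _ (by fun_prop)]
        refine lintegral_mono_ae ?_
        filter_upwards [ae_input_nonneg hF] with p hp
        have ht := truncTime_nonneg v k
        have hp0 := inputWeight_pos p
        rw [← ENNReal.ofReal_mul (by positivity)]
        refine ENNReal.ofReal_le_ofReal ?_
        have h2 : |φ (truncTime v k) p - h (truncTime v k)| ≤
            C * (1 + truncTime v k) * (inputWeight p + EW) := by
          refine (abs_sub _ _).trans ?_
          linarith [hC _ p ht hp.1 hp.2, hh _ ht]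
        have h3 := pow_le_pow_left₀ (abs_nonneg _) h2 2
        rw [sq_abs] at h3
        simp only [D]
        rw [div_pow, div_pow, ← mul_div_assoc]
        gcongr
        refine h3.trans_eq (by ring)
      refine ne_top_of_le_ne_top ?_ (ENNReal.tsum_le_tsum fun k => lintegral_mono (h1 k))
      have h2 : ∀ k : ℕ, ∫⁻ v, (∫⁻ p, ENNReal.ofReal (C ^ 2 * (inputWeight p + EW) ^ 2) ∂κ) *
            ENNReal.ofReal (((1 + truncTime v k) / (k + 1)) ^ 2) ∂(Measure.infinitePi fun _ => κ) =
          (∫⁻ p, ENNReal.ofReal (C ^ 2 * (inputWeight p + EW) ^ 2) ∂κ) *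
            ∫⁻ v, ENNReal.ofReal (((1 + truncTime v k) / (k + 1)) ^ 2)
              ∂(Measure.infinitePi fun _ => κ) := fun k =>
        lintegral_const_mul _ (by have := measurable_truncTime k; fun_prop)
      simp only [h2]
      rw [ENNReal.tsum_mul_left]
      exact ENNReal.mul_ne_top hWW hL.tsum_lintegral_truncTime_ne_top)
  filter_upwards [hconv, hL.ae_tendsto_pathTime_div hF] with v ⟨c, hc⟩ ⟨_, hev⟩
  have hK := tendsto_inv_mul_sum_of_tendsto_sum_div (b := fun n : ℕ => (n : ℝ) + 1)
    (d := fun k => φ (truncTime v k) (v k) - h (truncTime v k)) (fun n => by positivity)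
    (fun m n hmn => by simpa using hmn)
    (tendsto_atTop_add_const_right _ _ tendsto_natCast_atTop_atTop) hc
  obtain ⟨N, hN⟩ := eventually_atTop.1 hev
  -- Truncation alters only the terms with index below `N`; their total correction is constant in
  -- `n` and vanishes after division.
  have h1 := (hK.mul tendsto_add_one_div_nat).add (tendsto_const_div_atTop_nhds_zero_nat
    (∑ k ∈ Finset.range N, ((φ (pathTime v k) (v k) - h (pathTime v k)) -
      (φ (truncTime v k) (v k) - h (truncTime v k)))))
  simp only [zero_mul, add_zero] at h1
  refine h1.congr' ?_
  filter_upwards [eventually_ge_atTop N, eventually_gt_atTop 0] with n hn hn0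
  have hn1 : (0 : ℝ) < n := by exact_mod_cast hn0
  have h2 : ∑ k ∈ Finset.range n, ((φ (pathTime v k) (v k) - h (pathTime v k)) -
      (φ (truncTime v k) (v k) - h (truncTime v k))) =
      ∑ k ∈ Finset.range N, ((φ (pathTime v k) (v k) - h (pathTime v k)) -
      (φ (truncTime v k) (v k) - h (truncTime v k))) := by
    refine (Finset.sum_subset (Finset.range_mono hn) fun k _ hk => ?_).symm
    rw [hN k (by simpa using hk), sub_self]
  rw [← h2, div_mul_div_cancel₀ (by positivity), ← add_div, ← Finset.sum_add_distrib]
  congr 1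
  exact Finset.sum_congr rfl fun k _ => by ring

end Steady

-- Functionals of linear growth

theorem linearGrowth_of_continuous {φ : ℝ → ℝ × ℝ → ℝ} (hc : Continuous (Function.uncurry φ))
    {C : ℝ} (hC : 0 ≤ C)
    (h : ∀ t x s : ℝ, 0 ≤ t → 0 < x → 0 ≤ s →
      |φ t (x, s)| ≤ C * (1 + t) * ((1 + x ^ 2) * (1 + s))) : LinearGrowth φ :=
  ⟨hc.measurable, C, hC, fun t p ht hx hs => by
    simpa [inputWeight, abs_of_nonneg hs] using h t p.1 p.2 ht hx hs⟩

theorem continuous_systemStep : Continuous (Function.uncurry systemStep) := by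
  simp only [Function.uncurry_def, systemStep]; fun_prop

theorem continuous_systemStep_prod :
    Continuous fun q : ℝ × ℝ × ℝ => systemStep q.1 q.2 := continuous_systemStep

theorem linearGrowth_systemStep : LinearGrowth systemStep :=
  linearGrowth_of_continuous continuous_systemStep zero_le_one fun t x s ht hx hs => by
    rw [abs_of_nonneg (systemStep_nonneg hs)]
    have h := systemStep_le (p := (x, s)) ht hx.le
    have h1 : t + s ≤ (1 + t) * (1 + s) := by nlinarith
    have h2 : (1 + t) * (1 + s) ≤ 1 * (1 + t) * ((1 + x ^ 2) * (1 + s)) := by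
      have : 0 ≤ (1 + t) * (1 + s) * x ^ 2 := by positivity
      linarith
    exact h.trans (h1.trans h2)

theorem linearGrowth_exp_neg_systemStep {r : ℝ} (hr : 0 ≤ r) :
    LinearGrowth fun t p => Real.exp (-(r * systemStep t p)) :=
  linearGrowth_of_continuous
    ((continuous_systemStep_prod.const_mul r).neg.rexp) zero_le_one fun t x s ht hx hs => by
    rw [abs_of_pos (Real.exp_pos _)]
    have h1 : Real.exp (-(r * systemStep t (x, s))) ≤ 1 := Real.exp_le_one_iff.2 (by
      have := mul_nonneg hr (systemStep_nonneg (t := t) (p := (x, s)) hs)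
      linarith)
    have h2 : 1 ≤ 1 + t := by linarith
    have h3 : 1 ≤ (1 + x ^ 2) * (1 + s) := one_le_mul_of_one_le_of_one_le (by nlinarith) (by linarith)
    rw [one_mul]
    exact h1.trans (one_le_mul_of_one_le_of_one_le h2 h3)

/-- With `y = (t - x)⁺`, the expression is `y² - t² + 2ys`, and `t² - y² ≤ 2tx`. Removing `t²`
restores linear growth in `t`; removing `s²` avoids a fourth service moment. -/
theorem linearGrowth_systemStep_sq_sub :
    LinearGrowth fun t p => systemStep t p ^ 2 - t ^ 2 - p.2 ^ 2 :=
  linearGrowth_of_continuous (C := 2)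
    (((continuous_systemStep_prod.pow 2).sub (continuous_fst.pow 2)).sub
      (continuous_snd.snd.pow 2)) zero_le_two fun t x s ht hx hs => by
    have h0 : 0 ≤ max (t - x) 0 := le_max_right _ _
    have h1 : max (t - x) 0 ≤ t := max_le (by linarith) ht
    have h2 : t - x ≤ max (t - x) 0 := le_max_left _ _
    simp only [systemStep]
    set y := max (t - x) 0
    have h3 : (t - y) * (t + y) ≤ x * (2 * t) :=
      mul_le_mul (by linarith) (by linarith) (by linarith) hx.le
    have h4 : y * s ≤ t * s := mul_le_mul_of_nonneg_right h1 hs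
    have h5 : 0 ≤ y * s := mul_nonneg h0 hs
    have h6 : 0 ≤ (t - y) * (t + y) := mul_nonneg (by linarith) (by linarith)
    have h7 : 2 * t * (x + s) ≤ 2 * (1 + t) * ((1 + x ^ 2) * (1 + s)) := by
      have : x + s ≤ (1 + x ^ 2) * (1 + s) := by
        nlinarith [sq_nonneg (x - 1), mul_nonneg hs (sq_nonneg x)]
      exact mul_le_mul (by linarith) this (by positivity) (by positivity)
    rw [abs_le]
    constructor <;> nlinarith

theorem linearGrowth_systemStep_mul :
    LinearGrowth fun t p => systemStep t p * p.1 + p.1 ^ 2 / 2 :=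
  linearGrowth_of_continuous (C := 2)
    ((continuous_systemStep_prod.mul continuous_snd.fst).add
      ((continuous_snd.fst.pow 2).div_const 2)) zero_le_two fun t x s ht hx hs => by
    have h := systemStep_le (p := (x, s)) ht hx.le
    have h0 := systemStep_nonneg (t := t) (p := (x, s)) hs
    simp only at h h0 ⊢
    rw [abs_of_nonneg (by positivity)]
    have h1 : systemStep t (x, s) * x ≤ (t + s) * x := mul_le_mul_of_nonneg_right h hx.le
    have h2 : (t + s) * x ≤ (1 + t) * ((1 + x ^ 2) * (1 + s)) := by
      have h3 : t + s ≤ (1 + t) * (1 + s) := by nlinarith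
      have h4 : x ≤ 1 + x ^ 2 := by nlinarith [sq_nonneg (x - 1)]
      have := mul_le_mul h3 h4 hx.le (by positivity)
      linarith
    have h3 : x ^ 2 / 2 ≤ (1 + t) * ((1 + x ^ 2) * (1 + s)) := by
      have h4 : 1 ≤ (1 + t) * (1 + s) := one_le_mul_of_one_le_of_one_le (by linarith) (by linarith)
      have h5 := mul_le_mul_of_nonneg_right h4 (by positivity : 0 ≤ 1 + x ^ 2)
      nlinarith
    linarith

/-! ### Small parameter asymptotics of the service transform -/

/-- `(1 - y + y²/2)(1 + y + y²/2) = 1 + y⁴/4 ≥ 1`, and the second factor is at most `e^y`. -/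
theorem exp_neg_le_quadratic {y : ℝ} (hy : 0 ≤ y) : Real.exp (-y) ≤ 1 - y + y ^ 2 / 2 := by
  have h1 := Real.quadratic_le_exp_of_nonneg hy
  have h2 : 0 < 1 + y + y ^ 2 / 2 := by positivity
  rw [Real.exp_neg, inv_eq_one_div, div_le_iff₀ (Real.exp_pos y)]
  have h3 : 0 ≤ 1 - y + y ^ 2 / 2 := by nlinarith [sq_nonneg (y - 1)]
  have h4 := mul_le_mul_of_nonneg_left h1 h3
  nlinarith [pow_nonneg hy 4]

theorem tendsto_exp_neg_second_order (s : ℝ) :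
    Tendsto (fun r : ℝ => (Real.exp (-(r * s)) - 1 + r * s) / r ^ 2) (𝓝[>] 0)
      (𝓝 (s ^ 2 / 2)) := by
  have h1 : Tendsto (fun r : ℝ => |s| ^ 3 * |r|) (𝓝[>] 0) (𝓝 0) := by
    have : Continuous fun r : ℝ => |s| ^ 3 * |r| := by fun_prop
    simpa using (this.tendsto 0).mono_left nhdsWithin_le_nhds
  have h2 : ∀ᶠ r : ℝ in 𝓝[>] 0, |r * s| ≤ 1 := by
    have : Tendsto (fun r : ℝ => |r * s|) (𝓝[>] 0) (𝓝 0) := by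
      have : Continuous fun r : ℝ => |r * s| := by fun_prop
      simpa using (this.tendsto 0).mono_left nhdsWithin_le_nhds
    exact (this.eventually (gt_mem_nhds one_pos)).mono fun r hr => le_of_lt hr
  rw [tendsto_iff_norm_sub_tendsto_zero]
  refine squeeze_zero' (Eventually.of_forall fun r => norm_nonneg _) ?_ h1
  filter_upwards [h2, self_mem_nhdsWithin] with r hr hr0
  have hr0' : 0 < r := hr0
  have h3 := Real.exp_bound (x := -(r * s)) (by rwa [abs_neg]) (n := 3) (by norm_num)
  simp [Finset.sum_range_succ, Nat.factorial] at h3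
  have h4 : (Real.exp (-(r * s)) - 1 + r * s) / r ^ 2 - s ^ 2 / 2 =
      (Real.exp (-(r * s)) - (1 + -(r * s) + (r * s) ^ 2 / 2)) / r ^ 2 := by
    field_simp; ring
  rw [h4, Real.norm_eq_abs, abs_div, abs_of_pos (by positivity : 0 < r ^ 2),
    div_le_iff₀ (by positivity)]
  refine h3.trans ?_
  rw [abs_of_pos hr0']
  have : 0 ≤ (r * |s|) ^ 3 := by positivity
  nlinarith

section Service

variable {F : Measure ℝ} [IsProbabilityMeasure F]

theorem integrable_exp_neg_service (hF : ∀ᵐ s ∂F, 0 ≤ s) {r : ℝ} (hr : 0 ≤ r) :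
    Integrable (fun s => Real.exp (-(r * s))) F := by
  refine Integrable.of_bound (by fun_prop) 1 ?_
  filter_upwards [hF] with s hs
  rw [Real.norm_of_nonneg (Real.exp_pos _).le, Real.exp_le_one_iff]
  have := mul_nonneg hr hs
  linarith

/-- The second-order quotients are dominated by `s²/2`, so a second moment suffices for the
expansion. -/
theorem tendsto_service_second_order (hF : ∀ᵐ s ∂F, 0 ≤ s)
    (hsq : Integrable (fun x : ℝ => x ^ 2) F) :
    Tendsto (fun r : ℝ => ((∫ s, Real.exp (-(r * s)) ∂F) - 1 + r * ∫ s, s ∂F) / r ^ 2) (𝓝[>] 0)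
      (𝓝 ((∫ s, s ^ 2 ∂F) / 2)) := by
  have hS := integrable_of_integrable_sq hsq
  rw [← integral_div]
  have h := tendsto_integral_filter_of_dominated_convergence (μ := F) (l := 𝓝[>] (0 : ℝ))
    (F := fun r s => (Real.exp (-(r * s)) - 1 + r * s) / r ^ 2) (f := fun s => s ^ 2 / 2)
    (fun s => s ^ 2 / 2) (Eventually.of_forall fun r => by fun_prop) ?_ (hsq.div_const 2)
    (ae_of_all _ tendsto_exp_neg_second_order)
  · refine h.congr' ?_
    filter_upwards [self_mem_nhdsWithin] with r hr
    have hr0 : 0 < r := hr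
    have i1 := integrable_exp_neg_service hF hr0.le
    have i2 : Integrable (fun s => Real.exp (-(r * s)) - 1) F := i1.sub (integrable_const _)
    rw [integral_div, integral_add i2 (hS.const_mul r), integral_sub i1 (integrable_const _),
      integral_const_mul]
    simp
  · filter_upwards [self_mem_nhdsWithin] with r hr
    have hr0 : 0 < r := hr
    filter_upwards [hF] with s hs
    have h1 := exp_neg_le_quadratic (mul_nonneg hr0.le hs)
    have h2 := Real.add_one_le_exp (-(r * s))
    rw [Real.norm_of_nonneg (div_nonneg (by linarith) (by positivity)),
      div_le_iff₀ (by positivity)]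
    nlinarith

end Service

-- Averages of sequences

/-- The average of the first `n` terms of a sequence. -/
noncomputable def seqAvg (u : ℕ → ℝ) (n : ℕ) : ℝ := (∑ k ∈ Finset.range n, u k) / n

theorem seqAvg_add (u w : ℕ → ℝ) (n : ℕ) :
    seqAvg (fun k => u k + w k) n = seqAvg u n + seqAvg w n := by
  simp [seqAvg, Finset.sum_add_distrib, add_div]

theorem seqAvg_sub (u w : ℕ → ℝ) (n : ℕ) :
    seqAvg (fun k => u k - w k) n = seqAvg u n - seqAvg w n := by
  simp [seqAvg, Finset.sum_sub_distrib, sub_div]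

theorem seqAvg_const_mul (c : ℝ) (u : ℕ → ℝ) (n : ℕ) :
    seqAvg (fun k => c * u k) n = c * seqAvg u n := by
  simp [seqAvg, ← Finset.mul_sum, mul_div_assoc]

theorem seqAvg_const (c : ℝ) {n : ℕ} (hn : n ≠ 0) : seqAvg (fun _ => c) n = c := by
  simp [seqAvg, hn]

theorem tendsto_seqAvg_const (c : ℝ) : Tendsto (seqAvg fun _ => c) atTop (𝓝 c) :=
  tendsto_const_nhds.congr' ((eventually_ne_atTop 0).mono fun _ hn => (seqAvg_const c hn).symm)

theorem seqAvg_shift (u : ℕ → ℝ) (n : ℕ) :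
    seqAvg (fun k => u (k + 1)) n = seqAvg u n + (u n - u 0) / n := by
  simp only [seqAvg]
  rw [← add_div, ← Finset.sum_range_sub u n, ← Finset.sum_add_distrib]
  congr 1
  exact Finset.sum_congr rfl fun k _ => by ring

theorem tendsto_bounded_div {u : ℕ → ℝ} (hu : ∀ n, |u n| ≤ 1) :
    Tendsto (fun n : ℕ => (u n - u 0) / n) atTop (𝓝 0) := by
  refine squeeze_zero_norm (fun n => ?_) (tendsto_const_div_atTop_nhds_zero_nat 2)
  rw [norm_div, Real.norm_natCast]
  gcongr
  exact (abs_sub _ _).trans (by linarith [hu n, hu 0])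

/-- The right derivative at the origin of the Pollaczek-Khinchine transform. -/
theorem tendsto_one_sub_transform_div {lam : ℝ} {F : Measure ℝ}
    [IsProbabilityMeasure F] (hF : ∀ᵐ s ∂F, 0 ≤ s)
    (hsq : Integrable (fun x : ℝ => x ^ 2) F) (hload : lam * ∫ s, s ∂F < 1) :
    Tendsto (fun r : ℝ => (1 - r * (1 - lam * ∫ s, s ∂F) * (∫ s, Real.exp (-(r * s)) ∂F) /
        (r - lam + lam * ∫ s, Real.exp (-(r * s)) ∂F)) / r) (𝓝[>] 0)
      (𝓝 ((∫ s, s ∂F) + lam * (∫ s, s ^ 2 ∂F) / (2 * (1 - lam * ∫ s, s ∂F)))) := by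
  have h1 := tendsto_service_second_order hF hsq
  set b := ∫ s, s ∂F
  set w : ℝ → ℝ := fun r => ((∫ s, Real.exp (-(r * s)) ∂F) - 1 + r * b) / r ^ 2
  have h0 : Tendsto (fun r : ℝ => r) (𝓝[>] 0) (𝓝 0) := tendsto_id.mono_left nhdsWithin_le_nhds
  have ha : Tendsto (fun r : ℝ => b - r * w r) (𝓝[>] 0) (𝓝 b) := by
    simpa using (h0.mul h1).const_sub b
  have hp : 1 - lam * b ≠ 0 := by linarith
  have h2 := ((h1.const_mul lam).add (ha.const_mul (1 - lam * b))).div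
    ((ha.const_mul lam).const_sub 1) hp
  have e0 : (lam * ((∫ s, s ^ 2 ∂F) / 2) + (1 - lam * b) * b) / (1 - lam * b) =
      b + lam * (∫ s, s ^ 2 ∂F) / (2 * (1 - lam * b)) := by field_simp; ring
  rw [e0] at h2
  have hpos : ∀ᶠ r in 𝓝[>] (0 : ℝ), 0 < 1 - lam * (b - r * w r) :=
    ((ha.const_mul lam).const_sub 1).eventually (lt_mem_nhds (by linarith))
  refine h2.congr' ?_
  filter_upwards [hpos, self_mem_nhdsWithin] with r hr hr0
  have hr0' : 0 < r := hr0
  -- In terms of the second-order quotient `w`, the denominator acquires a factor `r` that cancels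
  -- the one in the numerator.
  have e1 : (∫ s, Real.exp (-(r * s)) ∂F) = 1 - r * (b - r * w r) := by
    simp only [w]; field_simp; ring
  have e2 : r - lam + lam * (1 - r * (b - r * w r)) = r * (1 - lam * (b - r * w r)) := by ring
  simp only [Pi.div_apply]
  rw [e1, e2, mul_assoc r, mul_div_mul_left _ _ hr0'.ne', one_sub_div hr.ne', div_div,
    div_eq_div_iff hr.ne' (mul_pos hr hr0').ne']
  ring

-- Almost sure averages of the system times

section Averages

variable {lam : ℝ} {F : Measure ℝ} [IsProbabilityMeasure F] [IsProbabilityMeasure (expMeasure lam)]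
  {L : (ℕ → ℝ × ℝ) → ℝ}

theorem abs_exp_neg_le_one {y : ℝ} (hy : 0 ≤ y) : |Real.exp (-y)| ≤ 1 := by
  rw [abs_of_pos (Real.exp_pos _), Real.exp_le_one_iff]; linarith

/-- The pathwise balance of the identity: the increments telescope to `T_n / n`, which vanishes, so
the average drift tends to zero. -/
theorem IsBackwardLimit.ae_tendsto_avg_exp_rate (hL : IsBackwardLimit lam F L) (hlam : 0 < lam)
    (hF : ∀ᵐ s ∂F, 0 ≤ s) (hsq : Integrable (fun x : ℝ => x ^ 2) F) :
    ∀ᵐ v ∂inputLaw lam F, Tendsto (seqAvg fun k => Real.exp (-(lam * pathTime v k))) atTop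
      (𝓝 (1 - lam * ∫ s, s ∂F)) := by
  filter_upwards [hL.ae_tendsto_average_sub_mean hlam hF hsq linearGrowth_systemStep,
    hL.ae_tendsto_pathTime_div hF, ae_inputs_nonneg hF] with v h1 ⟨h2, _⟩ hv
  have h3 := ((h2.sub h1).const_mul lam).add_const (1 - lam * ∫ s, s ∂F)
  simp only [sub_self, mul_zero, zero_add] at h3
  refine h3.congr' ?_
  filter_upwards [eventually_ne_atTop 0] with n hn
  have e1 : ∑ k ∈ Finset.range n, (systemStep (pathTime v k) (v k) -
      ∫ p, systemStep (pathTime v k) p ∂(expMeasure lam).prod F) =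
      pathTime v n - ∑ k ∈ Finset.range n,
        (Real.exp (-(lam * pathTime v k)) / lam - 1 / lam + ∫ s, s ∂F) := by
    have := Finset.sum_range_sub (fun k => pathTime v k) n
    rw [pathTime_zero, sub_zero] at this
    rw [← this, ← Finset.sum_sub_distrib]
    refine Finset.sum_congr rfl fun k _ => ?_
    rw [integral_systemStep hlam hsq (pathTime_nonneg (fun i => (hv i).2) k), pathTime_succ]
    ring
  have hn' : (n : ℝ) ≠ 0 := by exact_mod_cast hn
  rw [e1, Finset.sum_add_distrib, Finset.sum_sub_distrib, ← Finset.sum_div]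
  simp only [seqAvg, Finset.sum_const, Finset.card_range, nsmul_eq_mul]
  field_simp
  ring

theorem IsBackwardLimit.ae_tendsto_avg_exp (hL : IsBackwardLimit lam F L) (hlam : 0 < lam)
    (hF : ∀ᵐ s ∂F, 0 ≤ s) (hsq : Integrable (fun x : ℝ => x ^ 2) F)
    (hload : lam * ∫ s, s ∂F < 1) {r : ℝ} (hr : 0 < r) (hrl : r ≠ lam) :
    ∀ᵐ v ∂inputLaw lam F, Tendsto (seqAvg fun k => Real.exp (-(r * pathTime v k))) atTop
      (𝓝 (r * (1 - lam * ∫ s, s ∂F) * (∫ s, Real.exp (-(r * s)) ∂F) /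
        (r - lam + lam * ∫ s, Real.exp (-(r * s)) ∂F))) := by
  have hS := integrable_of_integrable_sq hsq
  set G := ∫ s, Real.exp (-(r * s)) ∂F with hG
  have hGle : 1 - r * ∫ s, s ∂F ≤ G := by
    have h1 : ∫ s, (1 - r * s) ∂F ≤ G :=
      integral_mono ((integrable_const _).sub (hS.const_mul r))
        (integrable_exp_neg_service hF hr.le) fun s => by
          have := Real.add_one_le_exp (-(r * s))
          simp only; linarith
    rw [integral_sub (integrable_const _) (hS.const_mul r), integral_const_mul] at h1
    simpa using h1
  -- From `G ≥ 1 - r E[S]`, the denominator is at least `r (1 - ρ)`.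
  have hden : 0 < r - lam + lam * G := by nlinarith
  have hrl' : r - lam ≠ 0 := sub_ne_zero.2 hrl
  filter_upwards [hL.ae_tendsto_average_sub_mean hlam hF hsq (linearGrowth_exp_neg_systemStep hr.le),
    hL.ae_tendsto_avg_exp_rate hlam hF hsq, ae_inputs_nonneg hF] with v h1 h2 hv
  have hT := pathTime_nonneg (fun i => (hv i).2)
  have h3 := tendsto_bounded_div fun n => abs_exp_neg_le_one (mul_nonneg hr.le (hT n))
  have h4 := ((((h1.sub h3).const_mul (r - lam)).add (h2.const_mul (r * G))).div_const
    (r - lam + lam * G))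
  simp only [sub_self, mul_zero, zero_add] at h4
  rw [show r * (1 - lam * ∫ s, s ∂F) * G / (r - lam + lam * G) =
    r * G * (1 - lam * ∫ s, s ∂F) / (r - lam + lam * G) by ring]
  refine h4.congr fun n => ?_
  have e1 : (∑ k ∈ Finset.range n, (Real.exp (-(r * systemStep (pathTime v k) (v k))) -
      ∫ p, Real.exp (-(r * systemStep (pathTime v k) p)) ∂(expMeasure lam).prod F)) / n =
      seqAvg (fun k => Real.exp (-(r * pathTime v k))) n +
        (Real.exp (-(r * pathTime v n)) - Real.exp (-(r * pathTime v 0))) / n -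
        G / (r - lam) * (r * seqAvg (fun k => Real.exp (-(lam * pathTime v k))) n -
          lam * seqAvg (fun k => Real.exp (-(r * pathTime v k))) n) := by
    rw [← seqAvg_shift fun k => Real.exp (-(r * pathTime v k)), ← seqAvg_const_mul,
      ← seqAvg_const_mul, ← seqAvg_sub, ← seqAvg_const_mul, ← seqAvg_sub]
    simp only [seqAvg]
    congr 1
    refine Finset.sum_congr rfl fun k _ => ?_
    rw [integral_exp_neg_systemStep hlam hr.le hrl (hT k), pathTime_succ]
    ring
  rw [e1, div_eq_iff hden.ne']
  field_simp
  ring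

theorem IsBackwardLimit.ae_tendsto_avg_mul_exp_rate (hL : IsBackwardLimit lam F L)
    (hlam : 0 < lam) (hF : ∀ᵐ s ∂F, 0 ≤ s) (hsq : Integrable (fun x : ℝ => x ^ 2) F) :
    ∀ᵐ v ∂inputLaw lam F,
      Tendsto (seqAvg fun k => pathTime v k * Real.exp (-(lam * pathTime v k))) atTop
        (𝓝 ((1 - lam * ∫ s, s ∂F) * (1 - ∫ s, Real.exp (-(lam * s)) ∂F) /
          (lam * ∫ s, Real.exp (-(lam * s)) ∂F))) := by
  have hG0 := integral_exp_neg_service_pos hlam hF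
  set G := ∫ s, Real.exp (-(lam * s)) ∂F with hG
  filter_upwards [hL.ae_tendsto_average_sub_mean hlam hF hsq
    (linearGrowth_exp_neg_systemStep hlam.le),
    hL.ae_tendsto_avg_exp_rate hlam hF hsq, ae_inputs_nonneg hF] with v h1 h2 hv
  have hT := pathTime_nonneg (fun i => (hv i).2)
  have h3 := tendsto_bounded_div fun n => abs_exp_neg_le_one (mul_nonneg hlam.le (hT n))
  have h4 := (((h2.const_mul (1 - G)).add h3).sub h1).div_const (lam * G)
  simp only [add_zero, sub_zero] at h4
  rw [mul_comm (1 - G)] at h4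
  refine h4.congr fun n => ?_
  have e1 : (∑ k ∈ Finset.range n, (Real.exp (-(lam * systemStep (pathTime v k) (v k))) -
      ∫ p, Real.exp (-(lam * systemStep (pathTime v k) p)) ∂(expMeasure lam).prod F)) / n =
      seqAvg (fun k => Real.exp (-(lam * pathTime v k))) n +
        (Real.exp (-(lam * pathTime v n)) - Real.exp (-(lam * pathTime v 0))) / n -
        G * (seqAvg (fun k => Real.exp (-(lam * pathTime v k))) n +
          lam * seqAvg (fun k => pathTime v k * Real.exp (-(lam * pathTime v k))) n) := by
    rw [← seqAvg_shift fun k => Real.exp (-(lam * pathTime v k)), ← seqAvg_const_mul,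
      ← seqAvg_add, ← seqAvg_const_mul, ← seqAvg_sub]
    simp only [seqAvg]
    congr 1
    refine Finset.sum_congr rfl fun k _ => ?_
    rw [integral_exp_neg_rate_systemStep hlam (hT k), pathTime_succ]
    ring
  rw [e1, div_eq_iff (by positivity)]
  ring

/-- The balance of `t²`. The boundary term `T_n²/n` must stay for now: `T_n/n → 0` alone does not
make it vanish. The removed `s²` is averaged by the strong law. -/
theorem IsBackwardLimit.ae_tendsto_sq_div_add_avg (hL : IsBackwardLimit lam F L)
    (hlam : 0 < lam) (hF : ∀ᵐ s ∂F, 0 ≤ s) (hsq : Integrable (fun x : ℝ => x ^ 2) F) :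
    ∀ᵐ v ∂inputLaw lam F,
      Tendsto (fun n : ℕ => pathTime v n ^ 2 / n +
          2 * (1 / lam - ∫ s, s ∂F) * seqAvg (pathTime v) n) atTop
        (𝓝 ((∫ s, s ^ 2 ∂F) + 2 * (1 / lam - ∫ s, s ∂F) * ∫ s, s ∂F)) := by
  have hs2 := ae_tendsto_average_infinitePi ((expMeasure lam).prod F)
    (f := fun p : ℝ × ℝ => p.2 ^ 2) (by fun_prop) (hsq.comp_snd (expMeasure lam))
  rw [integral_fun_snd (fun s : ℝ => s ^ 2)] at hs2
  simp only [probReal_univ, one_smul] at hs2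
  filter_upwards [hL.ae_tendsto_average_sub_mean hlam hF hsq linearGrowth_systemStep_sq_sub,
    hL.ae_tendsto_avg_exp_rate hlam hF hsq, ae_inputs_nonneg hF, hs2] with v h1 h2 hv h3
  have hT := pathTime_nonneg (fun i => (hv i).2)
  set b := ∫ s, s ∂F
  have h4 := (((h1.add h3).add (h2.const_mul (2 * b / lam - 2 / lam ^ 2))).add_const
    (2 / lam ^ 2 - 2 * b / lam))
  have e0 : 0 + (∫ s, s ^ 2 ∂F) + (2 * b / lam - 2 / lam ^ 2) * (1 - lam * b) +
      (2 / lam ^ 2 - 2 * b / lam) = (∫ s, s ^ 2 ∂F) + 2 * (1 / lam - b) * b := by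
    field_simp; ring
  rw [e0] at h4
  refine h4.congr' ?_
  filter_upwards [eventually_ne_atTop 0] with n hn
  have e1 : (∑ k ∈ Finset.range n, (systemStep (pathTime v k) (v k) ^ 2 - pathTime v k ^ 2 -
      (v k).2 ^ 2 - ∫ p, (systemStep (pathTime v k) p ^ 2 - pathTime v k ^ 2 - p.2 ^ 2)
        ∂(expMeasure lam).prod F)) / n =
      (pathTime v n ^ 2 - pathTime v 0 ^ 2) / n - seqAvg (fun k => (v k).2 ^ 2) n -
        ((2 * b - 2 / lam) * seqAvg (pathTime v) n +
          (2 * b / lam - 2 / lam ^ 2) * seqAvg (fun k => Real.exp (-(lam * pathTime v k))) n +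
          (2 / lam ^ 2 - 2 * b / lam)) := by
    have := Finset.sum_range_sub (fun k => pathTime v k ^ 2) n
    rw [← this, ← seqAvg_const (2 / lam ^ 2 - 2 * b / lam) hn, ← seqAvg_const_mul,
      ← seqAvg_const_mul, ← seqAvg_add, ← seqAvg_add]
    change _ = seqAvg (fun k => pathTime v (k + 1) ^ 2 - pathTime v k ^ 2) n - _ - _
    rw [← seqAvg_sub, ← seqAvg_sub]
    simp only [seqAvg]
    congr 1
    refine Finset.sum_congr rfl fun k _ => ?_
    have i1 : Integrable (fun p => systemStep (pathTime v k) p ^ 2 - pathTime v k ^ 2 - p.2 ^ 2)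
      ((expMeasure lam).prod F) := linearGrowth_systemStep_sq_sub.integrable hlam hF hsq (hT k)
    have i2 := hsq.comp_snd (expMeasure lam)
    have i3 : Integrable (fun p => systemStep (pathTime v k) p ^ 2) ((expMeasure lam).prod F) :=
      ((i1.add i2).add (integrable_const (pathTime v k ^ 2))).congr
        (ae_of_all _ fun p => by simp only [Pi.add_apply]; ring)
    have i4 : Integrable (fun p => systemStep (pathTime v k) p ^ 2 - pathTime v k ^ 2)
      ((expMeasure lam).prod F) := i3.sub (integrable_const _)
    rw [integral_sub i4 i2, integral_sub i3 (integrable_const _),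
      integral_systemStep_sq hlam hsq (hT k), integral_fun_snd (fun s : ℝ => s ^ 2), pathTime_succ]
    simp
    ring
  rw [e1, pathTime_zero]
  simp only [seqAvg]
  ring

/-- A sandwich. From below, `(1 - e^{-rT})/r ≤ T`, and the averages of the left side tend to the
Pollaczek-Khinchine mean `c` as first `n → ∞` and then `r ↓ 0`. From above, the balance of `t²` with
its boundary term discarded gives the same `c`. Equality then forces the boundary term to vanish. -/
theorem IsBackwardLimit.ae_tendsto_avg_pathTime (hL : IsBackwardLimit lam F L)
    (hlam : 0 < lam) (hF : ∀ᵐ s ∂F, 0 ≤ s) (hsq : Integrable (fun x : ℝ => x ^ 2) F)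
    (hload : lam * ∫ s, s ∂F < 1) :
    ∀ᵐ v ∂inputLaw lam F,
      Tendsto (seqAvg (pathTime v)) atTop
        (𝓝 ((∫ s, s ∂F) + lam * (∫ s, s ^ 2 ∂F) / (2 * (1 - lam * ∫ s, s ∂F)))) ∧
      Tendsto (fun n : ℕ => pathTime v n ^ 2 / n) atTop (𝓝 0) := by
  have hPK := tendsto_one_sub_transform_div hF hsq hload
  set H : ℝ → ℝ := fun r => r * (1 - lam * ∫ s, s ∂F) * (∫ s, Real.exp (-(r * s)) ∂F) /
        (r - lam + lam * ∫ s, Real.exp (-(r * s)) ∂F)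
  set b := ∫ s, s ∂F
  set c := b + lam * (∫ s, s ^ 2 ∂F) / (2 * (1 - lam * b)) with hc
  have hκ : 0 < 2 * (1 / lam - b) := by
    have : b < 1 / lam := by rw [lt_div_iff₀ hlam]; linarith
    linarith
  -- A sequence keeps the exceptional sets countable in number, and values below `lam` avoid the
  -- resonant rate.
  obtain ⟨r, -, hr0, hrlim⟩ := exists_seq_strictAnti_tendsto' (x := (0 : ℝ)) (y := lam) hlam
  have hrt : Tendsto r atTop (𝓝[>] 0) := tendsto_nhdsWithin_iff.2
    ⟨hrlim, Eventually.of_forall fun n => (hr0 n).1⟩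
  have hPK' := hPK.comp hrt
  filter_upwards [ae_all_iff.2 fun j => hL.ae_tendsto_avg_exp hlam hF hsq hload (hr0 j).1 (hr0 j).2.ne,
    hL.ae_tendsto_sq_div_add_avg hlam hF hsq, ae_inputs_nonneg hF] with v h1 h2 hv
  have hT := pathTime_nonneg (fun i => (hv i).2)
  have hcκ : (∫ s, s ^ 2 ∂F) + 2 * (1 / lam - b) * b = 2 * (1 / lam - b) * c := by
    have : 1 - lam * b ≠ 0 := by linarith
    rw [hc]; field_simp; ring
  rw [hcκ] at h2
  have hconv : Tendsto (seqAvg (pathTime v)) atTop (𝓝 c) := by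
    refine tendsto_order.2 ⟨fun a ha => ?_, fun a ha => ?_⟩
    · obtain ⟨j, hj⟩ := (hPK'.eventually (lt_mem_nhds ha)).exists
      have hrj := (hr0 j).1
      have h3 : Tendsto (fun n => (1 - seqAvg (fun k => Real.exp (-(r j * pathTime v k))) n) / r j)
        atTop (𝓝 ((1 - H (r j)) / r j)) := ((h1 j).const_sub 1).div_const _
      filter_upwards [h3.eventually (lt_mem_nhds hj), eventually_ne_atTop 0] with n hn hn0
      refine hn.trans_le ?_
      rw [div_le_iff₀ hrj, mul_comm, ← seqAvg_const_mul, ← seqAvg_const 1 hn0, ← seqAvg_sub]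
      simp only [seqAvg]
      gcongr with k _
      have := Real.add_one_le_exp (-(r j * pathTime v k))
      linarith
    · have h3 := h2.div_const (2 * (1 / lam - b))
      rw [mul_div_cancel_left₀ _ hκ.ne'] at h3
      filter_upwards [h3.eventually (gt_mem_nhds ha)] with n hn
      refine lt_of_le_of_lt ?_ hn
      rw [le_div_iff₀ hκ]
      have : 0 ≤ pathTime v n ^ 2 / n := by positivity
      linarith
  refine ⟨hconv, ?_⟩
  have := h2.sub (hconv.const_mul (2 * (1 / lam - b)))
  rw [sub_self] at this
  exact this.congr fun n => add_sub_cancel_right _ _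

theorem IsBackwardLimit.ae_tendsto_avg_area (hL : IsBackwardLimit lam F L)
    (hlam : 0 < lam) (hF : ∀ᵐ s ∂F, 0 ≤ s) (hsq : Integrable (fun x : ℝ => x ^ 2) F)
    (hload : lam * ∫ s, s ∂F < 1) :
    ∀ᵐ v ∂inputLaw lam F,
      Tendsto (seqAvg fun k => pathTime v (k + 1) * (v k).1 + (v k).1 ^ 2 / 2) atTop
        (𝓝 ((lam * (∫ s, s ^ 2 ∂F) / (2 * (1 - lam * ∫ s, s ∂F)) + 1 / lam +
          (1 - lam * ∫ s, s ∂F) * (1 - ∫ s, Real.exp (-(lam * s)) ∂F) /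
          (lam * ∫ s, Real.exp (-(lam * s)) ∂F)) / lam)) := by
  filter_upwards [hL.ae_tendsto_average_sub_mean hlam hF hsq linearGrowth_systemStep_mul,
    hL.ae_tendsto_avg_exp_rate hlam hF hsq, hL.ae_tendsto_avg_mul_exp_rate hlam hF hsq,
    hL.ae_tendsto_avg_pathTime hlam hF hsq hload, ae_inputs_nonneg hF] with v h1 h2 h3 ⟨h4, _⟩ hv
  have hT := pathTime_nonneg (fun i => (hv i).2)
  set m := (1 - lam * ∫ s, s ∂F) * (1 - ∫ s, Real.exp (-(lam * s)) ∂F) /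
          (lam * ∫ s, Real.exp (-(lam * s)) ∂F)
  set b := ∫ s, s ∂F
  have h5 := h1.add ((((h4.const_mul (1 / lam)).add (h3.const_mul (1 / lam))).add
    (h2.const_mul (2 / lam ^ 2))).add (tendsto_seqAvg_const (b / lam - 1 / lam ^ 2)))
  have e0 : 0 + (1 / lam * (b + lam * (∫ s, s ^ 2 ∂F) / (2 * (1 - lam * b))) + 1 / lam * m +
      2 / lam ^ 2 * (1 - lam * b) + (b / lam - 1 / lam ^ 2)) =
      (lam * (∫ s, s ^ 2 ∂F) / (2 * (1 - lam * b)) + 1 / lam + m) / lam := by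
    have : 1 - lam * b ≠ 0 := by linarith
    field_simp; ring
  rw [e0] at h5
  refine h5.congr fun n => ?_
  rw [← seqAvg_const_mul, ← seqAvg_const_mul, ← seqAvg_const_mul, ← seqAvg_add, ← seqAvg_add,
    ← seqAvg_add]
  simp only [seqAvg]
  rw [← add_div, ← Finset.sum_add_distrib]
  congr 1
  refine Finset.sum_congr rfl fun k _ => ?_
  rw [integral_systemStep_mul hlam hsq (hT k), pathTime_succ]
  ring

end Averages

/-! ## The age process along a path -/

section Path

variable {x s : ℕ → ℝ}

theorem arrivalTime_succ (x : ℕ → ℝ) (n : ℕ) :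
    arrivalTime x (n + 1) = arrivalTime x n + x n := Finset.sum_range_succ _ _

theorem monotone_arrivalTime (hx : ∀ i, 0 < x i) : Monotone (arrivalTime x) :=
  monotone_nat_of_le_succ fun n => by rw [arrivalTime_succ]; linarith [hx n]

theorem departureTime_zero (x s : ℕ → ℝ) : departureTime x s 0 = 0 := rfl

theorem departureTime_succ (x s : ℕ → ℝ) (n : ℕ) : departureTime x s (n + 1) =
    max (departureTime x s n) (arrivalTime x (n + 1)) + s n := rfl

theorem monotone_departureTime (hs : ∀ i, 0 ≤ s i) : Monotone (departureTime x s) :=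
  monotone_nat_of_le_succ fun n => by
    rw [departureTime_succ]
    exact (le_max_left _ _).trans (le_add_of_nonneg_right (hs n))

theorem departureTime_nonneg (hs : ∀ i, 0 ≤ s i) (n : ℕ) : 0 ≤ departureTime x s n :=
  monotone_departureTime (x := x) hs (Nat.zero_le n)

theorem arrivalTime_le_departureTime (hs : ∀ i, 0 ≤ s i) (n : ℕ) :
    arrivalTime x n ≤ departureTime x s n := by
  cases n with
  | zero => simp [arrivalTime, departureTime]
  | succ n =>
    rw [departureTime_succ]
    exact (le_max_right _ _).trans (le_add_of_nonneg_right (hs n))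

theorem latestReceived_eq (hs : ∀ i, 0 ≤ s i) {t : ℝ} {k : ℕ} (h1 : departureTime x s k ≤ t)
    (h2 : t < departureTime x s (k + 1)) : latestReceived x s t = k := by
  refine IsGreatest.csSup_eq ⟨h1, fun j hj => ?_⟩
  by_contra! h
  exact absurd (hj.out.trans_lt h2) (not_lt.2 (monotone_departureTime hs h))

theorem exists_departureTime_le_lt (hs : ∀ i, 0 ≤ s i)
    (hd : Tendsto (departureTime x s) atTop atTop) {t : ℝ} (ht : 0 ≤ t) :
    ∃ k, departureTime x s k ≤ t ∧ t < departureTime x s (k + 1) ∧ latestReceived x s t = k := by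
  classical
  have hex : ∃ k, t < departureTime x s k := (hd.eventually_gt_atTop t).exists
  have h0 : Nat.find hex ≠ 0 := fun h => by
    have := Nat.find_spec hex
    rw [h, departureTime_zero] at this
    linarith
  obtain ⟨k, hk⟩ := Nat.exists_eq_succ_of_ne_zero h0
  have h1 : departureTime x s k ≤ t := not_lt.1 (Nat.find_min hex (by omega))
  have h2 : t < departureTime x s (k + 1) := by
    have := Nat.find_spec hex
    rwa [hk] at this
  exact ⟨k, h1, h2, latestReceived_eq hs h1 h2⟩

/-- A jointly measurable version of the age, extended by zero to negative times. -/
noncomputable def measurableAge (x s : ℕ → ℝ) (t : ℝ) : ℝ :=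
  if 0 ≤ t then t - ∑' k, (if departureTime x s (k + 1) ≤ t then x k else 0) else 0

theorem measurableAge_eq (hs : ∀ i, 0 ≤ s i) {t : ℝ} (ht : 0 ≤ t) {k : ℕ}
    (h1 : departureTime x s k ≤ t) (h2 : t < departureTime x s (k + 1)) :
    measurableAge x s t = t - arrivalTime x k := by
  rw [measurableAge, if_pos ht, tsum_eq_sum (s := Finset.range k) fun j hj => ?_]
  · congr 1
    refine Finset.sum_congr rfl fun j hj => if_pos ?_
    exact (monotone_departureTime hs (Finset.mem_range.1 hj)).trans h1
  · refine if_neg (not_le.2 (h2.trans_le (monotone_departureTime hs ?_)))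
    have := Finset.mem_range.not.1 hj
    omega

theorem age_eq_measurableAge (hs : ∀ i, 0 ≤ s i)
    (hd : Tendsto (departureTime x s) atTop atTop) {t : ℝ} (ht : 0 ≤ t) :
    age x s t = measurableAge x s t := by
  obtain ⟨k, h1, h2, h3⟩ := exists_departureTime_le_lt hs hd ht
  rw [measurableAge_eq hs ht h1 h2, age, h3]

/-- Joint measurability is what Fubini needs when the queue path is frozen and only the decisions
are random. -/
theorem measurable_measurableAge_uncurry :
    Measurable fun q : (ℕ → ℝ × ℝ) × ℝ =>
      measurableAge (fun i => (q.1 i).1) (fun i => (q.1 i).2) q.2 := by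
  have hX : ∀ k, Measurable fun q : (ℕ → ℝ × ℝ) × ℝ => (q.1 k).1 := fun k => by fun_prop
  have hA : ∀ k, Measurable fun q : (ℕ → ℝ × ℝ) × ℝ => arrivalTime (fun i => (q.1 i).1) k :=
    fun k => Finset.measurable_fun_sum _ fun i _ => hX i
  have hD : ∀ k, Measurable fun q : (ℕ → ℝ × ℝ) × ℝ =>
      departureTime (fun i => (q.1 i).1) (fun i => (q.1 i).2) k := fun k => by
    induction k with
    | zero => exact measurable_const
    | succ k ih =>
      simp only [departureTime_succ]
      exact (ih.max (hA (k + 1))).add (by fun_prop)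
  refine Measurable.ite (measurableSet_le measurable_const measurable_snd)
    (measurable_snd.sub (Measurable.tsum fun k => ?_)) measurable_const
  exact Measurable.ite (measurableSet_le (hD (k + 1)) measurable_snd) (hX k) measurable_const

theorem measurable_measurableAge (x s : ℕ → ℝ) : Measurable (measurableAge x s) :=
  (measurable_measurableAge_uncurry).comp
    (measurable_prodMk_left (x := fun i => (x i, s i)))

theorem measurableAge_nonneg (hs : ∀ i, 0 ≤ s i)
    (hd : Tendsto (departureTime x s) atTop atTop) (t : ℝ) : 0 ≤ measurableAge x s t := by
  rcases lt_or_ge t 0 with h | h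
  · simp [measurableAge, not_le.2 h]
  · obtain ⟨k, h1, h2, -⟩ := exists_departureTime_le_lt hs hd h
    rw [measurableAge_eq hs h h1 h2]
    linarith [arrivalTime_le_departureTime (x := x) hs k]

theorem measurableAge_le (hx : ∀ i, 0 < x i) (hs : ∀ i, 0 ≤ s i)
    (hd : Tendsto (departureTime x s) atTop atTop)
    (t : ℝ) : measurableAge x s t ≤ max t 0 := by
  rcases lt_or_ge t 0 with h | h
  · simp [measurableAge, not_le.2 h]
  · obtain ⟨k, h1, h2, -⟩ := exists_departureTime_le_lt hs hd h
    rw [measurableAge_eq hs h h1 h2, max_eq_left h]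
    have : arrivalTime x 0 ≤ arrivalTime x k := monotone_arrivalTime hx (Nat.zero_le k)
    have h0 : arrivalTime x 0 = 0 := by simp [arrivalTime]
    linarith

/-- The age has slope one and only jumps down, at departures. This one-sided bound is the regularity
that the sampling theorem uses. -/
theorem measurableAge_add_le (hx : ∀ i, 0 < x i) (hs : ∀ i, 0 ≤ s i)
    (hd : Tendsto (departureTime x s) atTop atTop)
    (t u : ℝ) (hu : 0 ≤ u) :
    measurableAge x s (t + u) ≤ measurableAge x s t + u := by
  rcases lt_or_ge t 0 with h | h
  · refine (measurableAge_le hx hs hd _).trans (max_le ?_ ?_) <;>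
    linarith [measurableAge_nonneg hs hd t]
  · obtain ⟨k, h1, h2, -⟩ := exists_departureTime_le_lt hs hd h
    obtain ⟨j, h3, h4, -⟩ := exists_departureTime_le_lt hs hd (add_nonneg h hu)
    rw [measurableAge_eq hs h h1 h2, measurableAge_eq hs (add_nonneg h hu) h3 h4]
    have hkj : k ≤ j := by
      by_contra! hlt
      have := monotone_departureTime (x := x) hs hlt
      linarith
    linarith [monotone_arrivalTime hx hkj]

theorem intervalIntegrable_measurableAge (hx : ∀ i, 0 < x i) (hs : ∀ i, 0 ≤ s i)
    (hd : Tendsto (departureTime x s) atTop atTop)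
    (a b : ℝ) :
    IntervalIntegrable (measurableAge x s) volume a b :=
  intervalIntegrable_of_le_posPart (measurable_measurableAge x s)
    (measurableAge_nonneg hs hd) (measurableAge_le hx hs hd) a b

/-- The area under the age up to the departure of update `n`. -/
theorem integral_measurableAge_departureTime (hx : ∀ i, 0 < x i) (hs : ∀ i, 0 ≤ s i)
    (hd : Tendsto (departureTime x s) atTop atTop)
    (n : ℕ) :
    ∫ t in 0..departureTime x s n, measurableAge x s t =
      (∑ k ∈ Finset.range n, (systemTime x s (k + 1) * x k + x k ^ 2 / 2)) +
        systemTime x s n ^ 2 / 2 := by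
  induction n with
  | zero => simp [departureTime_zero, systemTime, arrivalTime]
  | succ n ih =>
    have hle := monotone_departureTime (x := x) hs (Nat.le_succ n)
    have h1 : ∫ t in departureTime x s n..departureTime x s (n + 1), measurableAge x s t =
        ∫ t in departureTime x s n..departureTime x s (n + 1), (t - arrivalTime x n) := by
      -- The right endpoint is removed because the age has already jumped there.
      rw [intervalIntegral.integral_of_le hle, intervalIntegral.integral_of_le hle,
        integral_Ioc_eq_integral_Ioo, integral_Ioc_eq_integral_Ioo]
      refine setIntegral_congr_fun measurableSet_Ioo fun t ht => ?_
      exact measurableAge_eq hs ((departureTime_nonneg hs n).trans ht.1.le) ht.1.le ht.2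
    rw [← intervalIntegral.integral_add_adjacent_intervals
      (intervalIntegrable_measurableAge hx hs hd 0 (departureTime x s n))
      (intervalIntegrable_measurableAge hx hs hd _ _), ih, h1,
      intervalIntegral.integral_comp_sub_right (fun t => t), integral_id, Finset.sum_range_succ]
    simp only [systemTime, arrivalTime_succ]
    ring

/-- At departures the integral is asymptotic to `nγ` and the time to `nm`. Other times lie between
consecutive departures, whose ratios have the same limit because the integral is monotone. -/
theorem tendsto_integral_measurableAge_div (hx : ∀ i, 0 < x i) (hs : ∀ i, 0 ≤ s i)
    (hd : Tendsto (departureTime x s) atTop atTop)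
    {m γ : ℝ} (hm : 0 < m)
    (ha : Tendsto (fun n : ℕ => arrivalTime x n / n) atTop (𝓝 m))
    (hT : Tendsto (fun n : ℕ => systemTime x s n / n) atTop (𝓝 0))
    (hT2 : Tendsto (fun n : ℕ => systemTime x s n ^ 2 / n) atTop (𝓝 0))
    (hS : Tendsto (seqAvg fun k => systemTime x s (k + 1) * x k + x k ^ 2 / 2) atTop (𝓝 γ)) :
    Tendsto (fun t => (∫ y in 0..t, measurableAge x s y) / t) atTop (𝓝 (γ / m)) := by
  set I : ℝ → ℝ := fun t => ∫ y in 0..t, measurableAge x s y with hI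
  set d := departureTime x s
  have hI1 : Tendsto (fun n : ℕ => I (d n) / n) atTop (𝓝 γ) := by
    have h := hS.add (hT2.div_const 2)
    rw [zero_div, add_zero] at h
    refine h.congr fun n => ?_
    change _ = (∫ y in 0..departureTime x s n, measurableAge x s y) / n
    rw [integral_measurableAge_departureTime hx hs hd n, seqAvg]
    ring
  have hd1 : Tendsto (fun n : ℕ => d n / n) atTop (𝓝 m) := by
    have h := ha.add hT
    rw [add_zero] at h
    refine h.congr fun n => ?_
    simp only [systemTime]
    rw [← add_div, add_sub_cancel]
  have hmono : ∀ a b, 0 ≤ a → a ≤ b → I a ≤ I b := fun a b h0 h =>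
    intervalIntegral.integral_mono_interval le_rfl h0 h
      (ae_of_all _ (measurableAge_nonneg hs hd)) (intervalIntegrable_measurableAge hx hs hd _ _)
  have hI0 : ∀ t, 0 ≤ t → 0 ≤ I t := fun t ht =>
    intervalIntegral.integral_nonneg ht fun y _ => measurableAge_nonneg hs hd y
  have hN : Tendsto (latestReceived x s) atTop atTop := by
    refine tendsto_atTop.2 fun n => ?_
    filter_upwards [eventually_ge_atTop (d n), eventually_ge_atTop 0] with t ht ht0
    obtain ⟨k, h1, h2, h3⟩ := exists_departureTime_le_lt hs hd ht0
    rw [h3]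
    by_contra! hlt
    have := monotone_departureTime (x := x) hs hlt
    exact absurd (h2.trans_le this) (not_lt.2 ht)
  have hup : Tendsto (fun n : ℕ => I (d (n + 1)) / d n) atTop (𝓝 (γ / m)) := by
    have h := ((hI1.comp (tendsto_add_atTop_nat 1)).mul tendsto_add_one_div_nat).div hd1 hm.ne'
    rw [mul_one] at h
    refine h.congr' ?_
    filter_upwards [eventually_gt_atTop 0] with n hn
    have : (0 : ℝ) < n := by exact_mod_cast hn
    simp only [Pi.div_apply, Function.comp]
    push_cast
    field_simp
  have hlo : Tendsto (fun n : ℕ => I (d n) / d (n + 1)) atTop (𝓝 (γ / m)) := by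
    have h := (hI1.div tendsto_add_one_div_nat one_ne_zero).div
      (hd1.comp (tendsto_add_atTop_nat 1)) hm.ne'
    rw [div_one] at h
    refine h.congr' ?_
    filter_upwards [eventually_gt_atTop 0] with n hn
    have : (0 : ℝ) < n := by exact_mod_cast hn
    simp only [Pi.div_apply, Function.comp]
    push_cast
    field_simp
  refine tendsto_of_tendsto_of_tendsto_of_le_of_le' (hlo.comp hN) (hup.comp hN) ?_ ?_
  · filter_upwards [eventually_gt_atTop 0] with t ht
    obtain ⟨k, h1, h2, h3⟩ := exists_departureTime_le_lt hs hd (le_of_lt ht)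
    simp only [Function.comp, h3]
    have hk := departureTime_nonneg (x := x) hs k
    exact div_le_div₀ (hI0 _ ht.le) (hmono _ _ hk h1) ht h2.le
  · filter_upwards [eventually_gt_atTop 0, hN.eventually (hd.eventually_gt_atTop 0)] with t ht hpos
    obtain ⟨k, h1, h2, h3⟩ := exists_departureTime_le_lt hs hd (le_of_lt ht)
    simp only [Function.comp, h3] at hpos ⊢
    exact div_le_div₀ (hI0 _ (departureTime_nonneg hs _)) (hmono _ _ ht.le h2.le) hpos h1

end Path

/-! ## Counting decisions -/

theorem tendsto_decisionCount {z : ℕ → ℝ} (hz : Tendsto (decisionTime z) atTop atTop)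
    (hpos : ∀ i, 0 < z i) : Tendsto (decisionCount z) atTop atTop := by
  refine tendsto_atTop.2 fun n => ?_
  filter_upwards [eventually_ge_atTop (decisionTime z n)] with T hT
  -- Finiteness matters, since `Set.ncard` of an infinite set is `0`.
  have hfin : {j : ℕ | 1 ≤ j ∧ decisionTime z j ≤ T}.Finite := by
    obtain ⟨N, hN⟩ := (hz.eventually_gt_atTop T).exists_forall_of_atTop
    refine (Set.finite_Iio N).subset fun j hj => ?_
    by_contra h
    exact absurd (hN j (not_lt.1 h)) (not_lt.2 hj.2)
  have hsub : (Finset.Icc 1 n : Set ℕ) ⊆ {j : ℕ | 1 ≤ j ∧ decisionTime z j ≤ T} := fun j hj => by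
    have hj := Finset.mem_Icc.1 (Finset.mem_coe.1 hj)
    exact ⟨hj.1, (monotone_decisionTime hpos hj.2).trans hT⟩
  have := Set.ncard_le_ncard hsub hfin
  rwa [Set.ncard_coe_finset, Nat.card_Icc, Nat.add_sub_cancel] at this

theorem sum_Icc_one_eq_sum_range (f : ℕ → ℝ) (n : ℕ) :
    ∑ j ∈ Finset.Icc 1 n, f j = ∑ i ∈ Finset.range n, f (i + 1) := by
  induction n with
  | zero => simp
  | succ n ih => rw [Finset.sum_Icc_succ_top (by omega), Finset.sum_range_succ, ih]

/-! ## The joint law of the input -/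

/-- A cylinder over `s` is also one over three copies of a common index set `A`, with full factors
outside `s`. In that form it splits into pairs and decisions. -/
theorem map_sumElim_prod_infinitePi (μ : ℕ ⊕ (ℕ ⊕ ℕ) → Measure ℝ)
    [∀ i, IsProbabilityMeasure (μ i)] :
    ((Measure.infinitePi fun i => (μ (.inl i)).prod (μ (.inr (.inl i)))).prod
      (Measure.infinitePi fun i => μ (.inr (.inr i)))).map
        (fun q (j : ℕ ⊕ (ℕ ⊕ ℕ)) => Sum.elim (fun i => (q.1 i).1)
          (Sum.elim (fun i => (q.1 i).2) q.2) j) =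
      Measure.infinitePi μ := by
  classical
  refine Measure.eq_infinitePi _ fun s t ht => ?_
  have hmeas : Measurable fun (q : (ℕ → ℝ × ℝ) × (ℕ → ℝ)) (j : ℕ ⊕ (ℕ ⊕ ℕ)) =>
      Sum.elim (fun i => (q.1 i).1) (Sum.elim (fun i => (q.1 i).2) q.2) j := by
    refine measurable_pi_iff.2 fun j => ?_
    rcases j with i | i | i <;> simp only [Sum.elim_inl, Sum.elim_inr] <;> fun_prop
  set A : Finset ℕ := s.toLeft ∪ s.toRight.toLeft ∪ s.toRight.toRight
  set big := A.disjSum (A.disjSum A)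
  have hsub : s ⊆ big := fun j hj => by
    rcases j with i | i | i <;> simp [big, A, hj]
  set t' : ℕ ⊕ (ℕ ⊕ ℕ) → Set ℝ := fun j => if j ∈ s then t j else Set.univ with ht'
  have ht'm : ∀ j, MeasurableSet (t' j) := fun j => by
    simp only [ht']; split_ifs; exacts [ht j, .univ]
  have hset : Set.pi (s : Set (ℕ ⊕ (ℕ ⊕ ℕ))) t = Set.pi (big : Set (ℕ ⊕ (ℕ ⊕ ℕ))) t' := by
    ext x
    simp only [Set.mem_pi, Finset.mem_coe, ht']
    refine ⟨fun h j _ => ?_, fun h j hj => ?_⟩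
    · split_ifs with hj
      exacts [h j hj, trivial]
    · have := h j (hsub hj)
      rwa [if_pos hj] at this
  have hprod : ∏ j ∈ s, μ j (t j) = ∏ j ∈ big, μ j (t' j) := by
    rw [← Finset.prod_subset hsub fun j _ hj => by simp [ht', hj]]
    exact Finset.prod_congr rfl fun j hj => by simp [ht', hj]
  have hpre : (fun (q : (ℕ → ℝ × ℝ) × (ℕ → ℝ)) (j : ℕ ⊕ (ℕ ⊕ ℕ)) =>
      Sum.elim (fun i => (q.1 i).1) (Sum.elim (fun i => (q.1 i).2) q.2) j) ⁻¹'
        Set.pi (big : Set (ℕ ⊕ (ℕ ⊕ ℕ))) t' =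
      (Set.pi (A : Set ℕ) fun i => t' (.inl i) ×ˢ t' (.inr (.inl i))) ×ˢ
        Set.pi (A : Set ℕ) fun i => t' (.inr (.inr i)) := by
    ext q
    simp only [Set.mem_preimage, Set.mem_pi, Finset.mem_coe, Set.mem_prod, big, Sum.forall,
      Finset.inl_mem_disjSum, Finset.inr_mem_disjSum, Sum.elim_inl, Sum.elim_inr]
    grind
  rw [Measure.map_apply hmeas (.pi (Finset.countable_toSet s) fun j _ => ht j), hset, hpre, hprod,
    Measure.prod_prod, Measure.infinitePi_pi _ fun i _ => (ht'm _).prod (ht'm _),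
    Measure.infinitePi_pi _ fun i _ => ht'm _, Finset.prod_disjSum, Finset.prod_disjSum]
  simp only [Measure.prod_prod, Finset.prod_mul_distrib, mul_assoc]

theorem IsMG1MInput.hasLaw {Ω : Type*} [MeasurableSpace Ω] {P : Measure Ω} {lam nu : ℝ}
    {F : Measure ℝ} {X S Z : ℕ → Ω → ℝ} [IsProbabilityMeasure F]
    [IsProbabilityMeasure (expMeasure lam)] [IsProbabilityMeasure (expMeasure nu)]
    (h : IsMG1MInput P lam nu F X S Z) :
    HasLaw (fun ω => ((fun i => (X i ω, S i ω)), fun i => Z i ω))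
      ((inputLaw lam F).prod (Measure.infinitePi fun _ : ℕ => expMeasure nu)) P := by
  set μ : ℕ ⊕ (ℕ ⊕ ℕ) → Measure ℝ :=
    Sum.elim (fun _ => expMeasure lam) (Sum.elim (fun _ => F) fun _ => expMeasure nu)
  have hμ : ∀ i, IsProbabilityMeasure (μ i) := by
    rintro (i | i | i) <;> simp only [μ, Sum.elim_inl, Sum.elim_inr] <;> infer_instance
  have hX : ∀ i, HasLaw (Sum.elim X (Sum.elim S Z) i) (μ i) P := by
    rintro (i | i | i)
    exacts [h.interarrival_law i, h.service_law i, h.interdecision_law i]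
  have h1 := h.indep.hasLaw_infinitePi hX (aemeasurable_pi_iff.2 fun i => (hX i).aemeasurable)
  rw [← map_sumElim_prod_infinitePi μ] at h1
  set Ψ : (ℕ ⊕ (ℕ ⊕ ℕ) → ℝ) → (ℕ → ℝ × ℝ) × (ℕ → ℝ) := fun w =>
    ((fun i => (w (.inl i), w (.inr (.inl i)))), fun i => w (.inr (.inr i)))
  have hΨ : Measurable Ψ := by fun_prop
  refine ⟨hΨ.comp_aemeasurable h1.aemeasurable, ?_⟩
  have h2 := AEMeasurable.map_map_of_aemeasurable hΨ.aemeasurable h1.aemeasurable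
  refine h2.symm.trans ?_
  rw [h1.map_eq, Measure.map_map hΨ]
  · exact Measure.map_id
  · refine measurable_pi_iff.2 fun j => ?_
    rcases j with i | i | i <;> simp only [Sum.elim_inl, Sum.elim_inr] <;> fun_prop

/-! ## The average age upon decisions -/

section Average

variable {lam nu : ℝ} {F : Measure ℝ} [IsProbabilityMeasure F]

theorem ae_tendsto_arrivalTime_div [IsProbabilityMeasure (expMeasure lam)] (hlam : 0 < lam) :
    ∀ᵐ v ∂inputLaw lam F,
      Tendsto (fun n : ℕ => arrivalTime (fun i => (v i).1) n / n) atTop (𝓝 (1 / lam)) := by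
  have hi : Integrable (fun x : ℝ => x) (expMeasure lam) := by
    simpa using integrable_pow_expMeasure hlam 1
  have hm : ∫ x, x ∂expMeasure lam = 1 / lam := by
    simpa using integral_pow_expMeasure hlam 1
  have h := ae_tendsto_average_infinitePi ((expMeasure lam).prod F) measurable_fst
    (hi.comp_fst F)
  rw [integral_fun_fst (fun x : ℝ => x)] at h
  simpa [hm, arrivalTime, inputLaw] using h

/-- Almost surely, the time average of the age and the average age sampled at the decision epochs
agree, and they are given by the area formula. -/
theorem ae_tendsto_average_age [IsProbabilityMeasure (expMeasure lam)]
    [IsProbabilityMeasure (expMeasure nu)] (hlam : 0 < lam) (hnu : 0 < nu)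
    (hF : ∀ᵐ s ∂F, 0 ≤ s) (hsq : Integrable (fun x : ℝ => x ^ 2) F)
    (hload : lam * ∫ s, s ∂F < 1) {L : (ℕ → ℝ × ℝ) → ℝ} (hL : IsBackwardLimit lam F L) {c : ℝ}
    (hc : c = lam * (∫ s, s ^ 2 ∂F) / (2 * (1 - lam * ∫ s, s ∂F)) + 1 / lam +
      (1 - lam * ∫ s, s ∂F) * (1 - ∫ s, Real.exp (-(lam * s)) ∂F) /
        (lam * ∫ s, Real.exp (-(lam * s)) ∂F)) :
    ∀ᵐ q ∂(inputLaw lam F).prod (Measure.infinitePi fun _ : ℕ => expMeasure nu),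
      Tendsto (fun T => averageAgeUponDecisions (fun i => (q.1 i).1) (fun i => (q.1 i).2) q.2 T)
        atTop (𝓝 c) := by
  have harr := ae_tendsto_arrivalTime_div (F := F) hlam
  have hpath : ∀ᵐ v ∂inputLaw lam F, Tendsto
      (departureTime (fun i => (v i).1) (fun i => (v i).2)) atTop atTop := by
    filter_upwards [ae_inputs_nonneg hF, harr] with v hv ha
    exact tendsto_atTop_mono (arrivalTime_le_departureTime fun i => (hv i).2)
      (tendsto_atTop_of_tendsto_div (by positivity) ha)
  have hdec : ∀ᵐ z ∂(Measure.infinitePi fun _ : ℕ => expMeasure nu),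
      (∀ i, 0 < z i) ∧ Tendsto (decisionTime z) atTop atTop := by
    filter_upwards [ae_forall_eval_infinitePi _ (ae_expMeasure_pos nu),
      ae_tendsto_decisionTime_div hnu] with z hz hd
    exact ⟨hz, tendsto_atTop_of_tendsto_div (by positivity) hd⟩
  have havg : ∀ᵐ q ∂(inputLaw lam F).prod (Measure.infinitePi fun _ : ℕ => expMeasure nu),
      Tendsto (fun n : ℕ => (∑ i ∈ Finset.range n, measurableAge (fun i => (q.1 i).1)
        (fun i => (q.1 i).2) (decisionTime q.2 (i + 1))) / n) atTop (𝓝 c) := by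
    -- For almost every fixed queue path the age is a deterministic function of time, and the
    -- sampling theorem applies to it.
    rw [Measure.ae_prod_iff_ae_ae]
    · filter_upwards [ae_inputs_nonneg hF, hpath, harr, hL.ae_tendsto_pathTime_div hF,
        hL.ae_tendsto_avg_pathTime hlam hF hsq hload,
        hL.ae_tendsto_avg_area hlam hF hsq hload] with v hv hd ha hT hT2 hS
      have hx := fun i => (hv i).1
      have hs := fun i => (hv i).2
      refine ae_tendsto_average_decisionTime hnu (measurable_measurableAge _ _)
        (measurableAge_nonneg hs hd) (measurableAge_le hx hs hd) (measurableAge_add_le hx hs hd) ?_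
      have h := tendsto_integral_measurableAge_div hx hs hd (one_div_pos.2 hlam) ha hT.1 hT2.2 hS
      rwa [← hc, div_div, mul_one_div_cancel hlam.ne', div_one] at h
    · refine measurableSet_tendsto_fun (fun n => ?_) measurable_const
      refine (Finset.measurable_fun_sum _ fun i _ => ?_).div_const _
      exact measurable_measurableAge_uncurry.comp
        (measurable_fst.prodMk ((measurable_decisionTime (i + 1)).comp measurable_snd))
  filter_upwards [havg, Measure.quasiMeasurePreserving_fst.ae (ae_inputs_nonneg hF),
    Measure.quasiMeasurePreserving_fst.ae hpath, Measure.quasiMeasurePreserving_snd.ae hdec]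
    with q hq hv hd hz
  refine (hq.comp (tendsto_decisionCount hz.2 hz.1)).congr fun T => ?_
  simp only [Function.comp, averageAgeUponDecisions, sum_Icc_one_eq_sum_range]
  congr 1
  refine Finset.sum_congr rfl fun i _ => (age_eq_measurableAge (fun i => (hv i).2) hd ?_).symm
  exact Finset.sum_nonneg fun i _ => (hz.1 i).le

end Average

/-! ## The steady-state system time -/

/-- The steady-state law is that of Loynes' limit `L`. Both claims depend on laws only, so they
transfer from the sequence space to `Ω`. -/
theorem exists_tendstoInDistribution_systemTime {Ω : Type*} [MeasurableSpace Ω] {P : Measure Ω}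
    [IsProbabilityMeasure P] {lam : ℝ} {F : Measure ℝ} {X S : ℕ → Ω → ℝ} [IsProbabilityMeasure F]
    [IsProbabilityMeasure (expMeasure lam)] (hlam : 0 < lam)
    (hF : ∀ᵐ s ∂F, 0 ≤ s) (hsq : Integrable (fun x : ℝ => x ^ 2) F)
    {L : (ℕ → ℝ × ℝ) → ℝ} (hL : IsBackwardLimit lam F L)
    (hlaw : HasLaw (fun ω i => (X i ω, S i ω)) (inputLaw lam F) P) :
    ∃ π : ProbabilityMeasure ℝ,
      TendstoInDistribution (fun (k : ℕ) (ω : Ω) =>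
        systemTime (fun i => X i ω) (fun i => S i ω) k) atTop id (fun _ => P) (π : Measure ℝ) ∧
      HasDerivAt (mgf id (π : Measure ℝ)) ((1 - lam * ∫ s, s ∂F) *
        (1 - ∫ s, Real.exp (-(lam * s)) ∂F) / (lam * ∫ s, Real.exp (-(lam * s)) ∂F)) (-lam) := by
  have hmap : ∀ k, P.map (fun ω => systemTime (fun i => X i ω) (fun i => S i ω) k) =
      (inputLaw lam F).map fun v => pathTime v k := fun k => by
    rw [← hlaw.map_eq, AEMeasurable.map_map_of_aemeasurable
      (measurable_pathTime k).aemeasurable hlaw.aemeasurable]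
    rfl
  have hdist := hL.tendstoInDistribution
  set π : ProbabilityMeasure ℝ :=
    ⟨(inputLaw lam F).map L, Measure.isProbabilityMeasure_map hL.measurable.aemeasurable⟩ with hπ
  refine ⟨π, ⟨fun k => (measurable_pathTime k).comp_aemeasurable hlaw.aemeasurable,
    aemeasurable_id, ?_⟩, ?_⟩
  · have h := hdist.tendsto
    convert! h using 1
    · exact congrArg Tendsto (funext fun k => Subtype.ext (hmap k))
    · exact congrArg 𝓝 (Subtype.ext Measure.map_id)
  · rw [← hL.integral_mul_exp_neg hlam hF hsq, hπ, ProbabilityMeasure.coe_mk,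
      mgf_id_map hL.measurable.aemeasurable]
    exact hL.hasDerivAt_mgf hlam

end UpdateDecide

theorem theorem1 {Ω : Type*} [MeasurableSpace Ω] (P : Measure Ω) [IsProbabilityMeasure P]
    (lam mu nu : ℝ) (hlam : 0 < lam) (hmu : 0 < mu) (hnu : 0 < nu)
    (F : Measure ℝ) (X S Z : ℕ → Ω → ℝ)
    (hsys : UpdateDecide.IsMG1MInput P lam nu F X S Z)
    (hmean : ∫ x, x ∂F = 1 / mu)
    (hsq : Integrable (fun x : ℝ => x ^ 2) F)
    (ρ om : ℝ) (hρ : ρ = lam / mu) (hρ1 : ρ < 1)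
    (hom : om = (1 - ρ) * (mgf id F (-lam) - 1) / (lam * mgf id F (-lam))) :
    (∃ π : ProbabilityMeasure ℝ,
      TendstoInDistribution
        (fun (k : ℕ) (ω : Ω) => UpdateDecide.systemTime (fun i => X i ω) (fun i => S i ω) k)
        atTop id (fun _ => P) (π : Measure ℝ) ∧
      HasDerivAt (mgf id (π : Measure ℝ)) (-om) (-lam)) ∧
    ∀ᵐ ω ∂P, Tendsto
      (fun T : ℝ => UpdateDecide.averageAgeUponDecisions
        (fun i => X i ω) (fun i => S i ω) (fun i => Z i ω) T)
      atTop
      (𝓝 ((lam ^ 2 * (∫ x, x ^ 2 ∂F) + 2 * (1 - ρ) * (1 - lam * om)) /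
        (2 * lam * (1 - ρ)))) := by
  have hFp : IsProbabilityMeasure F := by
    rw [← (hsys.service_law 0).map_eq]
    exact Measure.isProbabilityMeasure_map (hsys.service_law 0).aemeasurable
  have := isProbabilityMeasure_expMeasure hlam
  have := isProbabilityMeasure_expMeasure hnu
  have hF : ∀ᵐ s ∂F, 0 ≤ s := by
    rw [ae_iff]
    simp only [not_le]
    exact hsys.service_nonneg
  have hρ' : lam * ∫ s, s ∂F = ρ := by rw [hmean, hρ, mul_one_div]
  have hload : lam * ∫ s, s ∂F < 1 := hρ' ▸ hρ1
  have hG : mgf id F (-lam) = ∫ s, Real.exp (-(lam * s)) ∂F := by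
    simp only [mgf, id, neg_mul]
  have hGpos := UpdateDecide.integral_exp_neg_service_pos hlam hF
  obtain ⟨L, hLm, hLi, hLt⟩ := UpdateDecide.exists_backwardTime_limit hlam hF hsq hload
  have hL : UpdateDecide.IsBackwardLimit lam F L :=
    ⟨hLm, hLi, hLt.mono fun _ h => h.1, hLt.mono fun _ h => h.2⟩
  have hlaw := hsys.hasLaw
  have hom' : -om = (1 - lam * ∫ s, s ∂F) * (1 - ∫ s, Real.exp (-(lam * s)) ∂F) /
      (lam * ∫ s, Real.exp (-(lam * s)) ∂F) := by
    rw [hom, hG, hρ', ← neg_div]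
    ring
  constructor
  · rw [hom']
    refine UpdateDecide.exists_tendstoInDistribution_systemTime hlam hF hsq hL
      -- The steady state involves only arrivals and services, so the decisions are marginalized
      -- out.
      ⟨measurable_fst.comp_aemeasurable hlaw.aemeasurable, ?_⟩
    have h := AEMeasurable.map_map_of_aemeasurable
      (measurable_fst (α := ℕ → ℝ × ℝ) (β := ℕ → ℝ)).aemeasurable hlaw.aemeasurable
    rw [hlaw.map_eq, Measure.map_fst_prod, measure_univ, one_smul] at h
    exact h.symm
  · refine ae_of_ae_map hlaw.aemeasurable (p := fun q => Tendsto (fun T =>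
      UpdateDecide.averageAgeUponDecisions (fun i => (q.1 i).1) (fun i => (q.1 i).2) q.2 T)
        atTop (𝓝 _)) ?_
    rw [hlaw.map_eq]
    refine UpdateDecide.ae_tendsto_average_age hlam hnu hF hsq hload hL ?_
    -- In the area formula the mean of `T e^{-λT}` is `-om`; what remains is to put the three terms
    -- over the denominator `2 * lam * (1 - ρ)`.
    rw [← hom', hρ']
    have : 1 - ρ ≠ 0 := by linarith
    field_simp
    ring
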